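/- Throughout, $d\ge 1$ and $c\ge 2$ are integers, $\mathbb R^d$ carries the supremum norm, $|S|$ is the diameter of a set $S$, $B(x,r)$ is the closed ball, $\|\nu\|$ is the total mass of a measure $\nu$. For $j\ge 0$ and $\mathbf k\in\{0,\dots,c^j-1\}^d$ let $I_{j,\mathbf k}=\prod_i[k_ic^{-j},(k_i+1)c^{-j})$ (the $c$-adic boxes of generation $j$), let $\mathbf k_{j,y}=(\lfloor c^jy_i\rfloor)_i$ be the index of the box of generation $j$ containing $y\in[0,1)^d$, and for a $c$-adic box $L$ let $f_L$ be the canonical affine map from $L$ onto $[0,1)^d$. For $1\le i\le d$ let $(\pi^{(i)}_0,\dots,\pi^{(i)}_{c-1})$ be a probability vector with positive components, and let $\mu^{(i)}$ be the associated multinomial measure on $[0,1]$, i.e. the law of $\sum_{n\ge1}X_nc^{-n}$ where the $X_n$ are independent with law $\pi^{(i)}$ on $\{0,\dots,c-1\}$. Let $\mu=\mu^{(1)}\otimes\cdots\otimes\mu^{(d)}$, $$\tau_\mu(s)=\liminf_{j\to\infty}-\tfrac1j\log_c\sum_{\mathbf k}\mu(I_{j,\mathbf k})^s,\qquad \tau_\mu^*(\alpha)=\inf_{s\in\mathbb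 R}\big(\alpha s-\tau_\mu(s)\big),\qquad \tau_{i}(s)=-\log_c\sum_{k=0}^{c-1}(\pi^{(i)}_k)^s .$$ For $q\in\mathbb R$ put $\pi^{(i)}_{q,k}=c^{\tau_i(q)}(\pi^{(i)}_k)^q$ and let $\mu_q$ be the product of the multinomial measures on $[0,1]$ associated with the vectors $(\pi^{(i)}_{q,k})_{0\le k<c}$, $1\le i\le d$. For $C>0$ and $\gamma>1/2$ let $$\varphi_C(r)=C|\log r|^{-1/2}(\log\log|\log r|)^{1/2},\qquad \psi_{C,\gamma}(r)=C|\log r|^{-1/2}(\log|\log r|)^{\gamma}\qquad(r>0\text{ small}).$$ **Proposition.** Let $q\in\mathbb R$. Then $\tau_\mu(s)=\sum_{i=1}^d\tau_i(s)$ for all $s\in\mathbb R$; $\tau_\mu$ is differentiable at $q$, and $\alpha=\tau_\mu'(q)$, $\beta=\tau_\mu^*(\alpha)$ satisfy $\alpha>0$, $0<\beta\le d$; the measures $\mu$ and $m:=\mu_q$ have support $[0,1]^d$. For every $\gamma>1/2$ there are $C>0$ and functions $\varphi,\psi:[0,\infty)\to\mathbb R$ which coincide with $\varphi_C$, $\psi_{C,\gamma}$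 on a right neighbourhood of $0$, are continuous and non-decreasing, vanish at $0$, are such that near $0^+$ the functions $r^{-\varphi(r)}$ and $r^{-\psi(r)}$ are non-increasing, $r^{-\varphi(r)}\to+\infty$ as $r\to0^+$ and, for every $\varepsilon>0$, $r^{\varepsilon-\varphi(r)}$ is non-decreasing near $0^+$, and which have the following properties. (P2) For $m$-almost every $y$ there is $j(y)$ such that for all $j\ge j(y)$ and all $\mathbf k\in\{0,\dots,c^j-1\}^d$ with $\|\mathbf k-\mathbf k_{j,y}\|_\infty\le1$, the box $I=I_{j,\mathbf k}$ satisfies $|I|^{\alpha+\psi(|I|)}\le\mu(I)\le|I|^{\alpha-\psi(|I|)}$. (P1) For $m$-almost every $y$ there is $j(y)$ such that for all $j\ge j(y)$ and all $\mathbf k\in\{0,\dots,c^j-1\}^d$ with $\|\mathbf k-\mathbf k_{j,y}\|_\infty\le1$, the box $I=I_{j,\mathbf k}$ satisfies $m(I)\le|I|^{\beta-\varphi(|I|)}$. (3) For every $c$-adic box $L$ of $[0,1)^d$ there is a measure $m^L$, equivalent to the restriction $m_{|L}$ (mutual absolute continuity), with $m^L\circ f_L^{-1}=m$; in particular (P1)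 holds with $m^L\circ f_L^{-1}$ in place of $m$. (4') With the measures $m^L$ of (3), let $E_n^L$ be the set of those $x\in L$ such that $m^L(I_{j,\mathbf k})\le(|I_{j,\mathbf k}|/|L|)^{\beta-\varphi(|I_{j,\mathbf k}|/|L|)}$ for all $j\ge n+\log_c(|L|^{-1})$ and all $\mathbf k\in\{0,\dots,c^j-1\}^d$ with $\|\mathbf k-\mathbf k_{j,x}\|_\infty\le1$, and let $n_L=\inf\{n\ge1:m^L(E_n^L)\ge\|m^L\|/2\}$. There is $J$ such that for every $j\ge J$ and every $c$-adic box $L$ of generation $j$ one has $n_L<\infty$, $n_L\le\log_c(|L|^{-1})\,\varphi(|L|)$ and $|L|^{\varphi(|L|)}\le\|m^L\|$. (Digit frequencies) Let $\phi_{k,n}(x)$ be the proportion of digits equal to $k$ among the first $n$ digits of the $c$-adic expansion of $x\in[0,1]$ (the digits of $x<1$ being $\lfloor c^nx\rfloor \bmod c$, $n\ge1$, and those of $1$ being all equal to $c-1$). Let $(x_n)$ be a sequence in $[0,1]^d$ and $(\lambda_n)$ a non-increasing sequence of positive reals converging to $0$ with $(0,1)^d\subset\limsup_{n\to\infty}B(x_n,\lambda_n/2)$.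 There is a non-increasing sequence of positive reals $\varepsilon_n\to0$ such that, for every $\delta\ge1$, if $$S_\delta=\bigcap_{N}\ \bigcup_{n\ge N:\ \mathcal F_n\text{ holds}}B(x_n,\lambda_n^\delta),$$ $$\mathcal F_n:\quad\big|\phi_{k,\lfloor\log_c(\lambda_n^{-1})\rfloor}(x_{n,i})-\pi^{(i)}_{q,k}\big|\le\varepsilon_n\quad\text{for all }1\le i\le d,\ 0\le k\le c-1,$$ then there is a finite positive Borel measure $m_\delta$ on $\mathbb R^d$ with $m_\delta(S_\delta)>0$ and $$\limsup_{r\to0^+}\frac{m_\delta(B(x,r))}{r^{\beta/\delta-(4+d)\varphi(r)}}<\infty\qquad\text{for every }x\in S_\delta .$$ -/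

import Mathlib

open Filter Topology MeasureTheory
open scoped ENNReal

noncomputable section

/-! ### `c`-adic boxes -/

/-- The `c`-adic box `∏ᵢ [kᵢ c⁻ʲ, (kᵢ + 1) c⁻ʲ)` of generation `j`. The boxes contained in
`[0,1)^d` are those with `kᵢ < c ^ j` for all `i`. The space `Fin d → ℝ` carries the supremum
norm. -/
def cBox {d : ℕ} (c j : ℕ) (k : Fin d → ℕ) : Set (Fin d → ℝ) :=
  {x | ∀ i, (k i : ℝ) / (c : ℝ) ^ j ≤ x i ∧ x i < ((k i : ℝ) + 1) / (c : ℝ) ^ j}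

/-- The multi-integer `k` such that the `c`-adic box of generation `j` indexed by `k`
contains `y`. -/
def boxIndex {d : ℕ} (c j : ℕ) (y : Fin d → ℝ) : Fin d → ℕ :=
  fun i => ⌊(c : ℝ) ^ j * y i⌋₊

/-- `k` is the index of a box of generation `j` of `[0,1)^d` which is at distance at most `1`
(for the supremum norm) from the index of the box that contains `y`. -/
def IsNeighbor {d : ℕ} (c j : ℕ) (y : Fin d → ℝ) (k : Fin d → ℕ) : Prop :=
  (∀ i, k i < c ^ j) ∧ ∀ i, |(k i : ℤ) - (boxIndex c j y i : ℤ)| ≤ 1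

/-- The canonical affine map of the box `cBox c j k` onto `[0,1)^d`. -/
def boxMap {d : ℕ} (c j : ℕ) (k : Fin d → ℕ) (x : Fin d → ℝ) : Fin d → ℝ :=
  fun i => (c : ℝ) ^ j * x i - (k i : ℝ)

/-! ### The spectrum `τ_μ` and its Legendre transform -/

/-- `τ_μ(q) = liminf_j -j⁻¹ log_c ∑_k μ(I_{j,k})^q`. -/
def tauSpectrum {d : ℕ} (c : ℕ) (μ : Measure (Fin d → ℝ)) (q : ℝ) : EReal :=
  liminf (fun j : ℕ =>
    ((-(j : ℝ)⁻¹ * Real.logb c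
      (∑ k : Fin d → Fin (c ^ j), (μ.real (cBox c j (fun i => (k i : ℕ)))) ^ q) : ℝ) : EReal))
    atTop

/-- `τ_μ^*(α) = inf_q (α q - τ_μ(q))`. -/
def tauLegendre {d : ℕ} (c : ℕ) (μ : Measure (Fin d → ℝ)) (α : ℝ) : EReal :=
  ⨅ q : ℝ, ((α * q : ℝ) : EReal) - tauSpectrum c μ q

/-! ### Gauge functions -/

/-- The function `C |log r|^{-1/2} (log log |log r|)^{1/2}`. -/
def gaugePhi (C r : ℝ) : ℝ :=
  C * |Real.log r| ^ (-(1 / 2) : ℝ) * (Real.log (Real.log |Real.log r|)) ^ (1 / 2 : ℝ)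

/-- The function `C |log r|^{-1/2} (log |log r|)^γ`. -/
def gaugePsi (C γ r : ℝ) : ℝ :=
  C * |Real.log r| ^ (-(1 / 2) : ℝ) * (Real.log |Real.log r|) ^ γ

/-- The conditions on the pair of gauge functions `φ`, `ψ` (functions on `[0, ∞)`). -/
structure GaugePair (φ ψ : ℝ → ℝ) : Prop where
  monotone_phi : MonotoneOn φ (Set.Ici 0)
  monotone_psi : MonotoneOn ψ (Set.Ici 0)
  continuous_phi : ContinuousOn φ (Set.Ici 0)
  continuous_psi : ContinuousOn ψ (Set.Ici 0)
  phi_zero : φ 0 = 0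
  psi_zero : ψ 0 = 0
  antitone_phi : ∃ r₀ > 0, AntitoneOn (fun r : ℝ => r ^ (-φ r)) (Set.Ioo 0 r₀)
  antitone_psi : ∃ r₀ > 0, AntitoneOn (fun r : ℝ => r ^ (-ψ r)) (Set.Ioo 0 r₀)
  tendsto_phi : Tendsto (fun r : ℝ => r ^ (-φ r)) (𝓝[>] 0) atTop
  monotone_rpow : ∀ ε > 0, ∃ r₀ > 0, MonotoneOn (fun r : ℝ => r ^ (ε - φ r)) (Set.Ioo 0 r₀)

/-! ### The properties of `μ` and of the auxiliary measure `m` -/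

/-- `M⁻¹ |I|^{α + ψ(|I|)} ≤ μ(I) ≤ M |I|^{α - ψ(|I|)}`, where `|I|` is the diameter of `I`. -/
def MassControl {d : ℕ} (μ : Measure (Fin d → ℝ)) (α : ℝ) (ψ : ℝ → ℝ) (M : ℝ)
    (I : Set (Fin d → ℝ)) : Prop :=
  ENNReal.ofReal (M⁻¹ * Metric.diam I ^ (α + ψ (Metric.diam I))) ≤ μ I ∧
    μ I ≤ ENNReal.ofReal (M * Metric.diam I ^ (α - ψ (Metric.diam I)))

/-- `m(I) ≤ M |I|^{β - φ(|I|)}`. -/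
def MassBound {d : ℕ} (m : Measure (Fin d → ℝ)) (β : ℝ) (φ : ℝ → ℝ) (M : ℝ)
    (I : Set (Fin d → ℝ)) : Prop :=
  m I ≤ ENNReal.ofReal (M * Metric.diam I ^ (β - φ (Metric.diam I)))

/-- For `m`-almost every `y`, every box of a large generation `j` neighbouring the box of
`y` has a `μ`-mass controlled by the exponent `α` and the gauge `ψ`, with constant `1`. -/
def LocalScaling {d : ℕ} (c : ℕ) (μ m : Measure (Fin d → ℝ)) (α : ℝ) (ψ : ℝ → ℝ) : Prop :=
  ∀ᵐ y ∂m, ∃ j₀ : ℕ, ∀ j ≥ j₀, ∀ k, IsNeighbor c j y k → MassControl μ α ψ 1 (cBox c j k)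

/-- For `m`-almost every `y`, every box `I` of a large generation `j` neighbouring the box of
`y` satisfies `m(I) ≤ |I|^{β - φ(|I|)}`. -/
def LocalMassBound {d : ℕ} (c : ℕ) (m : Measure (Fin d → ℝ)) (β : ℝ) (φ : ℝ → ℝ) : Prop :=
  ∀ᵐ y ∂m, ∃ j₀ : ℕ, ∀ j ≥ j₀, ∀ k, IsNeighbor c j y k → MassBound m β φ 1 (cBox c j k)

/-- Self-similarity of `m` with the family `mL` of measures: for every `c`-adic box `L = cBox c j k` of
`[0,1)^d`, the measure `mL j k` is equivalent to the restriction of `m` to `L`, and its image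
under the affine map of `L` onto `[0,1)^d` satisfies `LocalMassBound`. -/
def SelfSimilarCopies {d : ℕ} (c : ℕ) (m : Measure (Fin d → ℝ)) (β : ℝ) (φ : ℝ → ℝ)
    (mL : ℕ → (Fin d → ℕ) → Measure (Fin d → ℝ)) : Prop :=
  ∀ (j : ℕ) (k : Fin d → ℕ), (∀ i, k i < c ^ j) →
    mL j k ≪ m.restrict (cBox c j k) ∧ m.restrict (cBox c j k) ≪ mL j k ∧
      LocalMassBound c ((mL j k).map (boxMap c j k)) β φ

/-- The set `E_n^L` attached to a box `L` and a measure `mL` on `L`. -/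
def goodSet {d : ℕ} (c : ℕ) (β : ℝ) (φ : ℝ → ℝ) (mL : Measure (Fin d → ℝ))
    (L : Set (Fin d → ℝ)) (n : ℕ) : Set (Fin d → ℝ) :=
  {x | x ∈ L ∧ ∀ j : ℕ, (n : ℝ) + Real.logb c ((Metric.diam L)⁻¹) ≤ (j : ℝ) →
    ∀ k, IsNeighbor c j x k →
      mL (cBox c j k) ≤ ENNReal.ofReal ((Metric.diam (cBox c j k) / Metric.diam L) ^
        (β - φ (Metric.diam (cBox c j k) / Metric.diam L)))}

/-- The integers `n ≥ 1` such that `E_n^L` carries at least half of the mass of `mL`. -/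
def goodLevels {d : ℕ} (c : ℕ) (β : ℝ) (φ : ℝ → ℝ) (mL : Measure (Fin d → ℝ))
    (L : Set (Fin d → ℝ)) : Set ℕ :=
  {n | 1 ≤ n ∧ mL Set.univ / 2 ≤ mL (goodSet c β φ mL L n)}

/-- The integer `n_L`, the least element of `goodLevels` (when there is one). -/
def growthIndex {d : ℕ} (c : ℕ) (β : ℝ) (φ : ℝ → ℝ) (mL : Measure (Fin d → ℝ))
    (L : Set (Fin d → ℝ)) : ℕ :=
  sInf (goodLevels c β φ mL L)

/-- For every box `L` of a large generation, `n_L ≤ log_c(|L|⁻¹) φ(|L|)` and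
`|L|^{φ(|L|)} ≤ ‖m^L‖`. The first clause says that `n_L` is a finite number. -/
def UniformGrowthControl {d : ℕ} (c : ℕ) (β : ℝ) (φ : ℝ → ℝ)
    (mL : ℕ → (Fin d → ℕ) → Measure (Fin d → ℝ)) : Prop :=
  ∃ J : ℕ, ∀ j ≥ J, ∀ k : Fin d → ℕ, (∀ i, k i < c ^ j) →
    (goodLevels c β φ (mL j k) (cBox c j k)).Nonempty ∧
    (growthIndex c β φ (mL j k) (cBox c j k) : ℝ) ≤
      Real.logb c ((Metric.diam (cBox c j k))⁻¹) * φ (Metric.diam (cBox c j k)) ∧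
    ENNReal.ofReal (Metric.diam (cBox c j k) ^ φ (Metric.diam (cBox c j k))) ≤
      mL j k Set.univ

/-! ### Multinomial measures -/

/-- The measure on `{0, …, c - 1}` that gives the mass `p k` to `k`. -/
def digitLaw {c : ℕ} (p : Fin c → ℝ) : Measure (Fin c) :=
  ∑ k, ENNReal.ofReal (p k) • Measure.dirac k

/-- The multinomial measure on `[0,1]` associated with the probability vector `p`: the law of
`∑_{n ≥ 1} X_n c⁻ⁿ`, where the digits `X_n` are independent with law `p`. -/
def multinomial {c : ℕ} (p : Fin c → ℝ) : Measure ℝ :=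
  (Measure.infinitePi (fun _ : ℕ => digitLaw p)).map Real.ofDigits

/-- The product of the multinomial measures associated with `p 0, …, p (d - 1)`. -/
def productMultinomial {d c : ℕ} (p : Fin d → Fin c → ℝ) : Measure (Fin d → ℝ) :=
  Measure.pi (fun i => multinomial (p i))

/-- `-log_c ∑_k p_k^q`. -/
def tauVector {c : ℕ} (p : Fin c → ℝ) (q : ℝ) : ℝ :=
  -Real.logb c (∑ k, p k ^ q)

/-- The vector `(c^{τ(q)} p_k^q)_k`, where `τ(q) = -log_c ∑_k p_k^q`. -/
def tilt {c : ℕ} (p : Fin c → ℝ) (q : ℝ) : Fin c → ℝ :=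
  fun k => (c : ℝ) ^ tauVector p q * p k ^ q

/-! ### Digit frequencies -/

/-- The `m`-th digit (`m ≥ 1`) of the `c`-adic expansion of `x ∈ [0,1]`. All the digits of `1`
are equal to `c - 1`. -/
def cDigit (c m : ℕ) (x : ℝ) : ℕ :=
  if x = 1 then c - 1 else ⌊(c : ℝ) ^ m * x⌋₊ % c

/-- The frequency of the digit `k` among the first `n` digits of `x` in base `c`. -/
def digitFreq (c k n : ℕ) (x : ℝ) : ℝ :=
  (((Finset.Icc 1 n).filter (fun m => cDigit c m x = k)).card : ℝ) / (n : ℝ)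

/-- The `n`-th ball satisfies the digit condition: for every coordinate `i` and digit `k`, the
frequency of `k` among the first `⌊log_c (1 / r)⌋` digits of the `i`-th coordinate of the
centre `x` is `ε`-close to `p i k`. -/
def DigitCondition {d c : ℕ} (p : Fin d → Fin c → ℝ) (x : Fin d → ℝ) (r ε : ℝ) : Prop :=
  ∀ (i : Fin d) (k : Fin c),
    |digitFreq c (k : ℕ) ⌊Real.logb c r⁻¹⌋₊ (x i) - p i k| ≤ ε

/-- The set of points that belong to `B(x_n, λ_n^δ)` for infinitely many `n` such that
`(x_n, λ_n)` satisfies the digit condition with error `ε_n`. -/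
def digitLimsup {d c : ℕ} (p : Fin d → Fin c → ℝ) (x : ℕ → Fin d → ℝ) (lam ε : ℕ → ℝ)
    (δ : ℝ) : Set (Fin d → ℝ) :=
  {y | ∃ᶠ n in atTop, DigitCondition p (x n) (lam n) (ε n) ∧
    y ∈ Metric.closedBall (x n) (lam n ^ δ)}

end

noncomputable section

/-! Under `m` the digits of the coordinates are independent and follow the tilted vectors, while the
`μ`-mass and the `m`-mass of a box are products of weights that depend only on the digit counts of
its index. The local estimates therefore reduce to the deviation of digit counts from their means.
An exponential maximal inequality on dyadic blocks and Borel–Cantelli give the upper half of a law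
of the iterated logarithm (`ae_eventually_digitCount`): the deviation is `O(√(j log log j))`, which
is at most `j φ(c⁻ʲ)` up to a constant once `C` is large. Neighbouring boxes cost nothing more.
Almost surely a prefix of length `j` does not end with `√j` zeros or `√j` digits `c - 1`, so a carry
stops before reaching the earlier digits (`ae_eventually_balancedWord`). This yields `LocalScaling`
and `LocalMassBound`.

For `m^L` the affine image of `m` in `L` is taken. It has mass one and its relative estimates are
those of `m`, so one generation works for all `L`, and `n_L` stays bounded. The spectrum is explicit
because the partition function is a product of `j`-th powers; Jensen's inequality places the tangent
above the graph, so that the Legendre transform at the slope is the entropy of the tilted vectors.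

The measure `m_δ` is the law of the limit of a random path of nested boxes. In a box `L`, a point
`y` is drawn from `m` conditioned on being balanced from a fixed generation on. The path moves to
the first box, of a late enough generation, that neighbours the copy of `y` in `L` and comes from a
ball with typical centre; from there it passes to a sub-box of the contracted ball. Such balls exist
because the digits of the centre of a ball covering the copy of `y` are the address of `L` followed
by a neighbour of a prefix of `y`. Selecting at the first possible generation makes the selected
boxes of `L` equal or disjoint (`IsUbiquitous.selNode_eq_of_common`). A selected box of generation
`j` thus has probability about `c^(-jβ)`, and its child, of generation about `δ j`, gets the
exponent `β / δ`; the late start lets the gauge absorb the generations before `L`.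
`IsControlled.mul_enters_le` extends this bound to all boxes. -/

/-! ### Shift structure of infinite product measures -/

/-- The sequence `x, ω 0, ω 1, …`. -/
def seqCons {X : Type*} (x : X) (ω : ℕ → X) : ℕ → X
  | 0 => x
  | n + 1 => ω n

theorem measurable_seqCons {X : Type*} [MeasurableSpace X] :
    Measurable (fun q : X × (ℕ → X) => seqCons q.1 q.2) := by
  refine measurable_pi_lambda _ fun n => ?_
  cases n with
  | zero => exact measurable_fst
  | succ n => exact (measurable_pi_apply n).comp measurable_snd

/-- Checked on cylinders. This is the only form of independence in use: it yields the
self-similarity of multinomial measures and the renewal of the random paths after one step. -/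
theorem map_seqCons_infinitePi {X : Type*} [MeasurableSpace X] (ν : Measure X)
    [IsProbabilityMeasure ν] :
    (ν.prod (Measure.infinitePi (fun _ : ℕ => ν))).map (fun q => seqCons q.1 q.2) =
      Measure.infinitePi (fun _ : ℕ => ν) := by
  classical
  refine Measure.eq_infinitePi _ fun s t ht => ?_
  obtain ⟨N, hN⟩ : ∃ N, s ⊆ Finset.range (N + 1) :=
    ⟨s.sup id, fun i hi => Finset.mem_range.2 (Nat.lt_succ_of_le (Finset.le_sup (f := id) hi))⟩
  -- The index set is enlarged to an initial segment, because removing the first term leaves an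
  -- initial segment again.
  set t' : ℕ → Set X := fun i => if i ∈ s then t i else Set.univ with ht'
  have hmt' : ∀ i, MeasurableSet (t' i) := fun i => by
    simp only [ht']; split_ifs
    · exact ht i
    · exact MeasurableSet.univ
  have hpi : Set.pi (s : Set ℕ) t = Set.pi (Finset.range (N + 1) : Set ℕ) t' := by
    ext x
    simp only [Set.mem_pi, Finset.mem_coe, ht']
    constructor
    · intro h i _
      split_ifs with his
      · exact h i his
      · trivial
    · intro h i hi
      have := h i (hN hi)
      rwa [if_pos hi] at this
  have hprod : ∏ i ∈ s, ν (t i) = ∏ i ∈ Finset.range (N + 1), ν (t' i) := by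
    rw [← Finset.prod_subset hN (f := fun i => ν (t' i))]
    · exact Finset.prod_congr rfl fun i hi => by simp [ht', hi]
    · intro i _ hi
      simp [ht', hi]
  rw [hpi, hprod, Measure.map_apply measurable_seqCons
    (MeasurableSet.pi (Finset.countable_toSet _) fun i _ => hmt' i)]
  have : (fun q : X × (ℕ → X) => seqCons q.1 q.2) ⁻¹' Set.pi (Finset.range (N + 1) : Set ℕ) t' =
      (t' 0) ×ˢ Set.pi (Finset.range N : Set ℕ) (fun i => t' (i + 1)) := by
    ext ⟨x, ω⟩
    simp only [Set.mem_preimage, Set.mem_pi, Finset.mem_coe, Finset.mem_range, Set.mem_prod]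
    constructor
    · intro h
      exact ⟨h 0 (Nat.succ_pos _), fun i hi => h (i + 1) (by omega)⟩
    · rintro ⟨h0, h⟩ i hi
      cases i with
      | zero => exact h0
      | succ i => exact h i (by omega)
  rw [this, Measure.prod_prod, Measure.infinitePi_pi _ (fun i _ => hmt' _), Finset.prod_range_succ',
    mul_comm]

/-! ### Digits of integers -/

/-- The number of digits equal to `t` in the word of length `j` which is the expansion of `k`. -/
def digitCount (c t : ℕ) : ℕ → ℕ → ℕ
  | 0, _ => 0
  | j + 1, k => digitCount c t j (k / c) + if k % c = t then 1 else 0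

theorem digitCount_le (c t j k : ℕ) : digitCount c t j k ≤ j := by
  induction j generalizing k with
  | zero => simp [digitCount]
  | succ j ih =>
    simp only [digitCount]
    have := ih (k / c)
    split_ifs <;> omega

/-- `l * c ^ b + k` is the concatenation of the word `l` of length `a` with the word `k` of length
`b`. -/
theorem digitCount_add {c : ℕ} (hc : 0 < c) (t a b l k : ℕ) (hk : k < c ^ b) :
    digitCount c t (a + b) (l * c ^ b + k) = digitCount c t a l + digitCount c t b k := by
  induction b generalizing k with
  | zero =>
    obtain rfl : k = 0 := by simpa using hk
    simp [digitCount]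
  | succ b ih =>
    have h1 : l * c ^ (b + 1) + k = k + c * (l * c ^ b) := by ring
    have h2 : (l * c ^ (b + 1) + k) / c = l * c ^ b + k / c := by
      rw [h1, Nat.add_mul_div_left _ _ hc, add_comm]
    have h3 : (l * c ^ (b + 1) + k) % c = k % c := by rw [h1, Nat.add_mul_mod_self_left]
    have h4 : k / c < c ^ b := by
      rw [Nat.div_lt_iff_lt_mul hc]; rwa [pow_succ] at hk
    rw [← add_assoc, digitCount, digitCount, h2, h3, ih _ h4, add_assoc]

/-- The weight `∏ₜ pₜ ^ nₜ` of the word of length `j` which is the expansion of `k`, where `nₜ` is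
the number of its digits that are equal to `t`. -/
def wordWeight {c : ℕ} (p : Fin c → ℝ) (j k : ℕ) : ℝ :=
  ∏ t : Fin c, p t ^ digitCount c t j k

theorem wordWeight_zero {c : ℕ} (p : Fin c → ℝ) (k : ℕ) : wordWeight p 0 k = 1 := by
  simp [wordWeight, digitCount]

theorem wordWeight_one {c : ℕ} (p : Fin c → ℝ) (t : Fin c) : wordWeight p 1 t = p t := by
  rw [wordWeight, Finset.prod_eq_single t]
  · simp [digitCount, Nat.mod_eq_of_lt t.2]
  · intro s _ hs
    have : (t : ℕ) ≠ s := fun h => hs (Fin.ext h.symm)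
    simp [digitCount, Nat.mod_eq_of_lt t.2, this]
  · simp

theorem wordWeight_add {c : ℕ} (hc : 0 < c) (p : Fin c → ℝ) (a b l k : ℕ) (hk : k < c ^ b) :
    wordWeight p (a + b) (l * c ^ b + k) = wordWeight p a l * wordWeight p b k := by
  simp only [wordWeight, digitCount_add hc _ a b l k hk, pow_add, Finset.prod_mul_distrib]

/-! ### Multinomial measures -/

/-- A probability vector with positive components. -/
structure IsPosProb {c : ℕ} (p : Fin c → ℝ) : Prop where
  pos : ∀ k, 0 < p k
  sum_eq : ∑ k, p k = 1

namespace IsPosProb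

variable {c : ℕ} {p : Fin c → ℝ}

theorem le_one (hp : IsPosProb p) (k : Fin c) : p k ≤ 1 := by
  rw [← hp.sum_eq]
  exact Finset.single_le_sum (fun i _ => (hp.pos i).le) (Finset.mem_univ k)

theorem lt_one (hp : IsPosProb p) (hc : 2 ≤ c) (k : Fin c) : p k < 1 := by
  obtain ⟨l, hl⟩ : ∃ l : Fin c, l ≠ k := by
    have : Nontrivial (Fin c) := Fin.nontrivial_iff_two_le.2 hc
    exact exists_ne k
  have : p k + p l ≤ 1 := by
    rw [← hp.sum_eq, ← Finset.sum_pair hl.symm]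
    exact Finset.sum_le_sum_of_subset_of_nonneg (Finset.subset_univ _) fun i _ _ => (hp.pos i).le
  linarith [hp.pos l]

theorem isProbabilityMeasure_digitLaw (hp : IsPosProb p) : IsProbabilityMeasure (digitLaw p) := by
  constructor
  simp only [digitLaw, Measure.coe_finsetSum, Finset.sum_apply, Measure.smul_apply,
    measure_univ, smul_eq_mul, mul_one]
  rw [← ENNReal.ofReal_sum_of_nonneg fun i _ => (hp.pos i).le, hp.sum_eq, ENNReal.ofReal_one]

theorem isProbabilityMeasure_multinomial (hp : IsPosProb p) :
    IsProbabilityMeasure (multinomial p) := by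
  have := hp.isProbabilityMeasure_digitLaw
  exact Measure.isProbabilityMeasure_map Real.continuous_ofDigits.measurable.aemeasurable

theorem wordWeight_pos (hp : IsPosProb p) (j k : ℕ) : 0 < wordWeight p j k :=
  Finset.prod_pos fun t _ => pow_pos (hp.pos t) _

end IsPosProb

section Multinomial

variable {c : ℕ} {p : Fin c → ℝ}

theorem ofDigits_seqCons (t : Fin c) (σ : ℕ → Fin c) :
    Real.ofDigits (seqCons t σ) = ((t : ℕ) + Real.ofDigits σ) / c := by
  have : (fun i => seqCons t σ (i + 1)) = σ := rfl
  rw [Real.ofDigits_eq_sum_add_ofDigits _ 1, this]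
  simp [Real.ofDigitsTerm, seqCons]
  ring

theorem lintegral_digitLaw (f : Fin c → ℝ≥0∞) :
    ∫⁻ t, f t ∂digitLaw p = ∑ t, ENNReal.ofReal (p t) * f t := by
  simp [digitLaw, lintegral_finsetSum_measure]

/-- The self-similarity equation of a multinomial measure. -/
theorem multinomial_apply (hp : IsPosProb p) {S : Set ℝ} (hS : MeasurableSet S) :
    multinomial p S = ∑ t : Fin c, ENNReal.ofReal (p t) *
      multinomial p ((fun y : ℝ => ((t : ℕ) + y) / c) ⁻¹' S) := by
  have := hp.isProbabilityMeasure_digitLaw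
  have hm : Measurable (Real.ofDigits (b := c)) := Real.continuous_ofDigits.measurable
  rw [multinomial, Measure.map_apply hm hS, ← map_seqCons_infinitePi (digitLaw p),
    Measure.map_apply measurable_seqCons (hm hS),
    Measure.prod_apply (measurable_seqCons (hm hS)), lintegral_digitLaw]
  refine Finset.sum_congr rfl fun t _ => ?_
  rw [map_seqCons_infinitePi, Measure.map_apply hm]
  · refine congrArg _ (congrArg _ (Set.ext fun σ => ?_))
    change Real.ofDigits (seqCons t σ) ∈ S ↔ (((t : ℕ) : ℝ) + Real.ofDigits σ) / c ∈ S
    rw [ofDigits_seqCons]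
  · exact (by fun_prop : Measurable fun y : ℝ => (((t : ℕ) : ℝ) + y) / c) hS

theorem multinomial_Icc : multinomial p (Set.Icc 0 1)ᶜ = 0 := by
  rw [multinomial, Measure.map_apply Real.continuous_ofDigits.measurable measurableSet_Icc.compl]
  refine measure_mono_null (t := ∅) (fun σ hσ => hσ ?_) measure_empty
  exact ⟨Real.ofDigits_nonneg σ, Real.ofDigits_le_one σ⟩

/-- Only the first digit `c - 1` can lead to the value `1`, so the mass `x` of `{1}` satisfies `x =
p x` with `p < 1`. One may then work on `[0,1)`, where floors read the digits. -/
theorem multinomial_one (hp : IsPosProb p) (hc : 2 ≤ c) : multinomial p {1} = 0 := by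
  have hP := hp.isProbabilityMeasure_multinomial
  have hc0 : (0 : ℝ) < c := by positivity
  let t₁ : Fin c := ⟨c - 1, by omega⟩
  have h := multinomial_apply hp (measurableSet_singleton (1 : ℝ))
  rw [Finset.sum_eq_single t₁] at h
  · have hs : (fun y : ℝ => (((t₁ : ℕ) : ℝ) + y) / c) ⁻¹' {1} = {1} := by
      ext y
      simp only [Set.mem_preimage, Set.mem_singleton_iff, t₁, div_eq_one_iff_eq hc0.ne',
        Nat.cast_sub (by omega : 1 ≤ c)]
      constructor <;> intro h <;> push_cast at * <;> linarith
    rw [hs] at h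
    by_contra hne
    have hlt : ENNReal.ofReal (p t₁) * multinomial p {1} < 1 * multinomial p {1} :=
      ENNReal.mul_lt_mul_left hne (measure_ne_top _ _) (by
        rw [← ENNReal.ofReal_one, ENNReal.ofReal_lt_ofReal_iff one_pos]
        exact hp.lt_one hc t₁)
    rw [one_mul, ← h] at hlt
    exact lt_irrefl _ hlt
  · intro t _ ht
    have htlt : (t : ℕ) + 1 ≤ c - 1 := by
      have : (t : ℕ) ≠ c - 1 := fun h => ht (Fin.ext h)
      have := t.2
      omega
    have htR : ((t : ℕ) : ℝ) + 1 + 1 ≤ c := by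
      have : (t : ℕ) + 1 + 1 ≤ c := by omega
      exact_mod_cast this
    rw [measure_mono_null _ (multinomial_Icc), mul_zero]
    intro y hy
    simp only [Set.mem_preimage, Set.mem_singleton_iff, div_eq_one_iff_eq hc0.ne'] at hy
    simp only [Set.mem_compl_iff, Set.mem_Icc, not_and, not_le]
    intro _
    linarith
  · simp

theorem multinomial_Ico (hp : IsPosProb p) (hc : 2 ≤ c) :
    ∀ᵐ y ∂multinomial p, y ∈ Set.Ico (0 : ℝ) 1 := by
  have h1 : ∀ᵐ y ∂multinomial p, y ∈ Set.Icc (0 : ℝ) 1 := multinomial_Icc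
  have h2 : ∀ᵐ y ∂multinomial p, y ≠ 1 := by
    have := multinomial_one hp hc
    rwa [← compl_compl ({1} : Set ℝ)] at this
  filter_upwards [h1, h2] with y hy hy1
  exact ⟨hy.1, lt_of_le_of_ne hy.2 hy1⟩

theorem floor_pow_mul_lt {c j : ℕ} (hc : 0 < c) {y : ℝ} (hy : y ∈ Set.Ico (0 : ℝ) 1) :
    ⌊(c : ℝ) ^ j * y⌋₊ < c ^ j := by
  have : (0 : ℝ) < (c : ℝ) ^ j := by positivity
  rw [Nat.floor_lt (by have := hy.1; positivity)]
  push_cast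
  nlinarith [hy.2]

theorem floor_pow_succ_mul {c : ℕ} (hc : 0 < c) (j t : ℕ) {y : ℝ} (hy : 0 ≤ y) :
    ⌊(c : ℝ) ^ (j + 1) * ((t + y) / c)⌋₊ = t * c ^ j + ⌊(c : ℝ) ^ j * y⌋₊ := by
  have h0 : (c : ℝ) ≠ 0 := by positivity
  have : (c : ℝ) ^ (j + 1) * ((t + y) / c) = (c : ℝ) ^ j * y + ((t * c ^ j : ℕ) : ℝ) := by
    push_cast; field_simp; ring
  rw [this, Nat.floor_add_natCast (by positivity), add_comm]

theorem measurable_floor_pow_mul (c j : ℕ) : Measurable fun y : ℝ => ⌊(c : ℝ) ^ j * y⌋₊ :=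
  Nat.measurable_floor.comp (by fun_prop)

/-- The restriction of a multinomial measure to a `c`-adic interval is a copy of the measure. -/
theorem multinomial_inter_floor_eq (hp : IsPosProb p) (hc : 2 ≤ c) (j k : ℕ) (hk : k < c ^ j)
    {S : Set ℝ} (hS : MeasurableSet S) :
    multinomial p (S ∩ {y | ⌊(c : ℝ) ^ j * y⌋₊ = k}) = ENNReal.ofReal (wordWeight p j k) *
      multinomial p ((fun y : ℝ => (k + y) / (c : ℝ) ^ j) ⁻¹' S) := by
  have hc0 : 0 < c := by omega
  have hcR : (c : ℝ) ≠ 0 := by positivity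
  induction j generalizing k S with
  | zero =>
    obtain rfl : k = 0 := by simpa using hk
    rw [wordWeight_zero, ENNReal.ofReal_one, one_mul]
    refine measure_congr ?_
    filter_upwards [multinomial_Ico hp hc] with y hy
    refine propext ?_
    change (y ∈ S ∧ ⌊(c : ℝ) ^ 0 * y⌋₊ = 0) ↔ ((0 : ℕ) + y) / (c : ℝ) ^ 0 ∈ S
    have : ⌊(c : ℝ) ^ 0 * y⌋₊ = 0 := by simpa using floor_pow_mul_lt (j := 0) hc0 hy
    rw [this]
    simp
  | succ j ih =>
    have hcj : 0 < c ^ j := by positivity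
    have hk' : k % c ^ j < c ^ j := Nat.mod_lt _ hcj
    have ht : k / c ^ j < c := by
      rw [Nat.div_lt_iff_lt_mul hcj]; rwa [pow_succ, mul_comm] at hk
    -- The leading digit of `k` is the only one that contributes to the self-similarity equation.
    let t : Fin c := ⟨k / c ^ j, ht⟩
    have hkt : k = t * c ^ j + k % c ^ j := (Nat.div_add_mod' k (c ^ j)).symm
    have hw : wordWeight p (j + 1) k = p t * wordWeight p j (k % c ^ j) := by
      conv_lhs => rw [hkt, add_comm j 1]
      rw [wordWeight_add hc0 p 1 j t _ hk', wordWeight_one]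
    have hSt : MeasurableSet ((fun y : ℝ => (((t : ℕ) : ℝ) + y) / c) ⁻¹' S) :=
      (by fun_prop : Measurable fun y : ℝ => (((t : ℕ) : ℝ) + y) / c) hS
    rw [multinomial_apply hp (S := S ∩ {y | ⌊(c : ℝ) ^ (j + 1) * y⌋₊ = k})
      (hS.inter (measurable_floor_pow_mul c (j + 1) (measurableSet_singleton k))), Finset.sum_eq_single t, hw, ENNReal.ofReal_mul (hp.pos t).le, mul_assoc]
    · congr 1
      convert ih _ hk' hSt using 1
      · refine measure_congr ?_
        filter_upwards [multinomial_Ico hp hc] with y hy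
        refine propext ?_
        change (((t : ℕ) : ℝ) + y) / c ∈ S ∧ ⌊(c : ℝ) ^ (j + 1) * (((t : ℕ) + y) / c)⌋₊ = k ↔
          (((t : ℕ) : ℝ) + y) / c ∈ S ∧ ⌊(c : ℝ) ^ j * y⌋₊ = k % c ^ j
        rw [floor_pow_succ_mul hc0 j t hy.1]
        refine and_congr_right fun _ => ?_
        omega
      · rw [← Set.preimage_comp]
        congr 3
        funext y
        have hkR : (k : ℝ) = (t : ℕ) * (c : ℝ) ^ j + (k % c ^ j : ℕ) := by exact_mod_cast hkt
        simp only [Function.comp]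
        rw [hkR]
        field_simp
        ring
    · intro s _ hs
      rw [mul_eq_zero]
      right
      rw [← nonpos_iff_eq_zero, ← measure_empty (μ := multinomial p)]
      refine measure_mono_ae ?_
      filter_upwards [multinomial_Ico hp hc] with y hy hmem
      have hmem : ⌊(c : ℝ) ^ (j + 1) * (((s : ℕ) + y) / c)⌋₊ = k := hmem.2
      rw [floor_pow_succ_mul hc0 j s hy.1] at hmem
      refine hs (Fin.ext ?_)
      change (s : ℕ) = k / c ^ j
      rw [← hmem, add_comm, Nat.add_mul_div_right _ _ hcj,
        Nat.div_eq_of_lt (floor_pow_mul_lt hc0 hy), zero_add]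
    · simp

/-- The mass that a multinomial measure gives to a `c`-adic interval. -/
theorem multinomial_floor_eq (hp : IsPosProb p) (hc : 2 ≤ c) (j k : ℕ) (hk : k < c ^ j) :
    multinomial p {y | ⌊(c : ℝ) ^ j * y⌋₊ = k} = ENNReal.ofReal (wordWeight p j k) := by
  have := hp.isProbabilityMeasure_multinomial
  simpa using multinomial_inter_floor_eq hp hc j k hk MeasurableSet.univ

end Multinomial

/-! ### Boxes -/

section Boxes

variable {d c : ℕ}

/-- The canonical affine map of `[0,1)^d` onto the box `cBox c j k`. -/
def boxEmbed (c j : ℕ) (k : Fin d → ℕ) (y : Fin d → ℝ) : Fin d → ℝ :=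
  fun i => ((k i : ℝ) + y i) / (c : ℝ) ^ j

theorem measurable_boxEmbed (c j : ℕ) (k : Fin d → ℕ) : Measurable (boxEmbed c j k) := by
  unfold boxEmbed; fun_prop

theorem measurable_boxMap (c j : ℕ) (k : Fin d → ℕ) : Measurable (boxMap c j k) := by
  unfold boxMap; fun_prop

theorem boxMap_boxEmbed (hc : 0 < c) (j : ℕ) (k : Fin d → ℕ) (y : Fin d → ℝ) :
    boxMap c j k (boxEmbed c j k y) = y := by
  funext i
  have : (c : ℝ) ≠ 0 := by positivity
  simp only [boxMap, boxEmbed]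
  field_simp
  ring

theorem measurable_boxIndex (c j : ℕ) : Measurable (boxIndex c j : (Fin d → ℝ) → Fin d → ℕ) :=
  measurable_pi_lambda _ fun i => (measurable_floor_pow_mul c j).comp (measurable_pi_apply i)

theorem cBox_eq_pi (c j : ℕ) (k : Fin d → ℕ) : cBox c j k =
    Set.pi Set.univ fun i => Set.Ico ((k i : ℝ) / (c : ℝ) ^ j) (((k i : ℝ) + 1) / (c : ℝ) ^ j) := by
  ext x; simp [cBox]

theorem measurableSet_cBox (c j : ℕ) (k : Fin d → ℕ) : MeasurableSet (cBox c j k) := by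
  rw [cBox_eq_pi]
  exact MeasurableSet.univ_pi fun i => measurableSet_Ico

theorem mem_cBox_iff (hc : 0 < c) {j : ℕ} {k : Fin d → ℕ} {x : Fin d → ℝ} :
    x ∈ cBox c j k ↔ (∀ i, 0 ≤ x i) ∧ boxIndex c j x = k := by
  have hcj : (0 : ℝ) < (c : ℝ) ^ j := by positivity
  have key : ∀ i, 0 ≤ x i → (⌊(c : ℝ) ^ j * x i⌋₊ = k i ↔
      (k i : ℝ) / (c : ℝ) ^ j ≤ x i ∧ x i < ((k i : ℝ) + 1) / (c : ℝ) ^ j) := fun i hi => by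
    rw [Nat.floor_eq_iff (by positivity), div_le_iff₀ hcj, lt_div_iff₀ hcj, mul_comm]
  constructor
  · intro h
    have h0 : ∀ i, 0 ≤ x i := fun i => le_trans (by positivity) (h i).1
    exact ⟨h0, funext fun i => (key i (h0 i)).2 (h i)⟩
  · rintro ⟨h0, h⟩ i
    exact (key i (h0 i)).1 (congrFun h i)

theorem boxIndex_lt (hc : 0 < c) (j : ℕ) {y : Fin d → ℝ} (hy : ∀ i, y i ∈ Set.Ico (0 : ℝ) 1)
    (i : Fin d) : boxIndex c j y i < c ^ j :=
  floor_pow_mul_lt hc (hy i)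

theorem boxIndex_div (hc : 0 < c) (a b : ℕ) (y : Fin d → ℝ) (i : Fin d) :
    boxIndex c (a + b) y i / c ^ b = boxIndex c a y i := by
  have hcb : ((c ^ b : ℕ) : ℝ) ≠ 0 := by positivity
  simp only [boxIndex]
  rw [← Nat.floor_div_natCast]
  congr 1
  rw [div_eq_iff hcb]
  push_cast
  ring

theorem boxIndex_boxEmbed (hc : 0 < c) (a b : ℕ) (l : Fin d → ℕ) {y : Fin d → ℝ}
    (hy : ∀ i, 0 ≤ y i) (i : Fin d) :
    boxIndex c (a + b) (boxEmbed c a l y) i = l i * c ^ b + boxIndex c b y i := by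
  have hcR : (c : ℝ) ≠ 0 := by positivity
  have := hy i
  simp only [boxIndex, boxEmbed]
  have h : (c : ℝ) ^ (a + b) * ((l i + y i) / (c : ℝ) ^ a) =
      (c : ℝ) ^ b * y i + ((l i * c ^ b : ℕ) : ℝ) := by
    push_cast; field_simp; ring
  rw [h, Nat.floor_add_natCast (by positivity), add_comm]

theorem diam_cBox (hd : 1 ≤ d) (hc : 0 < c) (j : ℕ) (k : Fin d → ℕ) :
    Metric.diam (cBox c j k) = ((c : ℝ) ^ j)⁻¹ := by
  have hcj : (0 : ℝ) < (c : ℝ) ^ j := by positivity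
  have hdist : ∀ x ∈ cBox c j k, ∀ y ∈ cBox c j k, dist x y ≤ ((c : ℝ) ^ j)⁻¹ := by
    intro x hx y hy
    refine (dist_pi_le_iff (by positivity)).2 fun i => ?_
    obtain ⟨hx1, hx2⟩ := hx i
    obtain ⟨hy1, hy2⟩ := hy i
    rw [add_div, one_div] at hx2 hy2
    rw [Real.dist_eq, abs_le]
    constructor <;> linarith
  refine le_antisymm (Metric.diam_le_of_forall_dist_le (by positivity) hdist) ?_
  by_contra! hlt
  -- Half-open boxes do not attain their diameter, hence two points that differ by some `t` strictly
  -- below the side.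
  obtain ⟨t, ht1, ht2⟩ := exists_between hlt
  have ht0 : 0 < t := lt_of_le_of_lt Metric.diam_nonneg ht1
  have hx : (fun i => (k i : ℝ) / (c : ℝ) ^ j) ∈ cBox c j k := fun i =>
    ⟨le_rfl, div_lt_div_of_pos_right (lt_add_one _) hcj⟩
  have hy : (fun i => (k i : ℝ) / (c : ℝ) ^ j + t) ∈ cBox c j k := fun i =>
    ⟨by linarith, by rw [add_div, one_div]; linarith⟩
  have h := Metric.dist_le_diam_of_mem (Metric.isBounded_iff.2 ⟨_, fun _ h _ h' => hdist _ h _ h'⟩)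
    hy hx
  have h' := (dist_le_pi_dist (fun i => (k i : ℝ) / (c : ℝ) ^ j + t)
    (fun i => (k i : ℝ) / (c : ℝ) ^ j) (⟨0, hd⟩ : Fin d)).trans h
  rw [Real.dist_eq, add_sub_cancel_left, abs_of_pos ht0] at h'
  linarith

end Boxes

/-! ### Products of multinomial measures on boxes -/

section ProductMeasure

variable {d c : ℕ} {p : Fin d → Fin c → ℝ}

theorem isProbabilityMeasure_productMultinomial (hp : ∀ i, IsPosProb (p i)) :
    IsProbabilityMeasure (productMultinomial p) := by
  have := fun i => (hp i).isProbabilityMeasure_multinomial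
  unfold productMultinomial; infer_instance

theorem ae_productMultinomial_of_forall (hp : ∀ i, IsPosProb (p i)) {P : Fin d → ℝ → Prop}
    (h : ∀ i, ∀ᵐ y ∂multinomial (p i), P i y) :
    ∀ᵐ y ∂productMultinomial p, ∀ i, P i (y i) := by
  have := fun i => (hp i).isProbabilityMeasure_multinomial
  exact eventually_all.2 fun i => Measure.tendsto_eval_ae_ae.eventually (h i)

theorem productMultinomial_Ico (hp : ∀ i, IsPosProb (p i)) (hc : 2 ≤ c) :
    ∀ᵐ y ∂productMultinomial p, ∀ i, y i ∈ Set.Ico (0 : ℝ) 1 :=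
  ae_productMultinomial_of_forall hp fun i => multinomial_Ico (hp i) hc

/-- The restriction of a product of multinomial measures to a `c`-adic box is a copy of it. -/
theorem productMultinomial_restrict (hp : ∀ i, IsPosProb (p i)) (hc : 2 ≤ c) (j : ℕ)
    (k : Fin d → ℕ) (hk : ∀ i, k i < c ^ j) :
    (productMultinomial p).restrict (cBox c j k) =
      ENNReal.ofReal (∏ i, wordWeight (p i) j (k i)) •
        (productMultinomial p).map (boxEmbed c j k) := by
  have := fun i => (hp i).isProbabilityMeasure_multinomial
  have hc0 : 0 < c := by omega
  have hcj : (0 : ℝ) < (c : ℝ) ^ j := by positivity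
  have h1 : (productMultinomial p).restrict (cBox c j k) =
      Measure.pi fun i => (multinomial (p i)).restrict
        (Set.Ico ((k i : ℝ) / (c : ℝ) ^ j) (((k i : ℝ) + 1) / (c : ℝ) ^ j)) := by
    rw [cBox_eq_pi, productMultinomial, Measure.restrict_pi_pi]
  rw [h1]
  refine Measure.pi_eq fun t ht => ?_
  have hpre : boxEmbed c j k ⁻¹' Set.pi Set.univ t =
      Set.pi Set.univ fun i => (fun y : ℝ => (k i + y) / (c : ℝ) ^ j) ⁻¹' t i := by
    ext y; simp [boxEmbed]
  rw [Measure.smul_apply, smul_eq_mul, Measure.map_apply (measurable_boxEmbed c j k)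
    (MeasurableSet.univ_pi ht), hpre, productMultinomial, Measure.pi_pi,
    ENNReal.ofReal_prod_of_nonneg fun i _ => ((hp i).wordWeight_pos _ _).le,
    ← Finset.prod_mul_distrib]
  refine Finset.prod_congr rfl fun i _ => ?_
  rw [← multinomial_inter_floor_eq (hp i) hc j (k i) (hk i) (ht i), Measure.restrict_apply (ht i)]
  refine measure_congr ?_
  filter_upwards [multinomial_Ico (hp i) hc] with y hy
  refine propext (and_congr_right fun _ => ?_)
  have := hy.1
  change ⌊(c : ℝ) ^ j * y⌋₊ = k i ↔ _
  rw [Nat.floor_eq_iff (by positivity), Set.mem_Ico, div_le_iff₀ hcj, lt_div_iff₀ hcj, mul_comm]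

theorem productMultinomial_cBox (hp : ∀ i, IsPosProb (p i)) (hc : 2 ≤ c) (j : ℕ)
    (k : Fin d → ℕ) (hk : ∀ i, k i < c ^ j) :
    productMultinomial p (cBox c j k) = ENNReal.ofReal (∏ i, wordWeight (p i) j (k i)) := by
  have := isProbabilityMeasure_productMultinomial hp
  have h := congrArg (fun ν => ν Set.univ) (productMultinomial_restrict hp hc j k hk)
  simpa [Measure.map_apply (measurable_boxEmbed c j k) MeasurableSet.univ] using h

/-! ### Support -/

theorem productMultinomial_support (hp : ∀ i, IsPosProb (p i)) (hc : 2 ≤ c) :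
    (productMultinomial p).support = Set.Icc 0 1 := by
  have hc0 : 0 < c := by omega
  refine Set.Subset.antisymm (Measure.support_subset_of_isClosed isClosed_Icc ?_) fun x hx => ?_
  · filter_upwards [productMultinomial_Ico hp hc] with y hy
    exact ⟨fun i => (hy i).1, fun i => (hy i).2.le⟩
  · rw [Measure.mem_support_iff_forall]
    intro U hU
    obtain ⟨ε, hε, hεU⟩ := Metric.mem_nhds_iff.1 hU
    have hc1 : ((c : ℝ)⁻¹) < 1 := inv_lt_one_of_one_lt₀ (by exact_mod_cast (by omega : 1 < c))
    obtain ⟨j, hj⟩ := exists_pow_lt_of_lt_one hε hc1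
    rw [inv_pow] at hj
    have hcj : (0 : ℝ) < (c : ℝ) ^ j := by positivity
    have hcjN : 0 < c ^ j := by positivity
    -- The minimum matters for coordinates equal to `1`, which are only on the boundary of the last
    -- box.
    set k : Fin d → ℕ := fun i => min (boxIndex c j x i) (c ^ j - 1) with hkdef
    have hk : ∀ i, k i < c ^ j := fun i => by simp only [hkdef]; omega
    have hsub : cBox c j k ⊆ U := by
      refine fun y hy => hεU ?_
      rw [Metric.mem_ball, dist_pi_lt_iff hε]
      intro i
      refine lt_of_le_of_lt ?_ hj
      have hy1 := (hy i).1
      have hy2 := (hy i).2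
      have hx0 := hx.1 i
      have hx1 := hx.2 i
      simp only [Pi.zero_apply, Pi.one_apply] at hx0 hx1
      have hxk1 : (k i : ℝ) ≤ (c : ℝ) ^ j * x i :=
        le_trans (Nat.cast_le.2 (min_le_left _ _)) (Nat.floor_le (by positivity))
      have hxk2 : (c : ℝ) ^ j * x i ≤ k i + 1 := by
        rcases le_total (boxIndex c j x i) (c ^ j - 1) with h | h
        · simp only [hkdef, min_eq_left h]
          exact (Nat.lt_floor_add_one _).le
        · have : ((c ^ j - 1 : ℕ) : ℝ) + 1 = (c : ℝ) ^ j := by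
            exact_mod_cast Nat.sub_add_cancel hcjN
          simp only [hkdef, min_eq_right h, this]
          nlinarith
      rw [div_le_iff₀ hcj] at hy1
      rw [lt_div_iff₀ hcj] at hy2
      rw [Real.dist_eq, abs_le, ← one_div, ← neg_div, div_le_iff₀ hcj, le_div_iff₀ hcj]
      constructor <;> nlinarith
    refine lt_of_lt_of_le ?_ (measure_mono hsub)
    rw [productMultinomial_cBox hp hc j k hk, ENNReal.ofReal_pos]
    exact Finset.prod_pos fun i _ => (hp i).wordWeight_pos _ _

/-! ### The spectrum -/

/-- Peeling off the last digit factorises the sum. The partition function is thus exactly geometric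
in `j`. -/
theorem sum_wordWeight_rpow (hc : 0 < c) {p : Fin c → ℝ} (hp : IsPosProb p) (s : ℝ) (j : ℕ) :
    ∑ k ∈ Finset.range (c ^ j), wordWeight p j k ^ s = (∑ t, p t ^ s) ^ j := by
  induction j with
  | zero => simp [wordWeight_zero]
  | succ j ih =>
    rw [pow_succ, pow_succ, ← ih, Finset.sum_mul_sum, ← Finset.sum_product',
      ← Fin.sum_univ_eq_sum_range (fun k => wordWeight p (j + 1) k ^ s) (c ^ j * c),
      ← finProdFinEquiv.sum_comp, Fintype.sum_prod_type, Finset.sum_product,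
      ← Fin.sum_univ_eq_sum_range (fun k => ∑ t, wordWeight p j k ^ s * p t ^ s)]
    refine Finset.sum_congr rfl fun k _ => Finset.sum_congr rfl fun t _ => ?_
    have h : ((finProdFinEquiv (k, t) : Fin (c ^ j * c)) : ℕ) = (k : ℕ) * c ^ 1 + t := by
      simp [finProdFinEquiv]; ring
    rw [h, wordWeight_add hc p j 1 k t (by simp), wordWeight_one,
      Real.mul_rpow (hp.wordWeight_pos _ _).le (hp.pos t).le]

theorem tauSpectrum_productMultinomial (hp : ∀ i, IsPosProb (p i)) (hc : 2 ≤ c) (s : ℝ) :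
    tauSpectrum c (productMultinomial p) s = ((∑ i, tauVector (p i) s : ℝ) : EReal) := by
  have hc0 : 0 < c := by omega
  have hsum : ∀ j : ℕ, (∑ k : Fin d → Fin (c ^ j),
      ((productMultinomial p).real (cBox c j (fun i => (k i : ℕ)))) ^ s) =
      ∏ i, (∑ t, p i t ^ s) ^ j := fun j => by
    simp_rw [← sum_wordWeight_rpow hc0 (hp _) s j, ← Fin.sum_univ_eq_sum_range
      (fun k => wordWeight (p _) j k ^ s), Finset.prod_univ_sum, Fintype.piFinset_univ]
    refine Finset.sum_congr rfl fun k _ => ?_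
    rw [measureReal_def, productMultinomial_cBox hp hc j _ fun i => (k i).2, ENNReal.toReal_ofReal
      (Finset.prod_nonneg fun i _ => ((hp i).wordWeight_pos _ _).le),
      ← Real.finsetProd_rpow _ _ fun i _ => ((hp i).wordWeight_pos _ _).le]
  have hpos : ∀ i, 0 < ∑ t, p i t ^ s := fun i =>
    Finset.sum_pos (fun t _ => Real.rpow_pos_of_pos ((hp i).pos t) _) ⟨⟨0, hc0⟩, Finset.mem_univ _⟩
  -- The sequence is constant for `j > 0`; the term `j = 0` only carries the default value of `0⁻¹`.
  refine Tendsto.liminf_eq (tendsto_const_nhds.congr' ?_)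
  filter_upwards [eventually_gt_atTop 0] with j hj
  have hjR : (j : ℝ) ≠ 0 := by positivity
  rw [hsum, EReal.coe_eq_coe_iff, Real.logb_prod _ _ fun i _ => (pow_pos (hpos i) _).ne']
  simp only [tauVector, Real.logb_pow, ← Finset.mul_sum, Finset.sum_neg_distrib]
  field_simp

end ProductMeasure

/-! ### Tilted vectors and the Legendre transform -/

section Tilt

variable {c : ℕ} {p : Fin c → ℝ}

theorem IsPosProb.sum_rpow_pos (hp : IsPosProb p) (s : ℝ) : 0 < ∑ k, p k ^ s := by
  have hne : (Finset.univ : Finset (Fin c)).Nonempty := by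
    rw [Finset.nonempty_iff_ne_empty]
    intro h
    have := hp.sum_eq
    simp [h] at this
  exact Finset.sum_pos (fun k _ => Real.rpow_pos_of_pos (hp.pos k) _) hne

theorem tilt_eq (hp : IsPosProb p) (hc : 2 ≤ c) (q : ℝ) (k : Fin c) :
    tilt p q k = p k ^ q / ∑ l, p l ^ q := by
  have hc1 : (1 : ℝ) < c := by exact_mod_cast (by omega : 1 < c)
  rw [tilt, tauVector, Real.rpow_neg (by positivity),
    Real.rpow_logb (by positivity) hc1.ne' (hp.sum_rpow_pos q), inv_mul_eq_div]

theorem isPosProb_tilt (hp : IsPosProb p) (hc : 2 ≤ c) (q : ℝ) : IsPosProb (tilt p q) where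
  pos k := by
    rw [tilt_eq hp hc]
    exact div_pos (Real.rpow_pos_of_pos (hp.pos k) _) (hp.sum_rpow_pos q)
  sum_eq := by
    simp_rw [tilt_eq hp hc, ← Finset.sum_div]
    exact div_self (hp.sum_rpow_pos q).ne'

theorem hasDerivAt_tauVector (hp : IsPosProb p) (hc : 2 ≤ c) (q : ℝ) :
    HasDerivAt (tauVector p) (-∑ k, tilt p q k * Real.logb c (p k)) q := by
  have h1 : HasDerivAt (fun s : ℝ => ∑ k, p k ^ s) (∑ k, p k ^ q * Real.log (p k)) q := by
    refine HasDerivAt.fun_sum fun k _ => ?_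
    exact (Real.hasStrictDerivAt_const_rpow (hp.pos k) q).hasDerivAt
  have h2 := ((h1.log (hp.sum_rpow_pos q).ne').div_const (Real.log c)).neg
  refine h2.congr_deriv ?_
  rw [neg_inj, Finset.sum_div, Finset.sum_div]
  refine Finset.sum_congr rfl fun k _ => ?_
  rw [tilt_eq hp hc, Real.logb]
  ring

/-- A tangent line of the concave function `tauVector p` lies above its graph. -/
theorem tauVector_le_tangent (hp : IsPosProb p) (hc : 2 ≤ c) (q s : ℝ) :
    tauVector p s ≤ tauVector p q + (-∑ k, tilt p q k * Real.logb c (p k)) * (s - q) := by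
  have hlogc : 0 < Real.log c := Real.log_pos (by exact_mod_cast (by omega : 1 < c))
  have hπ := isPosProb_tilt hp hc q
  -- Jensen for the logarithm with the tilted weights and the values `p k ^ (s - q)`, whose mean is
  -- the quotient of the partition functions at `s` and `q`.
  have hJ := strictConcaveOn_log_Ioi.concaveOn.le_map_sum (t := Finset.univ) (w := tilt p q)
    (p := fun k => p k ^ (s - q)) (fun k _ => (hπ.pos k).le) hπ.sum_eq
    (fun k _ => Real.rpow_pos_of_pos (hp.pos k) _)
  have hsum : ∑ k, tilt p q k • p k ^ (s - q) = (∑ k, p k ^ s) / ∑ k, p k ^ q := by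
    rw [Finset.sum_div]
    refine Finset.sum_congr rfl fun k _ => ?_
    rw [tilt_eq hp hc, smul_eq_mul, Real.rpow_sub (hp.pos k)]
    have := (Real.rpow_pos_of_pos (hp.pos k) q).ne'
    field_simp
  rw [hsum, Real.log_div (hp.sum_rpow_pos s).ne' (hp.sum_rpow_pos q).ne'] at hJ
  have hL : ∑ k, tilt p q k • Real.log (p k ^ (s - q)) =
      Real.log c * ((s - q) * ∑ k, tilt p q k * Real.logb c (p k)) := by
    rw [Finset.mul_sum, Finset.mul_sum]
    refine Finset.sum_congr rfl fun k _ => ?_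
    rw [Real.log_rpow (hp.pos k), Real.logb, smul_eq_mul]
    field_simp
  rw [hL] at hJ
  simp only [tauVector, Real.logb]
  rw [← sub_nonneg]
  have : 0 ≤ (Real.log (∑ k, p k ^ s) - Real.log (∑ k, p k ^ q) -
      Real.log c * ((s - q) * ∑ k, tilt p q k * Real.logb c (p k))) / Real.log c :=
    div_nonneg (by linarith) hlogc.le
  convert this using 1
  simp only [Real.logb]
  field_simp
  ring

/-- The entropy in base `c` of a vector. -/
def vecEntropy (p : Fin c → ℝ) : ℝ := -∑ k, p k * Real.logb c (p k)

theorem neg_sum_mul_logb_pos {π : Fin c → ℝ} (hπ : IsPosProb π) (hp : IsPosProb p) (hc : 2 ≤ c) :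
    0 < -∑ k, π k * Real.logb c (p k) := by
  have hc1 : (1 : ℝ) < c := by exact_mod_cast (by omega : 1 < c)
  rw [← Finset.sum_neg_distrib]
  refine Finset.sum_pos (fun k _ => ?_) ⟨⟨0, by omega⟩, Finset.mem_univ _⟩
  have h1 := Real.logb_neg hc1 (hp.pos k) (hp.lt_one hc k)
  nlinarith [hπ.pos k]

/-- Jensen for the logarithm with weights `p k` and values `(p k)⁻¹`, whose mean is `c`. -/
theorem vecEntropy_le_one (hp : IsPosProb p) (hc : 2 ≤ c) : vecEntropy p ≤ 1 := by
  have hlogc : 0 < Real.log c := Real.log_pos (by exact_mod_cast (by omega : 1 < c))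
  have hJ := strictConcaveOn_log_Ioi.concaveOn.le_map_sum (t := Finset.univ) (w := p)
    (p := fun k => (p k)⁻¹) (fun k _ => (hp.pos k).le) hp.sum_eq
    (fun k _ => inv_pos.2 (hp.pos k))
  simp only [smul_eq_mul, fun k => mul_inv_cancel₀ (hp.pos k).ne', Real.log_inv] at hJ
  simp only [Finset.sum_const, Finset.card_univ, Fintype.card_fin, nsmul_eq_mul, mul_one] at hJ
  have h : vecEntropy p = (∑ k, p k * -Real.log (p k)) / Real.log c := by
    rw [vecEntropy, Finset.sum_div, ← Finset.sum_neg_distrib]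
    refine Finset.sum_congr rfl fun k _ => ?_
    rw [Real.logb]; ring
  rw [h, div_le_one hlogc]
  exact hJ

/-- The logarithm of a tilted component is affine in the logarithm of the original one. The
right-hand side is `α q - τ(q)` with `α` the slope at `q`, the value of the Legendre transform. -/
theorem vecEntropy_tilt (hp : IsPosProb p) (hc : 2 ≤ c) (q : ℝ) : vecEntropy (tilt p q) =
    (-∑ k, tilt p q k * Real.logb c (p k)) * q - tauVector p q := by
  have hc1 : (1 : ℝ) < c := by exact_mod_cast (by omega : 1 < c)
  have hπ := isPosProb_tilt hp hc q
  have h : ∀ k, Real.logb c (tilt p q k) = tauVector p q + q * Real.logb c (p k) := fun k => by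
    rw [tilt, Real.logb_mul (Real.rpow_pos_of_pos (by positivity) _).ne'
      (Real.rpow_pos_of_pos (hp.pos k) _).ne', Real.logb_rpow (by positivity) hc1.ne',
      Real.logb_rpow_eq_mul_logb_of_pos (hp.pos k)]
  simp only [vecEntropy, h, mul_add, Finset.sum_add_distrib, ← Finset.sum_mul, hπ.sum_eq]
  rw [neg_mul, Finset.sum_mul]
  simp only [mul_assoc, mul_comm q]
  ring

end Tilt

/-! ### Slope, entropy and Legendre transform for products -/

section Legendre

variable {d c : ℕ} {p : Fin d → Fin c → ℝ}

/-- The derivative of the spectrum of a product of multinomial measures. -/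
def tauSlope (p : Fin d → Fin c → ℝ) (q : ℝ) : ℝ :=
  ∑ i, -∑ k, tilt (p i) q k * Real.logb c (p i k)

/-- The dimension of the measure associated with the tilted vectors. -/
def tiltEntropy (p : Fin d → Fin c → ℝ) (q : ℝ) : ℝ := ∑ i, vecEntropy (tilt (p i) q)

theorem tauSlope_pos (hd : 1 ≤ d) (hc : 2 ≤ c) (hp : ∀ i, IsPosProb (p i)) (q : ℝ) :
    0 < tauSlope p q :=
  Finset.sum_pos (fun i _ => neg_sum_mul_logb_pos (isPosProb_tilt (hp i) hc q) (hp i) hc)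
    ⟨⟨0, hd⟩, Finset.mem_univ _⟩

theorem tiltEntropy_pos (hd : 1 ≤ d) (hc : 2 ≤ c) (hp : ∀ i, IsPosProb (p i)) (q : ℝ) :
    0 < tiltEntropy p q :=
  Finset.sum_pos (fun i _ => neg_sum_mul_logb_pos (isPosProb_tilt (hp i) hc q)
    (isPosProb_tilt (hp i) hc q) hc) ⟨⟨0, hd⟩, Finset.mem_univ _⟩

theorem tiltEntropy_le (hc : 2 ≤ c) (hp : ∀ i, IsPosProb (p i)) (q : ℝ) :
    tiltEntropy p q ≤ d := by
  refine (Finset.sum_le_sum fun i _ => vecEntropy_le_one (isPosProb_tilt (hp i) hc q) hc).trans ?_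
  simp

theorem hasDerivAt_tauSpectrum (hc : 2 ≤ c) (hp : ∀ i, IsPosProb (p i)) (q : ℝ) :
    HasDerivAt (fun s => (tauSpectrum c (productMultinomial p) s).toReal) (tauSlope p q) q := by
  simp_rw [tauSpectrum_productMultinomial hp hc, EReal.toReal_coe]
  exact HasDerivAt.fun_sum fun i _ => hasDerivAt_tauVector (hp i) hc q

/-- The infimum is attained at `q`, since the tangents at `q` lie above the graphs of the `tauVector
(p i)`. -/
theorem tauLegendre_productMultinomial (hc : 2 ≤ c) (hp : ∀ i, IsPosProb (p i)) (q : ℝ) :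
    tauLegendre c (productMultinomial p) (tauSlope p q) = (tiltEntropy p q : EReal) := by
  have hβ : tiltEntropy p q = tauSlope p q * q - ∑ i, tauVector (p i) q := by
    simp only [tiltEntropy, vecEntropy_tilt (hp _) hc, tauSlope, Finset.sum_sub_distrib,
      Finset.sum_mul]
  simp only [tauLegendre, tauSpectrum_productMultinomial hp hc, ← EReal.coe_sub]
  refine le_antisymm (iInf_le_of_le q (by rw [hβ])) (le_iInf fun s => ?_)
  rw [EReal.coe_le_coe_iff, hβ]
  have := Finset.sum_le_sum fun i (_ : i ∈ Finset.univ) => tauVector_le_tangent (hp i) hc q s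
  rw [Finset.sum_add_distrib, ← Finset.sum_mul] at this
  change _ ≤ _ + tauSlope p q * (s - q) at this
  linarith

end Legendre

/-! ### Upper bounds of iterated logarithm type for digit counts -/

section IteratedLogarithm

variable {c : ℕ} {p : Fin c → ℝ}

theorem sum_digitCount (hc : 0 < c) (j k : ℕ) : ∑ t : Fin c, digitCount c t j k = j := by
  induction j generalizing k with
  | zero => simp [digitCount]
  | succ j ih =>
    simp only [digitCount, Finset.sum_add_distrib, ih]
    congr 1
    rw [Finset.sum_eq_single ⟨k % c, Nat.mod_lt _ hc⟩]
    · simp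
    · intro t _ ht
      rw [if_neg]
      exact fun h => ht (Fin.ext h.symm)
    · simp

/-- The sum of `z` over the digits of a word. -/
def wordSum (z : Fin c → ℝ) (j k : ℕ) : ℝ := ∑ t : Fin c, z t * digitCount c t j k

theorem wordSum_cons (hc : 0 < c) (z : Fin c → ℝ) (j : ℕ) (t : Fin c) {k : ℕ} (hk : k < c ^ j) :
    wordSum z (j + 1) (t * c ^ j + k) = z t + wordSum z j k := by
  have h : ∀ s : Fin c, (digitCount c s (j + 1) (t * c ^ j + k) : ℝ) =
      (if s = t then 1 else 0) + digitCount c s j k := fun s => by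
    rw [add_comm j 1, digitCount_add hc s 1 j t k hk]
    push_cast
    congr 1
    simp [digitCount, Nat.mod_eq_of_lt t.2, Fin.ext_iff, eq_comm]
  simp only [wordSum, h, mul_add, Finset.sum_add_distrib]
  simp

/-- From `eˣ ≤ 1 + x + x²` for `|x| ≤ 1`; centring removes the linear term. -/
theorem sum_mul_exp_le (hp : IsPosProb p) {z : Fin c → ℝ} (hz : ∀ t, |z t| ≤ 1)
    (hz0 : ∑ t, p t * z t = 0) {b : ℝ} (hb0 : 0 ≤ b) (hb1 : b ≤ 1) :
    ∑ t, p t * Real.exp (b * z t) ≤ Real.exp (b ^ 2) := by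
  have h : ∀ t, Real.exp (b * z t) ≤ 1 + b * z t + b ^ 2 := fun t => by
    have h1 : |b * z t| ≤ b := by
      rw [abs_mul, abs_of_nonneg hb0]
      exact mul_le_of_le_one_right hb0 (hz t)
    have h2 := (abs_le.1 (Real.abs_exp_sub_one_sub_id_le (h1.trans hb1))).2
    have h3 : (b * z t) ^ 2 ≤ b ^ 2 := sq_le_sq' (abs_le.1 h1).1 (abs_le.1 h1).2
    linarith
  calc ∑ t, p t * Real.exp (b * z t) ≤ ∑ t, p t * (1 + b * z t + b ^ 2) :=
        Finset.sum_le_sum fun t _ => mul_le_mul_of_nonneg_left (h t) (hp.pos t).le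
    _ = (∑ t, p t) + b * ∑ t, p t * z t + (∑ t, p t) * b ^ 2 := by
        rw [Finset.mul_sum, Finset.sum_mul, ← Finset.sum_add_distrib, ← Finset.sum_add_distrib]
        exact Finset.sum_congr rfl fun t _ => by ring
    _ = 1 + b ^ 2 := by rw [hp.sum_eq, hz0]; ring
    _ ≤ Real.exp (b ^ 2) := by linarith [Real.add_one_le_exp (b ^ 2)]

theorem measurableSet_exists_floor (c n : ℕ) (P : ℕ → ℕ → Prop) :
    MeasurableSet {y : ℝ | ∃ j ≤ n, P j ⌊(c : ℝ) ^ j * y⌋₊} := by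
  have : {y : ℝ | ∃ j ≤ n, P j ⌊(c : ℝ) ^ j * y⌋₊} =
      ⋃ j, ⋃ (_ : j ≤ n), (fun y : ℝ => ⌊(c : ℝ) ^ j * y⌋₊) ⁻¹' {k | P j k} := by
    ext y; simp
  rw [this]
  exact MeasurableSet.iUnion fun j => MeasurableSet.iUnion fun _ =>
    measurable_floor_pow_mul c j (Set.to_countable _).measurableSet

/-- An exponential maximal inequality for sums over digits. -/
theorem multinomial_exists_le_wordSum_le (hp : IsPosProb p) (hc : 2 ≤ c) {z : Fin c → ℝ}
    (hz : ∀ t, |z t| ≤ 1) (hz0 : ∑ t, p t * z t = 0) {b : ℝ} (hb0 : 0 ≤ b) (hb1 : b ≤ 1)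
    (u : ℝ) (n : ℕ) (x : ℝ) :
    multinomial p {y | ∃ j ≤ n, u ≤ x + wordSum z j ⌊(c : ℝ) ^ j * y⌋₊} ≤
      ENNReal.ofReal (Real.exp (b * (x - u) + n * b ^ 2)) := by
  have hP := hp.isProbabilityMeasure_multinomial
  have hc0 : 0 < c := by omega
  have hz' : ∀ k, wordSum z 0 k = 0 := fun k => by simp [wordSum, digitCount]
  -- With a free starting value, conditioning on the first digit `t` merely replaces `x` by `x + z
  -- t`. This plays the role of a stopping-time argument.
  induction n generalizing x with
  | zero =>
    by_cases hux : u ≤ x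
    · refine prob_le_one.trans ?_
      rw [← ENNReal.ofReal_one]
      refine ENNReal.ofReal_le_ofReal (Real.one_le_exp ?_)
      have : 0 ≤ b * (x - u) := mul_nonneg hb0 (by linarith)
      simpa using this
    · have : {y : ℝ | ∃ j ≤ 0, u ≤ x + wordSum z j ⌊(c : ℝ) ^ j * y⌋₊} = ∅ := by
        ext y
        simp [hz']
        linarith
      rw [this, measure_empty]
      exact zero_le
  | succ n ih =>
    by_cases hux : u ≤ x
    · refine prob_le_one.trans ?_
      rw [← ENNReal.ofReal_one]
      refine ENNReal.ofReal_le_ofReal (Real.one_le_exp ?_)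
      have : 0 ≤ b * (x - u) := mul_nonneg hb0 (by linarith)
      positivity
    · rw [multinomial_apply hp (measurableSet_exists_floor c (n + 1)
        fun j k => u ≤ x + wordSum z j k)]
      calc ∑ t : Fin c, ENNReal.ofReal (p t) * multinomial p ((fun y : ℝ => ((t : ℕ) + y) / c) ⁻¹'
            {y | ∃ j ≤ n + 1, u ≤ x + wordSum z j ⌊(c : ℝ) ^ j * y⌋₊})
          ≤ ∑ t : Fin c, ENNReal.ofReal (p t) *
            ENNReal.ofReal (Real.exp (b * (x + z t - u) + n * b ^ 2)) := by
            refine Finset.sum_le_sum fun t _ => ?_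
            refine mul_le_mul_right (le_trans (measure_mono_ae ?_) (ih (x + z t))) _
            filter_upwards [multinomial_Ico hp hc] with y hy hmem
            obtain ⟨j, hj, hju⟩ := hmem
            cases j with
            | zero => rw [hz', add_zero] at hju; exact absurd hju hux
            | succ j =>
              refine ⟨j, by omega, ?_⟩
              rwa [floor_pow_succ_mul hc0 j t hy.1,
                wordSum_cons hc0 z j t (floor_pow_mul_lt hc0 hy), ← add_assoc] at hju
        _ = ENNReal.ofReal (Real.exp (b * (x - u) + n * b ^ 2) *
            ∑ t, p t * Real.exp (b * z t)) := by
            rw [Finset.mul_sum, ENNReal.ofReal_sum_of_nonneg fun t _ => by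
              have := (hp.pos t).le; positivity]
            refine Finset.sum_congr rfl fun t _ => ?_
            rw [← ENNReal.ofReal_mul (hp.pos t).le, mul_left_comm, ← Real.exp_add]
            congr 3
            ring
        _ ≤ _ := by
            refine ENNReal.ofReal_le_ofReal ?_
            calc _ ≤ Real.exp (b * (x - u) + n * b ^ 2) * Real.exp (b ^ 2) :=
                  mul_le_mul_of_nonneg_left (sum_mul_exp_le hp hz hz0 hb0 hb1) (Real.exp_pos _).le
              _ = _ := by rw [← Real.exp_add]; push_cast; congr 1; ring

/-- The function `√(j log log j)`. -/
def lilBound (j : ℕ) : ℝ := √(j * Real.log (Real.log j))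

theorem eventually_natLog_le : ∀ᶠ j : ℕ in atTop,
    Real.log (Nat.log 2 j + 1 : ℕ) ≤ 2 * Real.log (Real.log j) := by
  have ht : Tendsto (fun j : ℕ => Real.log j) atTop atTop :=
    Real.tendsto_log_atTop.comp tendsto_natCast_atTop_atTop
  filter_upwards [ht.eventually_ge_atTop 3, eventually_gt_atTop 0] with j hj hj0
  have h1 : (Nat.log 2 j : ℝ) ≤ 2 * Real.log j := by
    have h2 : ((2 : ℝ) ^ Nat.log 2 j) ≤ j := by exact_mod_cast Nat.pow_log_le_self 2 hj0.ne'
    have h3 := Real.log_le_log (by positivity) h2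
    rw [Real.log_pow] at h3
    have h4 : (1 : ℝ) / 2 ≤ Real.log 2 := by linarith [Real.log_two_gt_d9]
    nlinarith [Nat.cast_nonneg (α := ℝ) (Nat.log 2 j)]
  have h5 : 2 * Real.log (Real.log j) = Real.log (Real.log j ^ 2) := by rw [Real.log_pow]; simp
  rw [h5]
  refine Real.log_le_log (by positivity) ?_
  push_cast
  nlinarith

/-- The bound that the iterated logarithm imposes on a sum of at most `2 ^ l` digits. -/
def blockBound (l : ℕ) : ℝ := √(8 * 2 ^ l * Real.log l)

theorem blockBound_sq (l : ℕ) : blockBound l ^ 2 = 8 * 2 ^ l * Real.log l :=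
  Real.sq_sqrt (mul_nonneg (by positivity) (Real.log_natCast_nonneg l))

/-- Makes the parameter `blockBound l / (2 * 2 ^ l)` at most `1`, as the maximal inequality
requires. -/
theorem blockBound_le {l : ℕ} (hl : 1 ≤ l) : blockBound l ≤ 2 * 2 ^ l := by
  have h2l : (0 : ℝ) < 2 ^ l := by positivity
  refine (abs_le_of_sq_le_sq' ?_ (by positivity)).2
  have h3 : 2 * Real.log l ≤ 2 ^ l := by
    have h4 := Real.log_le_sub_one_of_pos (by exact_mod_cast hl : (0 : ℝ) < l)
    have h5 : ((l - 1 : ℕ) : ℝ) < 2 ^ (l - 1) := by exact_mod_cast Nat.lt_two_pow_self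
    have h6 : (2 : ℝ) ^ l = 2 * 2 ^ (l - 1) := by
      rw [← pow_succ', Nat.sub_add_cancel hl]
    rw [Nat.cast_sub hl] at h5
    push_cast at h5
    linarith
  calc blockBound l ^ 2 = 4 * 2 ^ l * (2 * Real.log l) := by rw [blockBound_sq]; ring
    _ ≤ 4 * 2 ^ l * 2 ^ l := by gcongr
    _ = (2 * 2 ^ l) ^ 2 := by ring

/-- With `n = 2 ^ l` and `u = blockBound l`, the exponent `-b u + n b²` is least at `b = u / (2n)`,
where it is `-u² / (4n) = -2 log l`. The factor `8` in `blockBound` is what makes the bound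
summable. -/
theorem multinomial_block_le (hp : IsPosProb p) (hc : 2 ≤ c) {z : Fin c → ℝ}
    (hz : ∀ t, |z t| ≤ 1) (hz0 : ∑ t, p t * z t = 0) {l : ℕ} (hl : 1 ≤ l) :
    multinomial p {y | ∃ j ≤ 2 ^ l, blockBound l ≤ 0 + wordSum z j ⌊(c : ℝ) ^ j * y⌋₊} ≤
      ENNReal.ofReal (1 / (l : ℝ) ^ 2) := by
  have hlR : (0 : ℝ) < l := by exact_mod_cast hl
  have hu0 : 0 ≤ blockBound l := Real.sqrt_nonneg _
  refine (multinomial_exists_le_wordSum_le hp hc hz hz0 (b := blockBound l / (2 * 2 ^ l))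
    (by positivity) (div_le_one_of_le₀ (blockBound_le hl) (by positivity)) (blockBound l) (2 ^ l)
    0).trans (ENNReal.ofReal_le_ofReal (le_of_eq ?_))
  have h7 : blockBound l / (2 * 2 ^ l) * (0 - blockBound l) +
      ((2 ^ l : ℕ) : ℝ) * (blockBound l / (2 * 2 ^ l)) ^ 2 = -(2 * Real.log l) := by
    push_cast
    have : blockBound l / (2 * 2 ^ l) * (0 - blockBound l) +
        2 ^ l * (blockBound l / (2 * 2 ^ l)) ^ 2 = -(blockBound l ^ 2) / (4 * 2 ^ l) := by
      field_simp; ring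
    rw [this, blockBound_sq]
    field_simp
    ring
  rw [h7, Real.exp_neg, two_mul, Real.exp_add, Real.exp_log hlR, one_div, sq]

theorem ae_eventually_lt_blockBound (hp : IsPosProb p) (hc : 2 ≤ c) {z : Fin c → ℝ}
    (hz : ∀ t, |z t| ≤ 1) (hz0 : ∑ t, p t * z t = 0) :
    ∀ᵐ y ∂multinomial p, ∀ᶠ l : ℕ in atTop, ∀ j ≤ 2 ^ l,
      wordSum z j ⌊(c : ℝ) ^ j * y⌋₊ < blockBound l := by
  have hP := hp.isProbabilityMeasure_multinomial
  have hs : Summable fun l : ℕ => 1 / ((l + 1 : ℕ) : ℝ) ^ 2 :=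
    (summable_nat_add_iff 1).2 (Real.summable_one_div_nat_pow.2 (by norm_num : 1 < 2))
  have hsum : ∑' l, multinomial p
      {y | ∃ j ≤ 2 ^ l, blockBound l ≤ 0 + wordSum z j ⌊(c : ℝ) ^ j * y⌋₊} ≠ ∞ := by
    rw [tsum_eq_zero_add' ENNReal.summable]
    refine ENNReal.add_ne_top.2 ⟨measure_ne_top _ _, ?_⟩
    exact ne_top_of_le_ne_top hs.tsum_ofReal_ne_top
      (ENNReal.tsum_le_tsum fun l => multinomial_block_le hp hc hz hz0 (by omega : 1 ≤ l + 1))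
  filter_upwards [ae_eventually_notMem hsum] with y hy
  filter_upwards [hy] with l hl j hj
  by_contra! hlt
  exact hl ⟨j, hj, by rw [zero_add]; exact hlt⟩

/-- The block that contains `j` has `2 ^ l ≤ 2 j` and `log l ≤ 2 log log j`, so the square is at
most `32 j log log j`, and `32 ≤ 6²`. -/
theorem blockBound_natLog_le : ∀ᶠ j : ℕ in atTop,
    blockBound (Nat.log 2 j + 1) ≤ 6 * lilBound j := by
  filter_upwards [eventually_natLog_le, eventually_gt_atTop 0] with j hlog hj0
  set l := Nat.log 2 j + 1 with hl
  have hjR : (0 : ℝ) < j := by exact_mod_cast hj0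
  have h2 : (2 : ℝ) ^ l ≤ 2 * j := by
    have : 2 ^ Nat.log 2 j ≤ j := Nat.pow_log_le_self 2 hj0.ne'
    rw [hl, pow_succ']
    exact_mod_cast Nat.mul_le_mul_left 2 this
  have hl0 : 0 ≤ Real.log l := Real.log_natCast_nonneg l
  have h4 : 0 ≤ (j : ℝ) * Real.log (Real.log j) := mul_nonneg hjR.le (by linarith)
  rw [lilBound, blockBound]
  refine Real.sqrt_le_iff.2 ⟨by positivity, ?_⟩
  rw [mul_pow, Real.sq_sqrt h4]
  have h3 : 2 ^ l * Real.log l ≤ 2 * j * (2 * Real.log (Real.log j)) :=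
    mul_le_mul h2 hlog hl0 (by positivity)
  linarith

theorem ae_eventually_wordSum_le (hp : IsPosProb p) (hc : 2 ≤ c) {z : Fin c → ℝ}
    (hz : ∀ t, |z t| ≤ 1) (hz0 : ∑ t, p t * z t = 0) :
    ∀ᵐ y ∂multinomial p, ∀ᶠ j : ℕ in atTop,
      wordSum z j ⌊(c : ℝ) ^ j * y⌋₊ ≤ 6 * lilBound j := by
  filter_upwards [ae_eventually_lt_blockBound hp hc hz hz0] with y hy
  have htl : Tendsto (fun j : ℕ => Nat.log 2 j + 1) atTop atTop := by
    refine tendsto_atTop.2 fun b => ?_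
    filter_upwards [eventually_ge_atTop (2 ^ b)] with j hj
    exact (Nat.le_log_of_pow_le (by norm_num) hj).trans (Nat.le_succ _)
  filter_upwards [htl.eventually hy, blockBound_natLog_le] with j hj hlog
  exact (hj j (Nat.lt_pow_succ_log_self (by norm_num) j).le).le.trans hlog

theorem ae_eventually_digitCount (hp : IsPosProb p) (hc : 2 ≤ c) (t : Fin c) :
    ∀ᵐ y ∂multinomial p, ∀ᶠ j : ℕ in atTop,
      |(digitCount c t j ⌊(c : ℝ) ^ j * y⌋₊ : ℝ) - j * p t| ≤ 6 * lilBound j := by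
  have hc0 : 0 < c := by omega
  -- The centred indicator of the digit `t`; applying the bound to `z` and to `-z` controls both
  -- signs.
  set z : Fin c → ℝ := fun s => (if s = t then 1 else 0) - p t with hz
  have hsum : ∀ j k, wordSum z j k = (digitCount c t j k : ℝ) - j * p t := fun j k => by
    have : (∑ s : Fin c, (digitCount c s j k : ℝ)) = j := by exact_mod_cast sum_digitCount hc0 j k
    simp only [wordSum, hz, sub_mul, Finset.sum_sub_distrib, ← Finset.mul_sum, this]
    simp [mul_comm]
  have h1 : ∀ s, |z s| ≤ 1 := fun s => by
    have h0 := (hp.pos t).le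
    have h1 := hp.le_one t
    simp only [hz]
    split_ifs <;> rw [abs_le] <;> constructor <;> linarith
  have h0 : ∑ s, p s * z s = 0 := by
    simp [hz, mul_sub, Finset.sum_sub_distrib, ← Finset.sum_mul, hp.sum_eq]
  have hneg : ∀ j k, wordSum (fun s => -z s) j k = -wordSum z j k := fun j k => by
    simp [wordSum]
  filter_upwards [ae_eventually_wordSum_le hp hc h1 h0,
    ae_eventually_wordSum_le hp hc (z := fun s => -z s) (fun s => by rw [abs_neg]; exact h1 s)
      (by simp [h0])] with y hy1 hy2
  filter_upwards [hy1, hy2] with j hj1 hj2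
  rw [hneg] at hj2
  rw [← hsum, abs_le]
  constructor <;> linarith

/-! ### Runs of digits -/

theorem IsPosProb.exists_le_lt_one (hp : IsPosProb p) (hc : 2 ≤ c) :
    ∃ θ : ℝ, 0 < θ ∧ θ < 1 ∧ ∀ t, p t ≤ θ := by
  have : Nonempty (Fin c) := ⟨⟨0, by omega⟩⟩
  obtain ⟨t, ht⟩ := Finite.exists_max p
  exact ⟨p t, hp.pos t, hp.lt_one hc t, ht⟩

theorem wordWeight_le_pow (hp : IsPosProb p) (hc : 0 < c) {θ : ℝ} (hθ : ∀ t, p t ≤ θ) (j k : ℕ) :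
    wordWeight p j k ≤ θ ^ j := by
  calc wordWeight p j k ≤ ∏ t : Fin c, θ ^ digitCount c t j k :=
        Finset.prod_le_prod (fun t _ => pow_nonneg (hp.pos t).le _) fun t _ =>
          pow_le_pow_left₀ (hp.pos t).le (hθ t) _
    _ = θ ^ j := by rw [Finset.prod_pow_eq_pow_sum, sum_digitCount hc]

/-- The residue modulo `c ^ h` reads the last `h` digits of the prefix. Self-similarity removes the
`b` leading digits one at a time, since they are invisible modulo `c ^ h`. -/
theorem multinomial_floor_mod_le (hp : IsPosProb p) (hc : 2 ≤ c) {θ : ℝ} (hθ : ∀ t, p t ≤ θ)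
    (h b r : ℕ) (hr : r < c ^ h) :
    multinomial p {y | ⌊(c : ℝ) ^ (h + b) * y⌋₊ % c ^ h = r} ≤ ENNReal.ofReal (θ ^ h) := by
  have hc0 : 0 < c := by omega
  induction b with
  | zero =>
    refine le_trans (measure_mono_ae ?_) ((multinomial_floor_eq hp hc h r hr).le.trans
      (ENNReal.ofReal_le_ofReal (wordWeight_le_pow hp hc0 hθ h r)))
    filter_upwards [multinomial_Ico hp hc] with y hy hmem
    exact (Nat.mod_eq_of_lt (floor_pow_mul_lt hc0 hy)).symm.trans hmem
  | succ b ih =>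
    rw [multinomial_apply hp (S := {y | ⌊(c : ℝ) ^ (h + (b + 1)) * y⌋₊ % c ^ h = r})
      (measurable_floor_pow_mul c _ (Set.to_countable {k | k % c ^ h = r}).measurableSet)]
    refine (Finset.sum_le_sum fun t _ => mul_le_mul_right
      (le_trans (measure_mono_ae ?_) ih) _).trans ?_
    · filter_upwards [multinomial_Ico hp hc] with y hy hmem
      change ⌊(c : ℝ) ^ (h + b + 1) * (((t : ℕ) + y) / c)⌋₊ % c ^ h = r at hmem
      rw [floor_pow_succ_mul hc0 _ t hy.1, pow_add, mul_comm (c ^ h), ← mul_assoc, add_comm,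
        Nat.add_mul_mod_self_right] at hmem
      exact hmem
    · rw [← Finset.sum_mul, ← ENNReal.ofReal_sum_of_nonneg fun t _ => (hp.pos t).le, hp.sum_eq,
        ENNReal.ofReal_one, one_mul]

/-- With `n = Nat.sqrt j`, eventually `n⁴ θⁿ ≤ 1`, while `j ≤ 4 n²`; hence `θⁿ ≤ 16 / j²`. -/
theorem summable_pow_sqrt {θ : ℝ} (h0 : 0 < θ) (h1 : θ < 1) :
    Summable fun j : ℕ => θ ^ Nat.sqrt j := by
  have ht := tendsto_pow_const_mul_const_pow_of_abs_lt_one 4 (by rwa [abs_of_pos h0] : |θ| < 1)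
  have hs : Tendsto Nat.sqrt atTop atTop :=
    tendsto_atTop.2 fun b => by
      filter_upwards [eventually_ge_atTop (b * b)] with j hj
      exact Nat.le_sqrt.2 hj
  have h16 : Summable fun j : ℕ => 16 * (1 / (j : ℝ) ^ 2) :=
    (Real.summable_one_div_nat_pow.2 (by norm_num : 1 < 2)).mul_left 16
  refine Summable.of_norm_bounded_eventually_nat h16 ?_
  filter_upwards [(hs.eventually (ht.eventually_le_const one_pos)), hs.eventually_ge_atTop 1,
    eventually_gt_atTop 0] with j hj hs1 hj0
  have hjR : (0 : ℝ) < j := by exact_mod_cast hj0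
  have hsR : (1 : ℝ) ≤ Nat.sqrt j := by exact_mod_cast hs1
  have h3 : (j : ℝ) ≤ 4 * (Nat.sqrt j : ℝ) ^ 2 := by
    have : (j : ℝ) < (Nat.sqrt j + 1) * (Nat.sqrt j + 1) := by exact_mod_cast Nat.lt_succ_sqrt j
    nlinarith
  have h4 : (j : ℝ) ^ 2 ≤ 16 * (Nat.sqrt j : ℝ) ^ 4 := by
    calc (j : ℝ) ^ 2 ≤ (4 * (Nat.sqrt j : ℝ) ^ 2) ^ 2 := by gcongr
      _ = _ := by ring
  rw [Real.norm_of_nonneg (by positivity), mul_one_div, le_div_iff₀ (by positivity)]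
  have h5 : 0 < θ ^ Nat.sqrt j := by positivity
  nlinarith

/-- Borel–Cantelli for the last `√j` digits, to be used with the two words that let a carry through:
all digits `0` and all digits `c - 1`. -/
theorem ae_eventually_floor_mod_ne (hp : IsPosProb p) (hc : 2 ≤ c) (r : ℕ → ℕ)
    (hr : ∀ h, r h < c ^ h) :
    ∀ᵐ y ∂multinomial p, ∀ᶠ j : ℕ in atTop,
      ⌊(c : ℝ) ^ j * y⌋₊ % c ^ Nat.sqrt j ≠ r (Nat.sqrt j) := by
  obtain ⟨θ, h0, h1, hθ⟩ := hp.exists_le_lt_one hc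
  refine ae_eventually_notMem (s := fun j => {y | ⌊(c : ℝ) ^ j * y⌋₊ % c ^ Nat.sqrt j =
    r (Nat.sqrt j)}) (ne_top_of_le_ne_top (summable_pow_sqrt h0 h1).tsum_ofReal_ne_top
    (ENNReal.tsum_le_tsum fun j => ?_))
  obtain ⟨b, hb⟩ := Nat.exists_eq_add_of_le (Nat.sqrt_le_self j)
  have := multinomial_floor_mod_le hp hc hθ (Nat.sqrt j) b _ (hr (Nat.sqrt j))
  rwa [← hb] at this

/-! ### Digit counts of neighbouring words -/

/-- The word `κ` of length `j` is not one of the two extreme ones, and the digit counts of its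
neighbours have almost the frequencies `p`. -/
def BalancedWord (p : Fin c → ℝ) (j κ : ℕ) : Prop :=
  1 ≤ κ ∧ κ + 2 ≤ c ^ j ∧ ∀ k : ℕ, |(k : ℤ) - κ| ≤ 1 →
    ∀ t : Fin c, |(digitCount c t j k : ℝ) - j * p t| ≤ 7 * lilBound j

theorem abs_digitCount_sub_le (hc : 0 < c) (t h b k k' : ℕ) (hkk' : k / c ^ h = k' / c ^ h) :
    |(digitCount c t (b + h) k : ℝ) - digitCount c t (b + h) k'| ≤ h := by
  have key : ∀ k, digitCount c t (b + h) k =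
      digitCount c t b (k / c ^ h) + digitCount c t h (k % c ^ h) := fun k => by
    conv_lhs => rw [← Nat.div_add_mod' k (c ^ h)]
    exact digitCount_add hc t b h _ _ (Nat.mod_lt _ (by positivity))
  have h1 : (digitCount c t h (k % c ^ h) : ℝ) ≤ h := by exact_mod_cast digitCount_le _ _ _ _
  have h2 : (digitCount c t h (k' % c ^ h) : ℝ) ≤ h := by exact_mod_cast digitCount_le _ _ _ _
  have h3 : (0 : ℝ) ≤ digitCount c t h (k % c ^ h) := by positivity
  have h4 : (0 : ℝ) ≤ digitCount c t h (k' % c ^ h) := by positivity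
  rw [key, key, hkk', abs_le]
  push_cast
  constructor <;> linarith

/-- Adding or subtracting one can change the quotient by `M` only from the residues `M - 1` and `0`.
-/
theorem div_eq_div_of_neighbor {M k κ : ℕ} (h0 : κ % M ≠ 0) (h1 : κ % M ≠ M - 1)
    (hk : |(k : ℤ) - κ| ≤ 1) : k / M = κ / M := by
  rcases Nat.eq_zero_or_pos M with rfl | hM
  · simp
  have hlt := Nat.mod_lt κ hM
  have hκ := Nat.div_add_mod' κ M
  rw [abs_le] at hk
  refine Nat.div_eq_of_lt_le ?_ ?_
  · omega
  · rw [Nat.succ_mul]; omega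

theorem ae_eventually_balancedWord (hp : IsPosProb p) (hc : 2 ≤ c) :
    ∀ᵐ y ∂multinomial p, ∀ᶠ j : ℕ in atTop, BalancedWord p j ⌊(c : ℝ) ^ j * y⌋₊ := by
  have hc0 : 0 < c := by omega
  filter_upwards [multinomial_Ico hp hc,
    ae_eventually_floor_mod_ne hp hc (fun _ => 0) (fun h => by positivity),
    ae_eventually_floor_mod_ne hp hc (fun h => c ^ h - 1)
      (fun h => Nat.sub_lt (by positivity) one_pos),
    ae_all_iff.2 (ae_eventually_digitCount hp hc)] with y hy h0 h1 hcount
  have hll : Tendsto (fun j : ℕ => Real.log (Real.log j)) atTop atTop :=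
    Real.tendsto_log_atTop.comp (Real.tendsto_log_atTop.comp tendsto_natCast_atTop_atTop)
  filter_upwards [h0, h1, eventually_all.2 hcount, hll.eventually_ge_atTop 1] with j hj0 hj1 hjc hjl
  set κ := ⌊(c : ℝ) ^ j * y⌋₊ with hκ
  have hκlt : κ < c ^ j := floor_pow_mul_lt hc0 hy
  obtain ⟨b, hb⟩ := Nat.exists_eq_add_of_le' (Nat.sqrt_le_self j)
  refine ⟨?_, ?_, fun k hk t => ?_⟩
  · by_contra hlt
    exact hj0 (by rw [show κ = 0 by omega, Nat.zero_mod])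
  · by_contra hlt
    refine hj1 ?_
    have hM : 0 < c ^ Nat.sqrt j := by positivity
    have hcj : c ^ j = (c ^ b - 1) * c ^ Nat.sqrt j + c ^ Nat.sqrt j := by
      rw [← Nat.succ_mul, Nat.succ_eq_add_one, Nat.sub_add_cancel (Nat.one_le_pow _ _ hc0),
        ← pow_add, ← hb]
    have : κ = (c ^ Nat.sqrt j - 1) + (c ^ b - 1) * c ^ Nat.sqrt j := by omega
    rw [this, Nat.add_mul_mod_self_right, Nat.mod_eq_of_lt (Nat.sub_lt hM one_pos)]
  · have h2 := abs_digitCount_sub_le hc0 t (Nat.sqrt j) b k κ (div_eq_div_of_neighbor hj0 hj1 hk)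
    rw [← hb] at h2
    -- A neighbour differs in at most the last `√j` digits, which costs one more `lilBound`: this is
    -- `7 = 6 + 1`.
    have h3 : (Nat.sqrt j : ℝ) ≤ lilBound j := by
      refine (Real.nat_sqrt_le_real_sqrt).trans (Real.sqrt_le_sqrt ?_)
      nlinarith [Nat.cast_nonneg (α := ℝ) j]
    have h4 := abs_le.1 h2
    have h5 := abs_le.1 (hjc t)
    rw [abs_le]
    constructor <;> linarith

end IteratedLogarithm

/-! ### Gauge functions -/

/-- A function `h` of `L = |log r|` that generates a gauge function for `L ≥ L₀`. -/
structure GaugeGen (h : ℝ → ℝ) (L₀ : ℝ) : Prop where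
  continuousOn : ContinuousOn h (Set.Ici L₀)
  antitoneOn : AntitoneOn h (Set.Ici L₀)
  nonneg : ∀ L ≥ L₀, 0 ≤ h L
  tendsto_zero : Tendsto h atTop (𝓝 0)
  monotoneOn : MonotoneOn (fun L => L * h L) (Set.Ici L₀)
  tendsto_atTop : Tendsto (fun L => L * h L) atTop atTop

/-- The gauge function on `[0, ∞)` generated by `h`. -/
def gaugeOf (h : ℝ → ℝ) (L₀ r : ℝ) : ℝ :=
  if r ≤ 0 then 0 else h (max (-Real.log r) L₀)

theorem gaugeOf_of_pos (h : ℝ → ℝ) (L₀ : ℝ) {r : ℝ} (hr : 0 < r) :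
    gaugeOf h L₀ r = h (max (-Real.log r) L₀) := if_neg hr.not_ge

namespace GaugeGen

variable {h : ℝ → ℝ} {L₀ : ℝ}

theorem gaugeOf_nonneg (H : GaugeGen h L₀) (r : ℝ) : 0 ≤ gaugeOf h L₀ r := by
  unfold gaugeOf
  split_ifs
  · exact le_rfl
  · exact H.nonneg _ (le_max_right _ _)

theorem monotone_gaugeOf (H : GaugeGen h L₀) : Monotone (gaugeOf h L₀) := by
  intro r s hrs
  rcases le_or_gt r 0 with hr | hr
  · rw [gaugeOf, if_pos hr]
    exact H.gaugeOf_nonneg s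
  · rw [gaugeOf_of_pos h L₀ hr, gaugeOf_of_pos h L₀ (hr.trans_le hrs)]
    refine H.antitoneOn (Set.mem_Ici.2 (le_max_right _ _)) (Set.mem_Ici.2 (le_max_right _ _)) (max_le_max_right _ ?_)
    exact neg_le_neg (Real.log_le_log hr hrs)

theorem tendsto_gaugeOf_zero (H : GaugeGen h L₀) :
    Tendsto (gaugeOf h L₀) (𝓝[>] 0) (𝓝 0) := by
  have h1 : Tendsto (fun r : ℝ => max (-Real.log r) L₀) (𝓝[>] 0) atTop :=
    tendsto_atTop_mono (fun r => le_max_left _ _)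
      (tendsto_neg_atBot_atTop.comp Real.tendsto_log_nhdsGT_zero)
  refine (H.tendsto_zero.comp h1).congr' ?_
  filter_upwards [self_mem_nhdsWithin] with r hr
  exact (gaugeOf_of_pos h L₀ hr).symm

theorem continuousOn_gaugeOf (H : GaugeGen h L₀) : ContinuousOn (gaugeOf h L₀) (Set.Ici 0) := by
  intro r hr
  rcases eq_or_lt_of_le (Set.mem_Ici.1 hr) with rfl | hr
  · rw [← Set.Ioi_insert, continuousWithinAt_insert_self, ContinuousWithinAt, gaugeOf,
      if_pos le_rfl]
    exact H.tendsto_gaugeOf_zero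
  · refine ContinuousAt.continuousWithinAt ?_
    have h1 : ContinuousOn (fun s : ℝ => h (max (-Real.log s) L₀)) (Set.Ioi 0) := by
      refine H.continuousOn.comp ?_ fun s _ => Set.mem_Ici.2 (le_max_right _ _)
      exact ((Real.continuousOn_log.mono fun s (hs : 0 < s) => hs.ne').neg).sup continuousOn_const
    refine (h1.continuousAt (Ioi_mem_nhds hr)).congr ?_
    filter_upwards [Ioi_mem_nhds hr] with s hs
    exact (gaugeOf_of_pos h L₀ hs).symm

/-- Freezing `h` at its value in `L₀` keeps the product monotone: below `L₀` it is linear with slope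
`h L₀ ≥ 0`. -/
theorem monotoneOn_mul_max (H : GaugeGen h L₀) :
    MonotoneOn (fun L => L * h (max L L₀)) (Set.Ici 0) := by
  intro a (ha : 0 ≤ a) b _ hab
  have hb := ha.trans hab
  rcases le_total b L₀ with hbL | hbL
  · simp only [max_eq_right hbL, max_eq_right (hab.trans hbL)]
    exact mul_le_mul_of_nonneg_right hab (H.nonneg _ le_rfl)
  · rcases le_total a L₀ with haL | haL
    · simp only [max_eq_left hbL, max_eq_right haL]
      exact (mul_le_mul_of_nonneg_right haL (H.nonneg _ le_rfl)).trans
        (H.monotoneOn (Set.mem_Ici.2 le_rfl) hbL hbL)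
    · simp only [max_eq_left hbL, max_eq_left haL]
      exact H.monotoneOn haL hbL hab

theorem rpow_neg_gaugeOf {r : ℝ} (hr : 0 < r) : r ^ (-gaugeOf h L₀ r) =
    Real.exp (-Real.log r * h (max (-Real.log r) L₀)) := by
  rw [Real.rpow_def_of_pos hr, gaugeOf_of_pos h L₀ hr]
  congr 1
  ring

theorem antitoneOn_rpow_neg (H : GaugeGen h L₀) :
    AntitoneOn (fun r : ℝ => r ^ (-gaugeOf h L₀ r)) (Set.Ioc 0 1) := by
  intro r hr s hs hrs
  simp only [rpow_neg_gaugeOf hr.1, rpow_neg_gaugeOf hs.1]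
  refine Real.exp_le_exp.2 (H.monotoneOn_mul_max ?_ ?_ (neg_le_neg (Real.log_le_log hr.1 hrs)))
  · simpa using Real.log_nonpos hs.1.le hs.2
  · simpa using Real.log_nonpos hr.1.le hr.2

theorem tendsto_rpow_neg (H : GaugeGen h L₀) :
    Tendsto (fun r : ℝ => r ^ (-gaugeOf h L₀ r)) (𝓝[>] 0) atTop := by
  have h1 : Tendsto (fun r : ℝ => -Real.log r) (𝓝[>] 0) atTop :=
    tendsto_neg_atBot_atTop.comp Real.tendsto_log_nhdsGT_zero
  refine (Real.tendsto_exp_atTop.comp (H.tendsto_atTop.comp h1)).congr' ?_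
  filter_upwards [self_mem_nhdsWithin, h1.eventually_ge_atTop L₀] with r hr hrL
  simp only [Function.comp, rpow_neg_gaugeOf hr, max_eq_left hrL]

/-- Near `0` both `-log r` and `ε - φ(r)` are non-negative and non-increasing, hence so is their
product, the opposite of the logarithm of the function. -/
theorem exists_monotoneOn_rpow (H : GaugeGen h L₀) {ε : ℝ} (hε : 0 < ε) :
    ∃ r₀ > 0, MonotoneOn (fun r : ℝ => r ^ (ε - gaugeOf h L₀ r)) (Set.Ioo 0 r₀) := by
  obtain ⟨δ, hδ, hδε⟩ := mem_nhdsGT_iff_exists_Ioo_subset.1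
    (H.tendsto_gaugeOf_zero.eventually (Iio_mem_nhds hε))
  refine ⟨min δ 1, lt_min hδ one_pos, fun r hr s hs hrs => ?_⟩
  have hs1 : gaugeOf h L₀ s < ε := hδε ⟨hs.1, hs.2.trans_le (min_le_left _ _)⟩
  have hrs' := H.monotone_gaugeOf hrs
  have hls : Real.log s ≤ 0 := Real.log_nonpos hs.1.le (hs.2.trans_le (min_le_right _ _)).le
  have hl := Real.log_le_log hr.1 hrs
  simp only [Real.rpow_def_of_pos hr.1, Real.rpow_def_of_pos hs.1]
  refine Real.exp_le_exp.2 ?_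
  nlinarith

theorem gaugePair {h' : ℝ → ℝ} {L₀' : ℝ} (H : GaugeGen h L₀) (H' : GaugeGen h' L₀') :
    GaugePair (gaugeOf h L₀) (gaugeOf h' L₀') where
  monotone_phi := H.monotone_gaugeOf.monotoneOn _
  monotone_psi := H'.monotone_gaugeOf.monotoneOn _
  continuous_phi := H.continuousOn_gaugeOf
  continuous_psi := H'.continuousOn_gaugeOf
  phi_zero := if_pos le_rfl
  psi_zero := if_pos le_rfl
  antitone_phi := ⟨1, one_pos, H.antitoneOn_rpow_neg.mono fun _ hr => ⟨hr.1, hr.2.le⟩⟩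
  antitone_psi := ⟨1, one_pos, H'.antitoneOn_rpow_neg.mono fun _ hr => ⟨hr.1, hr.2.le⟩⟩
  tendsto_phi := H.tendsto_rpow_neg
  monotone_rpow := fun _ hε => H.exists_monotoneOn_rpow hε

end GaugeGen

/-! ### The two families of gauges -/

/-- The function of `|log r|` that defines `gaugePhi C`. -/
def genPhi (C L : ℝ) : ℝ :=
  C * L ^ (-(1 / 2) : ℝ) * (Real.log (Real.log L)) ^ (1 / 2 : ℝ)

/-- The function of `|log r|` that defines `gaugePsi C γ`. -/
def genPsi (C γ L : ℝ) : ℝ :=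
  C * L ^ (-(1 / 2) : ℝ) * (Real.log L) ^ γ

theorem tendsto_loglog_atTop : Tendsto (fun L : ℝ => Real.log (Real.log L)) atTop atTop :=
  Real.tendsto_log_atTop.comp Real.tendsto_log_atTop

theorem tendsto_mul_rpow_neg_half_mul {C : ℝ} (hC : 0 < C) {u : ℝ → ℝ} {s : ℝ} (hs : 0 < s)
    (hu : Tendsto u atTop atTop) :
    Tendsto (fun L : ℝ => L * (C * L ^ (-(1 / 2) : ℝ) * u L ^ s)) atTop atTop := by
  have h1 : Tendsto (fun L : ℝ => C * L ^ (1 / 2 : ℝ) * u L ^ s) atTop atTop :=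
    (((tendsto_rpow_atTop (by norm_num)).const_mul_atTop hC)).atTop_mul_atTop₀
      ((tendsto_rpow_atTop hs).comp hu)
  refine h1.congr' ?_
  filter_upwards [eventually_gt_atTop 0] with L hL
  have : L ^ (1 / 2 : ℝ) = L * L ^ (-(1 / 2) : ℝ) := by
    conv_rhs => rw [← Real.rpow_one_add' hL.le (by norm_num)]
    norm_num
  rw [this]
  ring

theorem monotoneOn_mul_rpow_neg_half_mul {C L₀ : ℝ} (hC : 0 < C) (hL₀ : 0 < L₀) {u : ℝ → ℝ}
    {s : ℝ} (hs : 0 < s) (hu : MonotoneOn u (Set.Ici L₀)) (hu0 : ∀ L ≥ L₀, 0 ≤ u L) :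
    MonotoneOn (fun L : ℝ => L * (C * L ^ (-(1 / 2) : ℝ) * u L ^ s)) (Set.Ici L₀) := by
  have key : ∀ L ≥ L₀, L * (C * L ^ (-(1 / 2) : ℝ) * u L ^ s) = C * L ^ (1 / 2 : ℝ) * u L ^ s := by
    intro L hL
    have : L ^ (1 / 2 : ℝ) = L * L ^ (-(1 / 2) : ℝ) := by
      conv_rhs => rw [← Real.rpow_one_add' (hL₀.trans_le hL).le (by norm_num)]
      norm_num
    rw [this]
    ring
  intro a ha b hb hab
  simp only [key a ha, key b hb]
  have ha0 := hL₀.le.trans ha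
  have hb0 := hL₀.le.trans hb
  exact mul_le_mul (mul_le_mul_of_nonneg_left (Real.rpow_le_rpow ha0 hab (by norm_num)) hC.le)
    (Real.rpow_le_rpow (hu0 a ha) (hu ha hb hab) hs.le) (Real.rpow_nonneg (hu0 a ha) _)
    (mul_nonneg hC.le (Real.rpow_nonneg hb0 _))

theorem exp_one_le_log {L : ℝ} (hL : Real.exp (Real.exp 1) ≤ L) : Real.exp 1 ≤ Real.log L := by
  rwa [Real.le_log_iff_exp_le ((Real.exp_pos _).trans_le hL)]

/-- The threshold ensures `log L ≥ e`, so that `x ↦ log x / x` is already decreasing both at `L` and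
at `log L`. -/
theorem gaugeGen_genPhi {C : ℝ} (hC : 0 < C) : GaugeGen (genPhi C) (Real.exp (Real.exp 1)) := by
  set L₀ := Real.exp (Real.exp 1) with hL₀
  have hL0 : 0 < L₀ := Real.exp_pos _
  have hlog : ∀ L ≥ L₀, Real.exp 1 ≤ Real.log L := fun L hL => exp_one_le_log hL
  have hloglog : ∀ L ≥ L₀, 1 ≤ Real.log (Real.log L) := fun L hL => by
    rw [Real.le_log_iff_exp_le ((Real.exp_pos _).trans_le (hlog L hL))]
    exact hlog L hL
  have hmono : MonotoneOn (fun L : ℝ => Real.log (Real.log L)) (Set.Ici L₀) := by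
    intro a ha b hb hab
    exact Real.log_le_log ((Real.exp_pos _).trans_le (hlog a ha))
      (Real.log_le_log (hL0.trans_le ha) hab)
  have hform : ∀ L ≥ L₀, genPhi C L = C * (Real.log (Real.log L) / L) ^ (1 / 2 : ℝ) := by
    intro L hL
    rw [genPhi, Real.div_rpow (by linarith [hloglog L hL]) (hL0.le.trans hL),
      Real.rpow_neg (hL0.le.trans hL)]
    ring
  refine ⟨?_, ?_, ?_, ?_, ?_, ?_⟩
  · intro L hL
    have h1 := hL0.trans_le hL
    have h2 := (Real.exp_pos 1).trans_le (hlog L hL)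
    refine ContinuousAt.continuousWithinAt ?_
    unfold genPhi
    exact (continuousAt_const.mul (Real.continuousAt_rpow_const _ _ (Or.inl h1.ne'))).mul
      (((Real.continuousAt_log h1.ne').log h2.ne').rpow_const (Or.inr (by norm_num)))
  · intro a ha b hb hab
    rw [hform a ha, hform b hb]
    have ha0 := hL0.trans_le ha
    have hb0 := hL0.trans_le hb
    have ha1 := (Real.exp_pos 1).trans_le (hlog a ha)
    have hb1 := (Real.exp_pos 1).trans_le (hlog b hb)
    -- Both factors are values of `x ↦ log x / x`, at `log L` and at `L`.
    have hsplit : ∀ L ≥ L₀, Real.log (Real.log L) / L =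
        Real.log (Real.log L) / Real.log L * (Real.log L / L) := fun L hL => by
      have := (Real.exp_pos 1).trans_le (hlog L hL)
      field_simp
    refine mul_le_mul_of_nonneg_left (Real.rpow_le_rpow
      (div_nonneg (by linarith [hloglog b hb]) hb0.le) ?_ (by norm_num)) hC.le
    rw [hsplit a ha, hsplit b hb]
    have hE : Real.exp 1 ≤ L₀ := Real.exp_le_exp.2 (by linarith [Real.add_one_le_exp (1 : ℝ)])
    refine mul_le_mul ?_ ?_ (div_nonneg hb1.le hb0.le)
      (div_nonneg (by linarith [hloglog a ha]) ha1.le)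
    · exact Real.log_div_self_antitoneOn (hlog a ha) (hlog b hb) (Real.log_le_log ha0 hab)
    · exact Real.log_div_self_antitoneOn (hE.trans ha) (hE.trans hb) hab
  · intro L hL
    rw [hform L hL]
    exact mul_nonneg hC.le (Real.rpow_nonneg
      (div_nonneg (by linarith [hloglog L hL]) (hL0.le.trans hL)) _)
  · have h1 : Tendsto (fun L : ℝ => Real.log (Real.log L) / L) atTop (𝓝 0) := by
      have h2 : Tendsto (fun L : ℝ => Real.log L / L) atTop (𝓝 0) :=
        Real.isLittleO_log_id_atTop.tendsto_div_nhds_zero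
      refine squeeze_zero' ?_ ?_ h2
      · filter_upwards [eventually_ge_atTop L₀] with L hL
        exact div_nonneg (by linarith [hloglog L hL]) (hL0.le.trans hL)
      · filter_upwards [eventually_ge_atTop L₀] with L hL
        have := (Real.exp_pos 1).trans_le (hlog L hL)
        exact div_le_div_of_nonneg_right (Real.log_le_self this.le) (hL0.le.trans hL)
    have h3 : Tendsto (fun L : ℝ => C * (Real.log (Real.log L) / L) ^ (1 / 2 : ℝ)) atTop
        (𝓝 (C * 0 ^ (1 / 2 : ℝ))) := (h1.rpow_const (Or.inr (by norm_num))).const_mul C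
    rw [Real.zero_rpow (by norm_num), mul_zero] at h3
    refine h3.congr' ?_
    filter_upwards [eventually_ge_atTop L₀] with L hL
    exact (hform L hL).symm
  · exact monotoneOn_mul_rpow_neg_half_mul hC hL0 (by norm_num) hmono
      fun L hL => by linarith [hloglog L hL]
  · exact tendsto_mul_rpow_neg_half_mul hC (by norm_num) tendsto_loglog_atTop

/-- `genPsi` is `C` times the power `γ` of `log L / L ^ (1 / (2γ))`, which decreases from `L =
e^(2γ)` on. -/
theorem gaugeGen_genPsi {C γ : ℝ} (hC : 0 < C) (hγ : 1 / 2 < γ) :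
    GaugeGen (genPsi C γ) (Real.exp (2 * γ)) := by
  set L₀ := Real.exp (2 * γ) with hL₀
  have hL0 : 0 < L₀ := Real.exp_pos _
  have hγ0 : 0 < γ := by linarith
  have hlog : ∀ L ≥ L₀, 1 ≤ Real.log L := fun L hL => by
    have := (Real.le_log_iff_exp_le (hL0.trans_le hL)).2 hL
    linarith
  have ha : 0 < 1 / (2 * γ) := by positivity
  have hform : ∀ L ≥ L₀, genPsi C γ L = C * (Real.log L / L ^ (1 / (2 * γ))) ^ γ := by
    intro L hL
    have hL' := hL0.le.trans hL
    rw [genPsi, Real.div_rpow (by linarith [hlog L hL]) (Real.rpow_nonneg hL' _),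
      ← Real.rpow_mul hL', Real.rpow_neg hL', show 1 / (2 * γ) * γ = 1 / 2 by field_simp]
    ring
  have hnn : ∀ L ≥ L₀, 0 ≤ Real.log L / L ^ (1 / (2 * γ)) := fun L hL =>
    div_nonneg (by linarith [hlog L hL]) (Real.rpow_nonneg (hL0.le.trans hL) _)
  refine ⟨?_, ?_, ?_, ?_, ?_, ?_⟩
  · intro L hL
    have h1 := hL0.trans_le hL
    refine ContinuousAt.continuousWithinAt ?_
    unfold genPsi
    exact (continuousAt_const.mul (Real.continuousAt_rpow_const _ _ (Or.inl h1.ne'))).mul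
      ((Real.continuousAt_log h1.ne').rpow_const (Or.inr hγ0.le))
  · intro a ha' b hb' hab
    rw [hform a ha', hform b hb']
    refine mul_le_mul_of_nonneg_left (Real.rpow_le_rpow (hnn b hb') ?_ hγ0.le) hC.le
    have hE : Real.exp (1 / (2 * γ))⁻¹ = L₀ := by rw [one_div, inv_inv]
    exact Real.log_div_self_rpow_antitoneOn ha (Set.mem_Ici.2 (hE.le.trans ha'))
      (Set.mem_Ici.2 (hE.le.trans hb')) hab
  · intro L hL
    rw [hform L hL]
    exact mul_nonneg hC.le (Real.rpow_nonneg (hnn L hL) _)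
  · have h1 : Tendsto (fun L : ℝ => Real.log L / L ^ (1 / (2 * γ))) atTop (𝓝 0) :=
      (isLittleO_log_rpow_atTop ha).tendsto_div_nhds_zero
    have h3 : Tendsto (fun L : ℝ => C * (Real.log L / L ^ (1 / (2 * γ))) ^ γ) atTop
        (𝓝 (C * 0 ^ γ)) := (h1.rpow_const (Or.inr hγ0.le)).const_mul C
    rw [Real.zero_rpow hγ0.ne', mul_zero] at h3
    refine h3.congr' ?_
    filter_upwards [eventually_ge_atTop L₀] with L hL
    exact (hform L hL).symm
  · refine monotoneOn_mul_rpow_neg_half_mul hC hL0 hγ0 ?_ fun L hL => by linarith [hlog L hL]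
    exact fun a ha b _ hab => Real.log_le_log (hL0.trans_le ha) hab
  · exact tendsto_mul_rpow_neg_half_mul hC hγ0 Real.tendsto_log_atTop

theorem gaugeOf_eventuallyEq (h : ℝ → ℝ) (L₀ : ℝ) :
    ∀ᶠ r in 𝓝[>] (0 : ℝ), gaugeOf h L₀ r = h |Real.log r| := by
  have h1 : Tendsto (fun r : ℝ => -Real.log r) (𝓝[>] 0) atTop :=
    tendsto_neg_atBot_atTop.comp Real.tendsto_log_nhdsGT_zero
  filter_upwards [self_mem_nhdsWithin, h1.eventually_ge_atTop (max L₀ 0)] with r hr hrL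
  rw [gaugeOf_of_pos h L₀ hr, max_eq_left ((le_max_left _ _).trans hrL), ← abs_neg,
    abs_of_nonneg ((le_max_right _ _).trans hrL)]

/-! ### Values of the gauges at the scales `c⁻ʲ` -/

/-- The exponent `j φ(c⁻ʲ)`. -/
def gaugeLevel (c : ℕ) (φ : ℝ → ℝ) (j : ℕ) : ℝ := j * φ (((c : ℝ) ^ j)⁻¹)

section GaugeLevel

variable {c : ℕ} {h : ℝ → ℝ} {L₀ : ℝ}

theorem gaugeLevel_gaugeOf (hc : 2 ≤ c) (j : ℕ) : gaugeLevel c (gaugeOf h L₀) j =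
    (Real.log c)⁻¹ * (j * Real.log c * h (max (j * Real.log c) L₀)) := by
  have hlogc : 0 < Real.log c := Real.log_pos (by exact_mod_cast (by omega : 1 < c))
  rw [gaugeLevel, gaugeOf_of_pos h L₀ (by positivity), Real.log_inv, Real.log_pow, neg_neg]
  field_simp

theorem GaugeGen.monotone_gaugeLevel (H : GaugeGen h L₀) (hc : 2 ≤ c) :
    Monotone (gaugeLevel c (gaugeOf h L₀)) := by
  have hlogc : 0 < Real.log c := Real.log_pos (by exact_mod_cast (by omega : 1 < c))
  intro i j hij
  rw [gaugeLevel_gaugeOf hc, gaugeLevel_gaugeOf hc]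
  refine mul_le_mul_of_nonneg_left (H.monotoneOn_mul_max ?_ ?_ ?_) (inv_pos.2 hlogc).le
  · exact mul_nonneg (Nat.cast_nonneg _) hlogc.le
  · exact mul_nonneg (Nat.cast_nonneg _) hlogc.le
  · exact mul_le_mul_of_nonneg_right (Nat.cast_le.2 hij) hlogc.le

theorem tendsto_natCast_mul_log (hc : 2 ≤ c) :
    Tendsto (fun j : ℕ => (j : ℝ) * Real.log c) atTop atTop :=
  tendsto_natCast_atTop_atTop.atTop_mul_const
    (Real.log_pos (by exact_mod_cast (by omega : 1 < c)))

theorem eventually_gaugeLevel_eq (hc : 2 ≤ c) : ∀ᶠ j : ℕ in atTop,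
    gaugeLevel c (gaugeOf h L₀) j = (Real.log c)⁻¹ * (j * Real.log c * h (j * Real.log c)) := by
  filter_upwards [(tendsto_natCast_mul_log hc).eventually_ge_atTop L₀] with j hj
  rw [gaugeLevel_gaugeOf hc, max_eq_left hj]

theorem GaugeGen.tendsto_gaugeLevel (H : GaugeGen h L₀) (hc : 2 ≤ c) :
    Tendsto (gaugeLevel c (gaugeOf h L₀)) atTop atTop := by
  have hlogc : 0 < Real.log c := Real.log_pos (by exact_mod_cast (by omega : 1 < c))
  refine ((H.tendsto_atTop.comp (tendsto_natCast_mul_log hc)).const_mul_atTop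
    (inv_pos.2 hlogc)).congr' ?_
  filter_upwards [eventually_gaugeLevel_eq (h := h) (L₀ := L₀) hc] with j hj
  exact hj.symm

/-- Since `log c ≥ 1/2`, eventually `j log c ≥ √j`. Two logarithms turn the square root into a loss
of `log 2`, absorbed by half of `log log j`. -/
theorem eventually_loglog_mul_log_ge (hc : 2 ≤ c) : ∀ᶠ j : ℕ in atTop,
    Real.log (Real.log j) / 2 ≤ Real.log (Real.log (j * Real.log c)) := by
  have hlogc : 1 / 2 ≤ Real.log c :=
    (by linarith [Real.log_two_gt_d9] : (1 : ℝ) / 2 ≤ Real.log 2).trans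
      (Real.log_le_log two_pos (by exact_mod_cast hc))
  have ht := tendsto_loglog_atTop.comp (tendsto_natCast_atTop_atTop (R := ℝ))
  filter_upwards [ht.eventually_ge_atTop (2 * Real.log 2), eventually_ge_atTop 4,
    (Real.tendsto_log_atTop.comp (tendsto_natCast_atTop_atTop (R := ℝ))).eventually_gt_atTop 0]
    with j hj hj4 hlj
  simp only [Function.comp] at hj hlj
  have hjR : (4 : ℝ) ≤ j := by exact_mod_cast hj4
  have h1 : √(j : ℝ) ≤ j * Real.log c := by
    have h2 : (2 : ℝ) ≤ √(j : ℝ) := by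
      rw [Real.le_sqrt (by norm_num) (by linarith)]; linarith
    have h3 := Real.mul_self_sqrt (by linarith : (0 : ℝ) ≤ j)
    nlinarith
  have h4 : Real.log j / 2 ≤ Real.log (j * Real.log c) := by
    rw [← Real.log_sqrt (by linarith)]
    exact Real.log_le_log (Real.sqrt_pos.2 (by linarith)) h1
  have h5 := Real.log_le_log (by linarith) h4
  rw [Real.log_div hlj.ne' (by norm_num)] at h5
  linarith

/-- Squaring both sides, what is needed is `C² ≥ 2 B² log c`: the `2` comes from the comparison of
iterated logarithms and `log c` from the scale `|log c⁻ʲ| = j log c`. The hypothesis on `C` is a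
convenient sufficient form. -/
theorem eventually_lilBound_le_genPhi (hc : 2 ≤ c) {B C : ℝ} (hB : 0 ≤ B)
    (hC : 2 * B * (1 + Real.log c) ≤ C) :
    ∀ᶠ j : ℕ in atTop, B * lilBound j ≤
      (Real.log c)⁻¹ * (j * Real.log c * genPhi C (j * Real.log c)) := by
  have hlogc : 0 < Real.log c := Real.log_pos (by exact_mod_cast (by omega : 1 < c))
  have ht := tendsto_loglog_atTop.comp (tendsto_natCast_atTop_atTop (R := ℝ))
  filter_upwards [eventually_loglog_mul_log_ge hc, ht.eventually_ge_atTop 0,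
    eventually_gt_atTop 0] with j hj hll hj0
  simp only [Function.comp] at hll
  have hjR : (0 : ℝ) < j := by exact_mod_cast hj0
  set D := Real.log (Real.log (j * Real.log c)) with hD
  have hD0 : 0 ≤ D := by linarith
  have hx : 0 < (j : ℝ) * Real.log c := by positivity
  have h1 : (Real.log c)⁻¹ * (j * Real.log c * genPhi C (j * Real.log c)) =
      C * (Real.log c)⁻¹ * √(j * Real.log c * D) := by
    rw [genPhi, ← hD, Real.sqrt_mul hx.le, Real.sqrt_eq_rpow, Real.sqrt_eq_rpow]
    have : (j * Real.log c) ^ (1 / 2 : ℝ) =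
        j * Real.log c * (j * Real.log c) ^ (-(1 / 2) : ℝ) := by
      conv_rhs => rw [← Real.rpow_one_add' hx.le (by norm_num)]
      norm_num
    rw [this]
    ring
  rw [h1, lilBound]
  have hC0 : 0 ≤ C := le_trans (by positivity) hC
  refine abs_le_of_sq_le_sq' ?_ (by positivity) |>.2
  rw [mul_pow, mul_pow, Real.sq_sqrt (by positivity), Real.sq_sqrt (by positivity), mul_pow]
  have hC2 : 2 * B ^ 2 * Real.log c ≤ C ^ 2 := by
    have h2 : (2 * B * (1 + Real.log c)) ^ 2 ≤ C ^ 2 := by gcongr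
    nlinarith [mul_nonneg (sq_nonneg B) hlogc.le, mul_nonneg (sq_nonneg B) (sq_nonneg (Real.log c)), sq_nonneg B]
  calc B ^ 2 * (j * Real.log (Real.log j)) ≤ B ^ 2 * (j * (2 * D)) := by gcongr; linarith
    _ = 2 * B ^ 2 * Real.log c * ((Real.log c)⁻¹ ^ 2 * (j * Real.log c * D)) := by
        field_simp
    _ ≤ C ^ 2 * ((Real.log c)⁻¹ ^ 2 * (j * Real.log c * D)) := by gcongr
    _ = _ := by ring

/-- Lets the estimate at the scale of `φ` serve for `ψ` with the same constant. -/
theorem eventually_genPhi_le_genPsi {C γ : ℝ} (hC : 0 ≤ C) (hγ : 1 / 2 < γ) :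
    ∀ᶠ L : ℝ in atTop, genPhi C L ≤ genPsi C γ L := by
  filter_upwards [Real.tendsto_log_atTop.eventually_ge_atTop 1, eventually_gt_atTop 0] with L hL hL0
  unfold genPhi genPsi
  refine mul_le_mul_of_nonneg_left ?_ (mul_nonneg hC (Real.rpow_nonneg hL0.le _))
  calc Real.log (Real.log L) ^ (1 / 2 : ℝ) ≤ Real.log L ^ (1 / 2 : ℝ) :=
        Real.rpow_le_rpow (Real.log_nonneg hL) (Real.log_le_self (by linarith)) (by norm_num)
    _ ≤ _ := Real.rpow_le_rpow_of_exponent_le hL hγ.le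

theorem eventually_lilBound_le_gaugePhi (hc : 2 ≤ c) {B C : ℝ} (hB : 0 ≤ B)
    (hC : 2 * B * (1 + Real.log c) ≤ C) (L₀ : ℝ) :
    ∀ᶠ j : ℕ in atTop, B * lilBound j ≤ gaugeLevel c (gaugeOf (genPhi C) L₀) j := by
  filter_upwards [eventually_lilBound_le_genPhi hc hB hC,
    eventually_gaugeLevel_eq (h := genPhi C) (L₀ := L₀) hc] with j h1 h2
  rwa [h2]

theorem eventually_lilBound_le_gaugePsi (hc : 2 ≤ c) {B C γ : ℝ} (hB : 0 ≤ B)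
    (hC : 2 * B * (1 + Real.log c) ≤ C) (hγ : 1 / 2 < γ) (L₀ : ℝ) :
    ∀ᶠ j : ℕ in atTop, B * lilBound j ≤ gaugeLevel c (gaugeOf (genPsi C γ) L₀) j := by
  have hlogc : 0 < Real.log c := Real.log_pos (by exact_mod_cast (by omega : 1 < c))
  have hC0 : 0 ≤ C := le_trans (by positivity) hC
  filter_upwards [eventually_lilBound_le_genPhi hc hB hC,
    eventually_gaugeLevel_eq (h := genPsi C γ) (L₀ := L₀) hc,
    (tendsto_natCast_mul_log hc).eventually (eventually_genPhi_le_genPsi hC0 hγ)] with j h1 h2 h3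
  rw [h2]
  refine h1.trans ?_
  gcongr

end GaugeLevel

/-! ### Mass of the boxes whose digit counts are balanced -/

section Balanced

variable {d c : ℕ} {p π : Fin d → Fin c → ℝ}

/-- The set of points whose boxes of generations at least `n` have balanced neighbours. -/
def balancedFrom (π : Fin d → Fin c → ℝ) (n : ℕ) : Set (Fin d → ℝ) :=
  {y | ∀ j ≥ n, ∀ i, BalancedWord (π i) j (boxIndex c j y i)}

theorem ae_eventually_balanced (hc : 2 ≤ c) (hπ : ∀ i, IsPosProb (π i)) :
    ∀ᵐ y ∂productMultinomial π, ∃ n, y ∈ balancedFrom π n := by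
  filter_upwards [ae_productMultinomial_of_forall hπ
    (P := fun i t => ∀ᶠ j : ℕ in atTop, BalancedWord (π i) j ⌊(c : ℝ) ^ j * t⌋₊)
    fun i => ae_eventually_balancedWord (hπ i) hc] with y hy
  exact eventually_atTop.1 (eventually_all.2 hy)

theorem measurableSet_balancedFrom (π : Fin d → Fin c → ℝ) (n : ℕ) :
    MeasurableSet (balancedFrom π n) := by
  have : balancedFrom π n = ⋂ j, ⋂ (_ : n ≤ j),
      boxIndex c j ⁻¹' {κ | ∀ i, BalancedWord (π i) j (κ i)} := by
    ext y; simp [balancedFrom]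
  rw [this]
  exact MeasurableSet.iInter fun j => MeasurableSet.iInter fun _ =>
    measurable_boxIndex c j (Set.to_countable _).measurableSet

theorem balancedFrom_mono (π : Fin d → Fin c → ℝ) : Monotone (balancedFrom π) :=
  fun _ _ hmn _ hy j hj => hy j (hmn.trans hj)

theorem eventually_half_le_balancedFrom (hc : 2 ≤ c) (hπ : ∀ i, IsPosProb (π i)) :
    ∀ᶠ n in atTop, 1 / 2 ≤ productMultinomial π (balancedFrom π n) := by
  have := isProbabilityMeasure_productMultinomial hπ
  have h1 : productMultinomial π (⋃ n, balancedFrom π n) = 1 := by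
    rw [← measure_univ (μ := productMultinomial π)]
    refine measure_congr (eventuallyEq_univ.2 ?_)
    filter_upwards [ae_eventually_balanced hc hπ] with y hy
    exact Set.mem_iUnion.2 hy
  have h2 := tendsto_measure_iUnion_atTop (μ := productMultinomial π) (balancedFrom_mono π)
  rw [h1] at h2
  refine (h2.eventually (lt_mem_nhds (?_ : (1 / 2 : ℝ≥0∞) < 1))).mono fun n hn => hn.le
  rw [one_div]
  exact ENNReal.one_half_lt_one

/-- Excluding the extreme words confines `y` to the open interval; in particular negative `y`, whose
natural floor is `0`, are ruled out. -/
theorem BalancedWord.mem_Ioo (hc : 0 < c) {π : Fin c → ℝ} {j : ℕ} {y : ℝ}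
    (h : BalancedWord π j ⌊(c : ℝ) ^ j * y⌋₊) : y ∈ Set.Ioo (0 : ℝ) 1 := by
  have hcj : (0 : ℝ) < (c : ℝ) ^ j := by positivity
  obtain ⟨h1, h2, -⟩ := h
  have h3 : (1 : ℝ) ≤ (c : ℝ) ^ j * y := by
    simpa using (Nat.le_floor_iff' one_ne_zero).1 h1
  have h4 : (c : ℝ) ^ j * y < c ^ j := by
    have h5 := Nat.lt_floor_add_one ((c : ℝ) ^ j * y)
    have h6 : ((⌊(c : ℝ) ^ j * y⌋₊ : ℕ) : ℝ) + 2 ≤ (c : ℝ) ^ j := by exact_mod_cast h2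
    linarith
  constructor
  · by_contra! hy
    nlinarith
  · by_contra! hy
    nlinarith

theorem mem_Ioo_of_mem_balancedFrom (hc : 0 < c) {n : ℕ} {y : Fin d → ℝ}
    (hy : y ∈ balancedFrom π n) (i : Fin d) : y i ∈ Set.Ioo (0 : ℝ) 1 :=
  (hy n le_rfl i).mem_Ioo hc

/-- The sum of the absolute values of the logarithms in base `c` of the components. -/
def logSize (p : Fin d → Fin c → ℝ) : ℝ := ∑ i, ∑ t, |Real.logb c (p i t)|

theorem logSize_nonneg (p : Fin d → Fin c → ℝ) : 0 ≤ logSize p :=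
  Finset.sum_nonneg fun _ _ => Finset.sum_nonneg fun _ _ => abs_nonneg _

/-- The logarithm of the mass is linear in the digit counts. For `π` the tilted vectors, the weights
`p` give the exponent `α`, and the weights `π` themselves give the entropy `β`. -/
theorem abs_logb_prod_wordWeight_sub_le (hp : ∀ i, IsPosProb (p i)) {j : ℕ} {k : Fin d → ℕ}
    {u : ℝ} (h : ∀ i t, |(digitCount c (t : Fin c) j (k i) : ℝ) - j * π i t| ≤ u) :
    |Real.logb c (∏ i, wordWeight (p i) j (k i)) -
      -(j * ∑ i, -∑ t, π i t * Real.logb c (p i t))| ≤ logSize p * u := by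
  have h1 : Real.logb c (∏ i, wordWeight (p i) j (k i)) =
      ∑ i, ∑ t : Fin c, (digitCount c t j (k i) : ℝ) * Real.logb c (p i t) := by
    rw [Real.logb_prod _ _ fun i _ => ((hp i).wordWeight_pos _ _).ne']
    refine Finset.sum_congr rfl fun i _ => ?_
    rw [wordWeight, Real.logb_prod _ _ fun t _ => (pow_pos ((hp i).pos t) _).ne']
    exact Finset.sum_congr rfl fun t _ => Real.logb_pow _ _ _
  have h2 : Real.logb c (∏ i, wordWeight (p i) j (k i)) -
      -(j * ∑ i, -∑ t, π i t * Real.logb c (p i t)) =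
      ∑ i, ∑ t : Fin c, ((digitCount c t j (k i) : ℝ) - j * π i t) * Real.logb c (p i t) := by
    rw [h1]
    simp only [Finset.sum_neg_distrib, mul_neg, neg_neg, sub_mul, Finset.sum_sub_distrib,
      Finset.mul_sum, mul_assoc]
  rw [h2, logSize, Finset.sum_mul]
  refine (Finset.abs_sum_le_sum_abs _ _).trans (Finset.sum_le_sum fun i _ => ?_)
  rw [Finset.sum_mul]
  refine (Finset.abs_sum_le_sum_abs _ _).trans (Finset.sum_le_sum fun t _ => ?_)
  rw [abs_mul, mul_comm]
  exact mul_le_mul_of_nonneg_left (h i t) (abs_nonneg _)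

theorem prod_wordWeight_mem_Icc (hc : 2 ≤ c) (hp : ∀ i, IsPosProb (p i)) {j : ℕ} {k : Fin d → ℕ}
    {u v : ℝ} (h : ∀ i t, |(digitCount c (t : Fin c) j (k i) : ℝ) - j * π i t| ≤ u)
    (hv : logSize p * u ≤ v) :
    (c : ℝ) ^ (-(j * ∑ i, -∑ t, π i t * Real.logb c (p i t)) - v) ≤
        ∏ i, wordWeight (p i) j (k i) ∧
      ∏ i, wordWeight (p i) j (k i) ≤
        (c : ℝ) ^ (-(j * ∑ i, -∑ t, π i t * Real.logb c (p i t)) + v) := by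
  have hc1 : (1 : ℝ) < c := by exact_mod_cast (by omega : 1 < c)
  have hpos : 0 < ∏ i, wordWeight (p i) j (k i) :=
    Finset.prod_pos fun i _ => (hp i).wordWeight_pos _ _
  have h1 := abs_le.1 (abs_logb_prod_wordWeight_sub_le hp h)
  rw [← Real.le_logb_iff_rpow_le hc1 hpos, ← Real.logb_le_iff_le_rpow hc1 hpos]
  constructor <;> linarith [h1.1, h1.2]

theorem diam_cBox_rpow_sub (hd : 1 ≤ d) (hc : 0 < c) (φ : ℝ → ℝ) (s : ℝ) (j : ℕ)
    (k : Fin d → ℕ) : Metric.diam (cBox c j k) ^ (s - φ (Metric.diam (cBox c j k))) =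
      (c : ℝ) ^ (-(j * s) + gaugeLevel c φ j) := by
  have hcR : (0 : ℝ) ≤ c := by positivity
  rw [diam_cBox hd hc, gaugeLevel, ← Real.rpow_natCast, ← Real.rpow_neg hcR, ← Real.rpow_mul hcR]
  congr 1
  ring

theorem diam_cBox_rpow_add (hd : 1 ≤ d) (hc : 0 < c) (φ : ℝ → ℝ) (s : ℝ) (j : ℕ)
    (k : Fin d → ℕ) : Metric.diam (cBox c j k) ^ (s + φ (Metric.diam (cBox c j k))) =
      (c : ℝ) ^ (-(j * s) - gaugeLevel c φ j) := by
  have hcR : (0 : ℝ) ≤ c := by positivity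
  rw [diam_cBox hd hc, gaugeLevel, ← Real.rpow_natCast, ← Real.rpow_neg hcR, ← Real.rpow_mul hcR]
  congr 1
  ring

theorem digitCount_of_isNeighbor {j n : ℕ} {y : Fin d → ℝ} {k : Fin d → ℕ}
    (hy : y ∈ balancedFrom π n) (hj : n ≤ j) (hk : IsNeighbor c j y k) (i : Fin d) (t : Fin c) :
    |(digitCount c t j (k i) : ℝ) - j * π i t| ≤ 7 * lilBound j :=
  (hy j hj i).2.2 (k i) (hk.2 i) t

theorem localScaling_of_gauge (hd : 1 ≤ d) (hc : 2 ≤ c) (hp : ∀ i, IsPosProb (p i))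
    (hπ : ∀ i, IsPosProb (π i)) {ψ : ℝ → ℝ}
    (hψ : ∀ᶠ j : ℕ in atTop, logSize p * (7 * lilBound j) ≤ gaugeLevel c ψ j) :
    LocalScaling c (productMultinomial p) (productMultinomial π)
      (∑ i, -∑ t, π i t * Real.logb c (p i t)) ψ := by
  have hc0 : 0 < c := by omega
  obtain ⟨J, hJ⟩ := eventually_atTop.1 hψ
  filter_upwards [ae_eventually_balanced hc hπ] with y hy
  obtain ⟨n, hn⟩ := hy
  refine ⟨max n J, fun j hj k hk => ?_⟩
  have hW := prod_wordWeight_mem_Icc hc hp (π := π) (j := j) (k := k)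
    (digitCount_of_isNeighbor hn ((le_max_left _ _).trans hj) hk) (hJ j ((le_max_right _ _).trans hj))
  rw [MassControl, productMultinomial_cBox hp hc j k hk.1, inv_one, one_mul, one_mul,
    diam_cBox_rpow_sub hd hc0, diam_cBox_rpow_add hd hc0]
  exact ⟨ENNReal.ofReal_le_ofReal hW.1, ENNReal.ofReal_le_ofReal hW.2⟩

theorem productMultinomial_cBox_le (hc : 2 ≤ c) (hπ : ∀ i, IsPosProb (π i)) {φ : ℝ → ℝ} {n j : ℕ}
    (hφ : logSize π * (7 * lilBound j) ≤ gaugeLevel c φ j) {y : Fin d → ℝ}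
    (hy : y ∈ balancedFrom π n) (hj : n ≤ j) {k : Fin d → ℕ} (hk : IsNeighbor c j y k) :
    productMultinomial π (cBox c j k) ≤
      ENNReal.ofReal ((c : ℝ) ^ (-(j * ∑ i, vecEntropy (π i)) + gaugeLevel c φ j)) := by
  rw [productMultinomial_cBox hπ hc j k hk.1]
  exact ENNReal.ofReal_le_ofReal (prod_wordWeight_mem_Icc hc hπ (π := π)
    (digitCount_of_isNeighbor hy hj hk) hφ).2

theorem localMassBound_of_gauge (hd : 1 ≤ d) (hc : 2 ≤ c) (hπ : ∀ i, IsPosProb (π i)) {φ : ℝ → ℝ}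
    (hφ : ∀ᶠ j : ℕ in atTop, logSize π * (7 * lilBound j) ≤ gaugeLevel c φ j) :
    LocalMassBound c (productMultinomial π) (∑ i, vecEntropy (π i)) φ := by
  have hc0 : 0 < c := by omega
  obtain ⟨J, hJ⟩ := eventually_atTop.1 hφ
  filter_upwards [ae_eventually_balanced hc hπ] with y hy
  obtain ⟨n, hn⟩ := hy
  refine ⟨max n J, fun j hj k hk => ?_⟩
  rw [MassBound, one_mul, diam_cBox_rpow_sub hd hc0]
  exact productMultinomial_cBox_le hc hπ (hJ j ((le_max_right _ _).trans hj)) hn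
    ((le_max_left _ _).trans hj) hk

/-! ### Copies of the measure -/

/-- The copy of the product of multinomial measures carried by a `c`-adic box. -/
def boxCopy (π : Fin d → Fin c → ℝ) (j : ℕ) (k : Fin d → ℕ) : Measure (Fin d → ℝ) :=
  (productMultinomial π).map (boxEmbed c j k)

theorem map_boxMap_boxCopy (hc : 0 < c) (π : Fin d → Fin c → ℝ) (j : ℕ) (k : Fin d → ℕ) :
    (boxCopy π j k).map (boxMap c j k) = productMultinomial π := by
  rw [boxCopy, Measure.map_map (measurable_boxMap c j k) (measurable_boxEmbed c j k)]
  have : boxMap c j k ∘ boxEmbed c j k = id := funext fun y => boxMap_boxEmbed hc j k y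
  rw [this, Measure.map_id]

theorem selfSimilarCopies_boxCopy (hd : 1 ≤ d) (hc : 2 ≤ c) (hπ : ∀ i, IsPosProb (π i))
    {φ : ℝ → ℝ}
    (hφ : ∀ᶠ j : ℕ in atTop, logSize π * (7 * lilBound j) ≤ gaugeLevel c φ j) :
    SelfSimilarCopies c (productMultinomial π) (∑ i, vecEntropy (π i)) φ (boxCopy π) := by
  intro j k hk
  rw [map_boxMap_boxCopy (by omega), productMultinomial_restrict hπ hc j k hk]
  refine ⟨Measure.absolutelyContinuous_smul ?_, Measure.smul_absolutelyContinuous,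
    localMassBound_of_gauge hd hc hπ hφ⟩
  exact (ENNReal.ofReal_pos.2 (Finset.prod_pos fun i _ => (hπ i).wordWeight_pos _ _)).ne'

theorem boxEmbed_preimage_cBox (hc : 0 < c) (a b : ℕ) (l k : Fin d → ℕ) :
    boxEmbed c a l ⁻¹' cBox c (a + b) (fun i => l i * c ^ b + k i) = cBox c b k := by
  have ha : (0 : ℝ) < (c : ℝ) ^ a := by positivity
  have hb : (0 : ℝ) < (c : ℝ) ^ b := by positivity
  ext y
  refine forall_congr' fun i => and_congr ?_ ?_
  · simp only [boxEmbed]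
    push_cast
    rw [pow_add, div_le_div_iff₀ (by positivity) ha, div_le_iff₀ hb]
    constructor <;> intro h
    · have : (c : ℝ) ^ a * (l i * c ^ b + k i) ≤ (c : ℝ) ^ a * ((l i + y i) * c ^ b) := by linarith
      have := le_of_mul_le_mul_left this ha
      linarith
    · nlinarith
  · simp only [boxEmbed]
    push_cast
    rw [pow_add, div_lt_div_iff₀ ha (by positivity), lt_div_iff₀ hb]
    constructor <;> intro h
    · have : (c : ℝ) ^ a * ((l i + y i) * c ^ b) < (c : ℝ) ^ a * (l i * c ^ b + k i + 1) := by
        linarith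
      have := lt_of_mul_lt_mul_left this ha.le
      linarith
    · nlinarith

/-- The neighbours of a balanced point of a box lie in the box. -/
theorem exists_relative_neighbor {n b : ℕ} (hb : n ≤ b) {l : Fin d → ℕ}
    {y : Fin d → ℝ} (hy : y ∈ balancedFrom π n) {k : Fin d → ℕ}
    (hk : ∀ i, |(k i : ℤ) - (l i * c ^ b + boxIndex c b y i : ℕ)| ≤ 1) :
    ∃ k' : Fin d → ℕ, IsNeighbor c b y k' ∧ k = fun i => l i * c ^ b + k' i := by
  have key : ∀ i, k i - l i * c ^ b < c ^ b ∧
      |((k i - l i * c ^ b : ℕ) : ℤ) - (boxIndex c b y i : ℕ)| ≤ 1 ∧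
      k i = l i * c ^ b + (k i - l i * c ^ b) := fun i => by
    obtain ⟨h1, h2, -⟩ := hy b hb i
    have h3 := hk i
    generalize l i * c ^ b = M at *
    generalize c ^ b = B at *
    rw [abs_le] at *
    omega
  exact ⟨fun i => k i - l i * c ^ b, ⟨fun i => (key i).1, fun i => (key i).2.1⟩,
    funext fun i => (key i).2.2⟩

/-- A single `n`, for which `balancedFrom π n` has at least half of the mass, belongs to
`goodLevels` for every box; it is below `j φ(c⁻ʲ)` for large `j` because this tends to infinity. The
copies have mass one, whence the last clause. -/
theorem uniformGrowthControl_boxCopy (hd : 1 ≤ d) (hc : 2 ≤ c) (hπ : ∀ i, IsPosProb (π i))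
    {φ : ℝ → ℝ} (hφ0 : ∀ r, 0 ≤ φ r)
    (hφ : ∀ᶠ j : ℕ in atTop, logSize π * (7 * lilBound j) ≤ gaugeLevel c φ j)
    (hφt : Tendsto (gaugeLevel c φ) atTop atTop) :
    UniformGrowthControl c (∑ i, vecEntropy (π i)) φ (boxCopy π) := by
  have hc0 : 0 < c := by omega
  have hc1 : (1 : ℝ) < c := by exact_mod_cast (by omega : 1 < c)
  have hP := isProbabilityMeasure_productMultinomial hπ
  obtain ⟨n, hn1, hnJ, hnhalf⟩ := ((eventually_ge_atTop 1).and
    ((eventually_forall_ge_atTop.2 hφ).and (eventually_half_le_balancedFrom hc hπ))).exists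
  obtain ⟨J, hJ⟩ := eventually_atTop.1 (hφt.eventually_ge_atTop (n : ℝ))
  have hlog : ∀ (j : ℕ) (k : Fin d → ℕ), Real.logb c ((Metric.diam (cBox c j k))⁻¹) = j := by
    intro j k
    rw [diam_cBox hd hc0, inv_inv, Real.logb_pow, Real.logb_self_eq_one hc1, mul_one]
  refine ⟨J, fun a ha l hl => ?_⟩
  have huniv : boxCopy π a l Set.univ = 1 := by
    rw [boxCopy, Measure.map_apply (measurable_boxEmbed c a l) MeasurableSet.univ]
    exact measure_univ
  have hmem : n ∈ goodLevels c (∑ i, vecEntropy (π i)) φ (boxCopy π a l) (cBox c a l) := by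
    refine ⟨hn1, ?_⟩
    rw [huniv]
    refine hnhalf.trans (le_trans (measure_mono fun y hy => ?_)
      (Measure.le_map_apply (measurable_boxEmbed c a l).aemeasurable _))
    have hy01 := mem_Ioo_of_mem_balancedFrom hc0 hy
    refine ⟨(mem_cBox_iff hc0).2 ⟨fun i => ?_, funext fun i => ?_⟩, fun j hj k hk => ?_⟩
    · have := (hy01 i).1.le
      simp only [boxEmbed]
      positivity
    · have := boxIndex_boxEmbed hc0 a 0 l (fun i => (hy01 i).1.le) i
      have hz : boxIndex c 0 y i = 0 := by
        simpa using boxIndex_lt hc0 0 (fun i => ⟨(hy01 i).1.le, (hy01 i).2⟩) i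
      rwa [hz, pow_zero, mul_one, add_zero, add_zero] at this
    · rw [hlog] at hj
      have hj' : n + a ≤ j := by exact_mod_cast hj
      obtain ⟨b, rfl⟩ : ∃ b, j = a + b := ⟨j - a, by omega⟩
      have hb : n ≤ b := by omega
      have hk2 : ∀ i, |(k i : ℤ) - (l i * c ^ b + boxIndex c b y i : ℕ)| ≤ 1 := fun i => by
        rw [← boxIndex_boxEmbed hc0 a b l (fun i => (hy01 i).1.le) i]
        exact hk.2 i
      -- The neighbours stay inside the box, where the copy has the relative masses of the original
      -- measure.
      obtain ⟨k', hk', rfl⟩ := exists_relative_neighbor hb hy hk2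
      have hratio : Metric.diam (cBox c (a + b) (fun i => l i * c ^ b + k' i)) /
          Metric.diam (cBox c a l) = Metric.diam (cBox c b k') := by
        rw [diam_cBox hd hc0, diam_cBox hd hc0, diam_cBox hd hc0]
        have : (c : ℝ) ≠ 0 := by positivity
        field_simp
        ring
      rw [hratio, boxCopy, Measure.map_apply (measurable_boxEmbed c a l) (measurableSet_cBox _ _ _),
        boxEmbed_preimage_cBox hc0, diam_cBox_rpow_sub hd hc0]
      exact productMultinomial_cBox_le hc hπ (hnJ b hb) hy hb hk'
  refine ⟨⟨n, hmem⟩, ?_, ?_⟩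
  · rw [hlog, diam_cBox hd hc0]
    exact le_trans (Nat.cast_le.2 (Nat.sInf_le hmem)) (hJ a ha)
  · rw [huniv, ← ENNReal.ofReal_one]
    refine ENNReal.ofReal_le_ofReal (Real.rpow_le_one Metric.diam_nonneg ?_ (hφ0 _))
    rw [diam_cBox hd hc0]
    exact inv_le_one_of_one_le₀ (one_le_pow₀ hc1.le)

end Balanced

/-! ### The tree of `c`-adic boxes -/

/-- The index `(j, k)` of a `c`-adic box. -/
abbrev Node (d : ℕ) := ℕ × (Fin d → ℕ)

section Tree

variable {d c : ℕ}

/-- The box of index `L` is contained in `[0,1)^d`. -/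
def IsValid (c : ℕ) (L : Node d) : Prop := ∀ i, L.2 i < c ^ L.1

/-- The box of index `L` contains the box of index `Q`. -/
def IsAncestor (c : ℕ) (L Q : Node d) : Prop :=
  L.1 ≤ Q.1 ∧ ∀ i, Q.2 i / c ^ (Q.1 - L.1) = L.2 i

theorem IsAncestor.refl (L : Node d) : IsAncestor c L L := ⟨le_rfl, fun i => by simp⟩

theorem IsAncestor.trans {L M Q : Node d} (h₁ : IsAncestor c L M) (h₂ : IsAncestor c M Q) :
    IsAncestor c L Q := by
  refine ⟨h₁.1.trans h₂.1, fun i => ?_⟩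
  rw [← h₁.2 i, ← h₂.2 i, Nat.div_div_eq_div_mul, ← pow_add]
  congr 2
  have := h₁.1
  have := h₂.1
  omega

theorem IsAncestor.of_common {L M Q : Node d} (h₁ : IsAncestor c L Q) (h₂ : IsAncestor c M Q)
    (hLM : L.1 ≤ M.1) : IsAncestor c L M := by
  refine ⟨hLM, fun i => ?_⟩
  rw [← h₁.2 i, ← h₂.2 i, Nat.div_div_eq_div_mul, ← pow_add]
  congr 2
  have := h₂.1
  omega

theorem IsAncestor.isValid {L Q : Node d} (hc : 0 < c) (h : IsAncestor c L Q)
    (hQ : IsValid c Q) : IsValid c L := by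
  intro i
  rw [← h.2 i, Nat.div_lt_iff_lt_mul (by positivity), ← pow_add, Nat.add_sub_cancel' h.1]
  exact hQ i

theorem isAncestor_root (hQ : IsValid c (Q : Node d)) : IsAncestor c ((0, 0) : Node d) Q :=
  ⟨Nat.zero_le _, fun i => Nat.div_eq_of_lt (hQ i)⟩

/-- The node of relative index `(b, k)` in the box of index `L`. -/
def relNode (c : ℕ) (L : Node d) (b : ℕ) (k : Fin d → ℕ) : Node d :=
  (L.1 + b, fun i => L.2 i * c ^ b + k i)

theorem isAncestor_relNode (hc : 0 < c) (L : Node d) {b : ℕ} {k : Fin d → ℕ}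
    (hk : ∀ i, k i < c ^ b) : IsAncestor c L (relNode c L b k) := by
  refine ⟨Nat.le_add_right _ _, fun i => ?_⟩
  simp only [relNode, Nat.add_sub_cancel_left]
  rw [add_comm, Nat.add_mul_div_right _ _ (by positivity), Nat.div_eq_of_lt (hk i), zero_add]

theorem exists_eq_relNode (hc : 0 < c) {L Q : Node d} (h : IsAncestor c L Q) :
    ∃ b k, (∀ i, k i < c ^ b) ∧ Q = relNode c L b k := by
  refine ⟨Q.1 - L.1, fun i => Q.2 i % c ^ (Q.1 - L.1), fun i => Nat.mod_lt _ (by positivity),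
    Prod.ext (Nat.add_sub_cancel' h.1).symm (funext fun i => ?_)⟩
  simp only [relNode]
  rw [← h.2 i, Nat.div_add_mod']

theorem isAncestor_relNode_iff (hc : 0 < c) (L : Node d) {b b' : ℕ} {k k' : Fin d → ℕ}
    (hb : b ≤ b') :
    IsAncestor c (relNode c L b k) (relNode c L b' k') ↔ ∀ i, k' i / c ^ (b' - b) = k i := by
  have key : ∀ i, (L.2 i * c ^ b' + k' i) / c ^ (b' - b) = L.2 i * c ^ b + k' i / c ^ (b' - b) := by
    intro i
    have : c ^ b' = c ^ b * c ^ (b' - b) := by rw [← pow_add, Nat.add_sub_cancel' hb]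
    rw [this, ← mul_assoc, add_comm, Nat.add_mul_div_right _ _ (by positivity), add_comm]
  simp only [IsAncestor, relNode, Nat.add_sub_add_left, key, Nat.add_left_cancel_iff]
  simp [hb]

/-- Ancestors of neighbouring boxes are neighbours or equal; thus being near a point passes to
larger boxes. -/
theorem abs_div_sub_div_le {A B : ℕ} (M : ℕ) (h : |(A : ℤ) - B| ≤ 1) :
    |((A / M : ℕ) : ℤ) - (B / M : ℕ)| ≤ 1 := by
  rcases Nat.eq_zero_or_pos M with rfl | hM
  · simp
  have key : ∀ A B : ℕ, A ≤ B + 1 → A / M ≤ B / M + 1 := fun A B hAB => by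
    calc A / M ≤ (B + M) / M := Nat.div_le_div_right (by omega)
      _ = B / M + 1 := Nat.add_div_right _ hM
  rw [abs_le] at h ⊢
  have h1 := key A B (by omega)
  have h2 := key B A (by omega)
  omega

/-! ### Selection of sub-boxes -/

variable {E : Set (Fin d → ℝ)} {δ : ℝ} {Hit : Node d → Prop} {child : Node d → Node d} {N : ℕ → ℕ}

/-- The boxes whose index satisfies `Hit` meet the neighbourhood of every point of every copy
of `E`, and each of them has a distinguished sub-box `child J`. -/
structure IsUbiquitous (c : ℕ) (E : Set (Fin d → ℝ)) (δ : ℝ) (Hit : Node d → Prop)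
    (child : Node d → Node d) : Prop where
  cover : ∀ L, IsValid c L → ∀ y ∈ E, ∀ N : ℕ, ∃ b ≥ N, ∃ k, IsNeighbor c b y k ∧
    Hit (relNode c L b k)
  isAncestor_child : ∀ J, Hit J → IsAncestor c J (child J)
  isValid_child : ∀ J, Hit J → IsValid c (child J)
  child_level_le : ∀ J, Hit J → ((child J).1 : ℝ) ≤ δ * (J.1 + 1) + 1

/-- The words of length `b` that are neighbours of the word `κ` and that satisfy `Hit` in `L`. -/
def Selectable (c : ℕ) (Hit : Node d → Prop) (L : Node d) (b : ℕ) (κ k : Fin d → ℕ) : Prop :=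
  (∀ i, k i < c ^ b) ∧ (∀ i, |(k i : ℤ) - κ i| ≤ 1) ∧ Hit (relNode c L b k)

/-- The relative generations at which a box can be selected near the copy of `y` in `L`. -/
def selLevels (c : ℕ) (Hit : Node d → Prop) (N : ℕ → ℕ) (L : Node d) (y : Fin d → ℝ) : Set ℕ :=
  {b | N L.1 ≤ b ∧ ∃ k, Selectable c Hit L b (boxIndex c b y) k}

/-- The least relative generation at which a box can be selected near the copy of `y` in `L`. -/
def selLevel (c : ℕ) (Hit : Node d → Prop) (N : ℕ → ℕ) (L : Node d) (y : Fin d → ℝ) : ℕ :=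
  sInf (selLevels c Hit N L y)

open Classical in
/-- A word that is selectable near `κ`. -/
def selWord (c : ℕ) (Hit : Node d → Prop) (L : Node d) (b : ℕ) (κ : Fin d → ℕ) : Fin d → ℕ :=
  if h : ∃ k, Selectable c Hit L b κ k then h.choose else 0

/-- The box selected near the copy of `y` in `L`. -/
def selNode (c : ℕ) (Hit : Node d → Prop) (N : ℕ → ℕ) (L : Node d) (y : Fin d → ℝ) : Node d :=
  relNode c L (selLevel c Hit N L y)
    (selWord c Hit L (selLevel c Hit N L y) (boxIndex c (selLevel c Hit N L y) y))

theorem measurable_selLevel (c : ℕ) (Hit : Node d → Prop) (N : ℕ → ℕ) (L : Node d) :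
    Measurable (selLevel c Hit N L) := by
  have hA : ∀ b, MeasurableSet {y | b ∈ selLevels c Hit N L y} := fun b =>
    measurable_boxIndex c b (Set.to_countable
      {κ | N L.1 ≤ b ∧ ∃ k, Selectable c Hit L b κ k}).measurableSet
  refine measurable_to_countable' fun b => ?_
  -- The second piece accounts for the default `sInf ∅ = 0`.
  have : selLevel c Hit N L ⁻¹' {b} =
      ({y | b ∈ selLevels c Hit N L y} ∩ ⋂ b' : ℕ, ⋂ (_ : b' < b),
        {y | b' ∈ selLevels c Hit N L y}ᶜ) ∪
      ({_y | b = 0} ∩ ⋂ b' : ℕ, {y | b' ∈ selLevels c Hit N L y}ᶜ) := by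
    ext y
    simp only [Set.mem_preimage, Set.mem_singleton_iff, selLevel, Set.mem_union, Set.mem_inter_iff,
      Set.mem_iInter, Set.mem_compl_iff]
    constructor
    · intro h
      rcases Set.eq_empty_or_nonempty (selLevels c Hit N L y) with he | hne
      · right
        rw [he, Nat.sInf_empty] at h
        refine ⟨h.symm, fun b' hb' => ?_⟩
        have : b' ∈ selLevels c Hit N L y := hb'
        rw [he] at this
        exact this
      · left
        exact ⟨h ▸ Nat.sInf_mem hne, fun b' hb' h' => Nat.notMem_of_lt_sInf (h.symm ▸ hb') h'⟩
    · rintro (⟨h1, h2⟩ | ⟨h1, h2⟩)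
      · refine le_antisymm (Nat.sInf_le h1) (le_of_not_gt fun hlt => ?_)
        exact h2 _ hlt (Nat.sInf_mem ⟨b, h1⟩)
      · have : selLevels c Hit N L y = ∅ := Set.eq_empty_iff_forall_notMem.2 h2
        rw [this, Nat.sInf_empty]
        exact h1.symm
  rw [this]
  refine ((hA b).inter (MeasurableSet.iInter fun b' => MeasurableSet.iInter fun _ =>
    (hA b').compl)).union (MeasurableSet.inter (MeasurableSet.const _)
      (MeasurableSet.iInter fun b' => (hA b').compl))

theorem measurable_selNode (c : ℕ) (Hit : Node d → Prop) (N : ℕ → ℕ) (L : Node d) :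
    Measurable (selNode c Hit N L) := by
  refine measurable_to_countable' fun M => ?_
  have : selNode c Hit N L ⁻¹' {M} = ⋃ b : ℕ, (selLevel c Hit N L ⁻¹' {b} ∩
      boxIndex c b ⁻¹' {κ | relNode c L b (selWord c Hit L b κ) = M}) := by
    ext y
    simp only [selNode, Set.mem_preimage, Set.mem_singleton_iff, Set.mem_iUnion, Set.mem_inter_iff]
    constructor
    · intro h
      exact ⟨_, rfl, h⟩
    · rintro ⟨b, rfl, h⟩
      exact h
  rw [this]
  exact MeasurableSet.iUnion fun b =>
    (measurable_selLevel c Hit N L (measurableSet_singleton b)).inter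
      (measurable_boxIndex c b (Set.to_countable _).measurableSet)

theorem IsUbiquitous.selLevels_nonempty (H : IsUbiquitous c E δ Hit child) {L : Node d}
    (hL : IsValid c L) {y : Fin d → ℝ} (hy : y ∈ E) : (selLevels c Hit N L y).Nonempty := by
  obtain ⟨b, hb, k, hk, hHit⟩ := H.cover L hL y hy (N L.1)
  exact ⟨b, hb, k, hk.1, hk.2, hHit⟩

theorem IsUbiquitous.selNode_spec (H : IsUbiquitous c E δ Hit child) {L : Node d}
    (hL : IsValid c L) {y : Fin d → ℝ} (hy : y ∈ E) :
    ∃ b k, selNode c Hit N L y = relNode c L b k ∧ b = selLevel c Hit N L y ∧ N L.1 ≤ b ∧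
      IsNeighbor c b y k ∧ Hit (relNode c L b k) := by
  obtain ⟨h1, h2⟩ := Nat.sInf_mem (H.selLevels_nonempty (N := N) hL hy)
  have h3 := h2.choose_spec
  have h4 : selWord c Hit L (selLevel c Hit N L y) (boxIndex c (selLevel c Hit N L y) y) =
      h2.choose := dif_pos h2
  refine ⟨_, _, rfl, rfl, h1, ?_⟩
  rw [h4]
  exact ⟨⟨h3.1, h3.2.1⟩, h3.2.2⟩

theorem IsUbiquitous.hit_selNode (H : IsUbiquitous c E δ Hit child) {L : Node d}
    (hL : IsValid c L) {y : Fin d → ℝ} (hy : y ∈ E) : Hit (selNode c Hit N L y) := by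
  obtain ⟨b, k, h, -, -, -, hHit⟩ := H.selNode_spec (N := N) hL hy
  rwa [h]

/-- Near a point, a box containing a selected box cannot have been selected earlier. -/
theorem IsUbiquitous.selNode_eq_of_isAncestor (H : IsUbiquitous c E δ Hit child) (hc : 0 < c)
    {L : Node d} (hL : IsValid c L) {y z : Fin d → ℝ} (hy : y ∈ E) (hz : z ∈ E)
    (h : IsAncestor c (selNode c Hit N L y) (selNode c Hit N L z)) :
    selNode c Hit N L y = selNode c Hit N L z := by
  obtain ⟨b, k, h1, -, hNb, hnb, hHit⟩ := H.selNode_spec (N := N) hL hy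
  obtain ⟨b', k', h1', hb', -, hnb', -⟩ := H.selNode_spec (N := N) hL hz
  have hbb' : b ≤ b' := by
    have := h.1
    rw [h1, h1'] at this
    simpa [relNode] using this
  rw [h1, h1', isAncestor_relNode_iff hc L hbb'] at h
  -- The box selected near `y` contains a neighbour of the box of `z`, so it neighbours the box of
  -- `z` of its own generation and was already selectable near `z`. Minimality of the level at `z`
  -- forces equality.
  have hmem : b ∈ selLevels c Hit N L z := by
    refine ⟨hNb, k, hnb.1, fun i => ?_, hHit⟩
    have h2 := abs_div_sub_div_le (c ^ (b' - b)) (hnb'.2 i)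
    have h3 := boxIndex_div hc b (b' - b) z i
    rw [Nat.add_sub_cancel' hbb'] at h3
    rwa [h3, h i] at h2
  have hle : b' ≤ b := hb' ▸ Nat.sInf_le hmem
  obtain rfl : b = b' := le_antisymm hbb' hle
  rw [h1, h1']
  congr 1
  funext i
  simpa using (h i).symm

/-- Distinct boxes selected in `L` are disjoint, so a box below a selected one reveals which
selection was made. -/
theorem IsUbiquitous.selNode_eq_of_common (H : IsUbiquitous c E δ Hit child) (hc : 0 < c)
    {L Q : Node d} (hL : IsValid c L) {y z : Fin d → ℝ} (hy : y ∈ E) (hz : z ∈ E)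
    (h : IsAncestor c (selNode c Hit N L y) Q) (h' : IsAncestor c (selNode c Hit N L z) Q) :
    selNode c Hit N L y = selNode c Hit N L z := by
  rcases le_total (selNode c Hit N L y).1 (selNode c Hit N L z).1 with hle | hle
  · exact H.selNode_eq_of_isAncestor hc hL hy hz (h.of_common h' hle)
  · exact (H.selNode_eq_of_isAncestor hc hL hz hy (h'.of_common h hle)).symm

end Tree

/-! ### Random descending paths -/

section Paths

variable {d c : ℕ} {E : Set (Fin d → ℝ)} {δ : ℝ} {Hit : Node d → Prop}
  {child : Node d → Node d} {N : ℕ → ℕ}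

/-- The path that starts at `L` and moves according to the points `ω 0, ω 1, …`. -/
def nodePath (c : ℕ) (Hit : Node d → Prop) (child : Node d → Node d) (N : ℕ → ℕ) :
    Node d → (ℕ → Fin d → ℝ) → ℕ → Node d
  | L, _, 0 => L
  | L, ω, s + 1 => nodePath c Hit child N (child (selNode c Hit N L (ω 0))) (fun n => ω (n + 1)) s

/-- The definition unrolls the path from its start, which suits renewal; this unrolls it at its end,
which suits inductions on the number of steps. -/
theorem nodePath_succ (L : Node d) (ω : ℕ → Fin d → ℝ) (s : ℕ) :
    nodePath c Hit child N L ω (s + 1) =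
      child (selNode c Hit N (nodePath c Hit child N L ω s) (ω s)) := by
  induction s generalizing L ω with
  | zero => rfl
  | succ s ih => rw [nodePath, ih, nodePath]

theorem measurable_nodePath (L : Node d) (s : ℕ) :
    Measurable fun ω => nodePath c Hit child N L ω s := by
  induction s with
  | zero => exact measurable_const
  | succ s ih =>
    refine measurable_to_countable' fun M => ?_
    have : (fun ω => nodePath c Hit child N L ω (s + 1)) ⁻¹' {M} = ⋃ Q : Node d,
        ((fun ω => nodePath c Hit child N L ω s) ⁻¹' {Q} ∩
          (fun ω : ℕ → Fin d → ℝ => selNode c Hit N Q (ω s)) ⁻¹' (child ⁻¹' {M})) := by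
      ext ω
      simp only [Set.mem_preimage, Set.mem_singleton_iff, nodePath_succ, Set.mem_iUnion,
        Set.mem_inter_iff, exists_eq_left']
    rw [this]
    exact MeasurableSet.iUnion fun Q => (ih (measurableSet_singleton Q)).inter
      (((measurable_selNode c Hit N Q).comp (measurable_pi_apply s))
        (Set.to_countable _).measurableSet)

theorem IsUbiquitous.isValid_nodePath (H : IsUbiquitous c E δ Hit child) {L : Node d}
    (hL : IsValid c L) {ω : ℕ → Fin d → ℝ} (hω : ∀ n, ω n ∈ E) (s : ℕ) :
    IsValid c (nodePath c Hit child N L ω s) := by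
  induction s with
  | zero => exact hL
  | succ s ih => rw [nodePath_succ]; exact H.isValid_child _ (H.hit_selNode ih (hω s))

theorem IsUbiquitous.isAncestor_selNode (H : IsUbiquitous c E δ Hit child) (hc : 0 < c)
    {L : Node d} (hL : IsValid c L) {y : Fin d → ℝ} (hy : y ∈ E) :
    IsAncestor c L (selNode c Hit N L y) := by
  obtain ⟨b, k, h, -, -, hnb, -⟩ := H.selNode_spec (N := N) hL hy
  rw [h]
  exact isAncestor_relNode hc L hnb.1

theorem IsUbiquitous.level_lt_selNode (H : IsUbiquitous c E δ Hit child)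
    (hN : ∀ a, 1 ≤ N a) {L : Node d} (hL : IsValid c L) {y : Fin d → ℝ} (hy : y ∈ E) :
    L.1 < (selNode c Hit N L y).1 := by
  obtain ⟨b, k, h, -, hb, -, -⟩ := H.selNode_spec (N := N) hL hy
  rw [h]
  have := hN L.1
  simp only [relNode]
  omega

theorem IsUbiquitous.isAncestor_step (H : IsUbiquitous c E δ Hit child) (hc : 0 < c)
    {L : Node d} (hL : IsValid c L) {y : Fin d → ℝ} (hy : y ∈ E) :
    IsAncestor c L (child (selNode c Hit N L y)) :=
  (H.isAncestor_selNode hc hL hy).trans (H.isAncestor_child _ (H.hit_selNode hL hy))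

theorem IsUbiquitous.isAncestor_nodePath (H : IsUbiquitous c E δ Hit child) (hc : 0 < c)
    {L : Node d} (hL : IsValid c L) {ω : ℕ → Fin d → ℝ} (hω : ∀ n, ω n ∈ E) {r s : ℕ}
    (hrs : r ≤ s) :
    IsAncestor c (nodePath c Hit child N L ω r) (nodePath c Hit child N L ω s) := by
  induction s, hrs using Nat.le_induction with
  | base => exact IsAncestor.refl _
  | succ s _ ih =>
    refine ih.trans ?_
    rw [nodePath_succ]
    exact H.isAncestor_step hc (H.isValid_nodePath hL hω s) (hω s)

theorem IsUbiquitous.level_lt_step (H : IsUbiquitous c E δ Hit child)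
    (hN : ∀ a, 1 ≤ N a) {L : Node d} (hL : IsValid c L) {y : Fin d → ℝ} (hy : y ∈ E) :
    L.1 < (child (selNode c Hit N L y)).1 :=
  (H.level_lt_selNode hN hL hy).trans_le (H.isAncestor_child _ (H.hit_selNode hL hy)).1

theorem IsUbiquitous.le_level_nodePath (H : IsUbiquitous c E δ Hit child)
    (hN : ∀ a, 1 ≤ N a) {L : Node d} (hL : IsValid c L) {ω : ℕ → Fin d → ℝ}
    (hω : ∀ n, ω n ∈ E) (s : ℕ) : s ≤ (nodePath c Hit child N L ω s).1 := by
  induction s with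
  | zero => exact Nat.zero_le _
  | succ s ih =>
    rw [nodePath_succ]
    exact Nat.succ_le_of_lt (ih.trans_lt (H.level_lt_step hN (H.isValid_nodePath hL hω s) (hω s)))

/-! ### Probability that a path enters a box -/

/-- The event that the path starting at `L` enters the box `Q`. -/
def enters (c : ℕ) (Hit : Node d → Prop) (child : Node d → Node d) (N : ℕ → ℕ) (L Q : Node d) :
    Set (ℕ → Fin d → ℝ) :=
  {ω | ∃ s, IsAncestor c Q (nodePath c Hit child N L ω s)}

theorem measurableSet_enters (L Q : Node d) : MeasurableSet (enters c Hit child N L Q) := by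
  have : enters c Hit child N L Q =
      ⋃ s, (fun ω => nodePath c Hit child N L ω s) ⁻¹' {M | IsAncestor c Q M} := by
    ext ω; simp [enters]
  rw [this]
  exact MeasurableSet.iUnion fun s =>
    measurable_nodePath L s (Set.to_countable _).measurableSet

/-- Renewal after one step: the first point is independent of the sequence that drives the rest of
the path. -/
theorem infinitePi_zero_shift {X : Type*} [MeasurableSpace X] (ν : Measure X)
    [IsProbabilityMeasure ν] {A : Set X} {B : Set (ℕ → X)} (hA : MeasurableSet A)
    (hB : MeasurableSet B) :
    Measure.infinitePi (fun _ : ℕ => ν) {ω | ω 0 ∈ A ∧ (fun n => ω (n + 1)) ∈ B} =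
      ν A * Measure.infinitePi (fun _ : ℕ => ν) B := by
  have hm : MeasurableSet {ω : ℕ → X | ω 0 ∈ A ∧ (fun n => ω (n + 1)) ∈ B} :=
    (measurable_pi_apply 0 hA).inter
      ((measurable_pi_lambda _ fun n => measurable_pi_apply (n + 1)) hB)
  conv_lhs => rw [← map_seqCons_infinitePi ν, Measure.map_apply measurable_seqCons hm]
  have : (fun q : X × (ℕ → X) => seqCons q.1 q.2) ⁻¹'
      {ω : ℕ → X | ω 0 ∈ A ∧ (fun n => ω (n + 1)) ∈ B} = A ×ˢ B := by
    ext q; rfl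
  rw [this, Measure.prod_prod]

theorem infinitePi_zero {X : Type*} [MeasurableSpace X] (ν : Measure X)
    [IsProbabilityMeasure ν] {A : Set X} (hA : MeasurableSet A) :
    Measure.infinitePi (fun _ : ℕ => ν) {ω | ω 0 ∈ A} = ν A := by
  simpa using infinitePi_zero_shift ν hA MeasurableSet.univ

theorem ae_infinitePi_forall_mem {X : Type*} [MeasurableSpace X] (ν : Measure X)
    [IsProbabilityMeasure ν] {A : Set X} (h : ∀ᵐ x ∂ν, x ∈ A) :
    ∀ᵐ ω ∂Measure.infinitePi (fun _ : ℕ => ν), ∀ n, ω n ∈ A := by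
  rw [ae_all_iff]
  intro n
  have hmp := measurePreserving_eval_infinitePi (fun _ : ℕ => ν) n
  exact hmp.quasiMeasurePreserving.ae h

end Paths

/-! ### Mass of the boxes entered by random paths -/

section PathMass

variable {d c n₀ : ℕ} {π : Fin d → Fin c → ℝ} {φ : ℝ → ℝ} {δ : ℝ} {Hit : Node d → Prop}
  {child : Node d → Node d} {N : ℕ → ℕ}

/-- The law of a point under the product measure, conditioned to be balanced from the
generation `n` on. -/
def balancedLaw (π : Fin d → Fin c → ℝ) (n : ℕ) : Measure (Fin d → ℝ) :=
  ProbabilityTheory.cond (productMultinomial π) (balancedFrom π n)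

/-- The gauge `φ` controls the masses of the boxes of generations at least `n₀`, and the points
that are balanced from the generation `n₀` on have at least half of the mass. -/
structure IsControlled (π : Fin d → Fin c → ℝ) (φ : ℝ → ℝ) (n₀ : ℕ) : Prop where
  nonneg : ∀ r, 0 ≤ φ r
  monotone : Monotone (gaugeLevel c φ)
  tendsto : Tendsto (gaugeLevel c φ) atTop atTop
  lilBound_le : ∀ j ≥ n₀, logSize π * (7 * lilBound j) ≤ gaugeLevel c φ j
  half_le : 1 / 2 ≤ productMultinomial π (balancedFrom π n₀)

theorem IsControlled.gaugeLevel_nonneg (h : IsControlled π φ n₀) (j : ℕ) :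
    0 ≤ gaugeLevel c φ j := mul_nonneg (Nat.cast_nonneg _) (h.nonneg _)

theorem IsControlled.ne_zero (h : IsControlled π φ n₀) :
    productMultinomial π (balancedFrom π n₀) ≠ 0 :=
  (lt_of_lt_of_le (by simp) h.half_le).ne'

theorem IsControlled.isProbabilityMeasure (h : IsControlled π φ n₀) (hπ : ∀ i, IsPosProb (π i)) :
    IsProbabilityMeasure (balancedLaw π n₀) := by
  have := isProbabilityMeasure_productMultinomial hπ
  exact ProbabilityTheory.cond_isProbabilityMeasure h.ne_zero

theorem ae_balancedLaw (hπ : ∀ i, IsPosProb (π i)) :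
    ∀ᵐ y ∂balancedLaw π n₀, y ∈ balancedFrom π n₀ := by
  have := isProbabilityMeasure_productMultinomial hπ
  exact ProbabilityTheory.ae_cond_mem (measurableSet_balancedFrom π n₀)

theorem IsControlled.balancedLaw_le (h : IsControlled π φ n₀) (S : Set (Fin d → ℝ)) :
    balancedLaw π n₀ S ≤ 2 * productMultinomial π (balancedFrom π n₀ ∩ S) := by
  rw [balancedLaw, ProbabilityTheory.cond_apply (measurableSet_balancedFrom π n₀)]
  refine mul_le_mul_left ?_ _
  rw [ENNReal.inv_le_iff_inv_le, ← one_div]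
  exact h.half_le

/-- The box of such a point is one of at most `3 ^ d` boxes. Each of them either contains no
balanced point of the set or has the mass bound, as the box of a balanced point. -/
theorem IsControlled.productMultinomial_neighbor_le (h : IsControlled π φ n₀) (hc : 2 ≤ c)
    (hπ : ∀ i, IsPosProb (π i)) {b : ℕ} (hb : n₀ ≤ b) (k : Fin d → ℕ) :
    productMultinomial π (balancedFrom π n₀ ∩ {y | IsNeighbor c b y k}) ≤
      3 ^ d * ENNReal.ofReal ((c : ℝ) ^ (-(b * ∑ i, vecEntropy (π i)) + gaugeLevel c φ b)) := by
  have hc0 : 0 < c := by omega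
  set F : Finset (Fin d → ℕ) := Fintype.piFinset fun i => Finset.Icc (k i - 1) (k i + 1) with hF
  have hcard : (F.card : ℝ≥0∞) ≤ 3 ^ d := by
    have : F.card ≤ 3 ^ d := by
      rw [hF, Fintype.card_piFinset]
      calc ∏ i, (Finset.Icc (k i - 1) (k i + 1)).card ≤ ∏ _i : Fin d, 3 :=
            Finset.prod_le_prod' fun i _ => by rw [Nat.card_Icc]; omega
        _ = 3 ^ d := by simp
    exact_mod_cast this
  have hsub : balancedFrom π n₀ ∩ {y | IsNeighbor c b y k} ⊆
      ⋃ κ ∈ F, balancedFrom π n₀ ∩ {y | IsNeighbor c b y k} ∩ {y | boxIndex c b y = κ} := by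
    intro y hy
    refine Set.mem_biUnion (x := boxIndex c b y) ?_ ⟨hy, rfl⟩
    simp only [hF, Fintype.coe_piFinset, Set.mem_pi, Finset.mem_coe, Finset.mem_Icc]
    intro i _
    have := abs_le.1 (hy.2.2 i)
    omega
  refine (measure_mono hsub).trans ((measure_biUnion_finset_le _ _).trans ?_)
  refine (Finset.sum_le_card_nsmul _ _ (ENNReal.ofReal ((c : ℝ) ^ (-(b * ∑ i, vecEntropy (π i)) +
    gaugeLevel c φ b))) fun κ _ => ?_).trans ?_
  · rcases Set.eq_empty_or_nonempty (balancedFrom π n₀ ∩ {y | IsNeighbor c b y k} ∩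
      {y | boxIndex c b y = κ}) with he | ⟨y, ⟨hy, -⟩, hyκ⟩
    · rw [he, measure_empty]; exact zero_le
    · have hy01 := mem_Ioo_of_mem_balancedFrom hc0 hy
      have hyκ : boxIndex c b y = κ := hyκ
      have hnb : IsNeighbor c b y κ := by
        rw [← hyκ]
        exact ⟨boxIndex_lt hc0 b fun i => ⟨(hy01 i).1.le, (hy01 i).2⟩, fun i => by simp⟩
      refine (measure_mono ?_).trans
        (productMultinomial_cBox_le hc hπ (h.lilBound_le b hb) hy hb hnb)
      rintro z ⟨⟨hz, -⟩, hzκ⟩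
      exact (mem_cBox_iff hc0).2 ⟨fun i => (mem_Ioo_of_mem_balancedFrom hc0 hz i).1.le, hzκ⟩
  · rw [nsmul_eq_mul]
    exact mul_le_mul_left hcard _

theorem IsControlled.balancedLaw_neighbor_le (h : IsControlled π φ n₀) (hc : 2 ≤ c)
    (hπ : ∀ i, IsPosProb (π i)) {b : ℕ} (hb : n₀ ≤ b) (k : Fin d → ℕ) {S : Set (Fin d → ℝ)}
    (hS : ∀ y ∈ S, y ∈ balancedFrom π n₀ → IsNeighbor c b y k) :
    (balancedLaw π n₀).real S ≤
      2 * 3 ^ d * (c : ℝ) ^ (-(b * ∑ i, vecEntropy (π i)) + gaugeLevel c φ b) := by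
  have h1 : balancedLaw π n₀ S ≤ ENNReal.ofReal
      (2 * 3 ^ d * (c : ℝ) ^ (-(b * ∑ i, vecEntropy (π i)) + gaugeLevel c φ b)) := by
    refine (h.balancedLaw_le S).trans ?_
    rw [mul_assoc, ENNReal.ofReal_mul (by norm_num), ENNReal.ofReal_mul (by positivity),
      ENNReal.ofReal_pow (by norm_num)]
    simp only [ENNReal.ofReal_ofNat]
    refine mul_le_mul_right (le_trans (measure_mono ?_)
      (h.productMultinomial_neighbor_le hc hπ hb k)) _
    exact fun y hy => ⟨hy.1, hS y hy.2 hy.1⟩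
  exact ENNReal.toReal_le_of_le_ofReal (by positivity) h1

/-- The generations `N a` at which the selection in a box of generation `a` starts are large. -/
structure IsLate (π : Fin d → Fin c → ℝ) (φ : ℝ → ℝ) (n₀ : ℕ) (N : ℕ → ℕ) : Prop where
  one_le : ∀ a, 1 ≤ N a
  le : ∀ a, n₀ ≤ N a
  le_gaugeLevel : ∀ a, ∀ b ≥ N a,
    a * ∑ i, vecEntropy (π i) + Real.logb c (2 * 3 ^ d) ≤ gaugeLevel c φ b

theorem IsControlled.exists_isLate (h : IsControlled π φ n₀) : ∃ N, IsLate π φ n₀ N := by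
  have := fun a : ℕ => (eventually_forall_ge_atTop.2 (h.tendsto.eventually_ge_atTop
    (a * ∑ i, vecEntropy (π i) + Real.logb c (2 * 3 ^ d)))).and
      ((eventually_ge_atTop 1).and (eventually_ge_atTop n₀)) |>.exists
  choose N hN using this
  exact ⟨N, fun a => (hN a).2.1, fun a => (hN a).2.2, fun a => (hN a).1⟩

theorem sum_vecEntropy_nonneg (hc : 2 ≤ c) (hπ : ∀ i, IsPosProb (π i)) :
    0 ≤ ∑ i, vecEntropy (π i) :=
  Finset.sum_nonneg fun i _ => (neg_sum_mul_logb_pos (hπ i) (hπ i) hc).le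

/-- In a box of generation `a`, a selection at relative generation `b` has probability at most `2 *
3 ^ d * c^(-bβ + gaugeLevel b)`. The missing `c^(-aβ)` and the constant are paid by the second
`gaugeLevel`, because `b ≥ N a`. -/
theorem IsControlled.balancedLaw_selNode_le (h : IsControlled π φ n₀) (hN : IsLate π φ n₀ N)
    (hc : 2 ≤ c) (hπ : ∀ i, IsPosProb (π i))
    (H : IsUbiquitous c (balancedFrom π n₀) δ Hit child) {L : Node d} (hL : IsValid c L)
    {y : Fin d → ℝ} (hy : y ∈ balancedFrom π n₀) :
    (balancedLaw π n₀).real {z | selNode c Hit N L z = selNode c Hit N L y} ≤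
      (c : ℝ) ^ (-((selNode c Hit N L y).1 * ∑ i, vecEntropy (π i)) +
        2 * gaugeLevel c φ (selNode c Hit N L y).1) := by
  have hc1 : (1 : ℝ) < c := by exact_mod_cast (by omega : 1 < c)
  obtain ⟨b, k, hJ, -, hNb, hnb, hHit⟩ := H.selNode_spec (N := N) hL hy
  rw [hJ]
  refine (h.balancedLaw_neighbor_le hc hπ ((hN.le L.1).trans hNb) k fun z hz hzE => ?_).trans ?_
  · obtain ⟨b', k', hJ', -, -, hnb', -⟩ := H.selNode_spec (N := N) hL hzE
    have heq : relNode c L b' k' = relNode c L b k := hJ'.symm.trans hz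
    have hbb : b' = b := by simpa [relNode] using congrArg Prod.fst heq
    subst hbb
    have hkk : k' = k := funext fun i => by
      simpa [relNode] using congrFun (congrArg Prod.snd heq) i
    rwa [← hkk]
  · have h1 : (2 * 3 ^ d : ℝ) = (c : ℝ) ^ Real.logb c (2 * 3 ^ d) :=
      (Real.rpow_logb (by linarith) hc1.ne' (by positivity)).symm
    rw [h1, ← Real.rpow_add (by linarith)]
    refine Real.rpow_le_rpow_of_exponent_le hc1.le ?_
    have h2 := hN.le_gaugeLevel L.1 b hNb
    have h3 : gaugeLevel c φ b ≤ gaugeLevel c φ (L.1 + b) := h.monotone (Nat.le_add_left _ _)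
    simp only [relNode]
    push_cast
    linarith

/-- The bound for the mass of a box of generation `t`. -/
theorem rpow_level_le (h : IsControlled π φ n₀) (hc : 2 ≤ c) (hπ : ∀ i, IsPosProb (π i))
    (hδ : 1 ≤ δ) {j t : ℕ} (hjt : j ≤ t) (htj : (t : ℝ) ≤ δ * (j + 1) + 1) :
    (c : ℝ) ^ (-(j * ∑ i, vecEntropy (π i)) + 2 * gaugeLevel c φ j) ≤
      (c : ℝ) ^ (2 * ∑ i, vecEntropy (π i) - t * ((∑ i, vecEntropy (π i)) / δ) +
        2 * gaugeLevel c φ t) := by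
  have hc1 : (1 : ℝ) < c := by exact_mod_cast (by omega : 1 < c)
  have hβ := sum_vecEntropy_nonneg hc hπ
  refine Real.rpow_le_rpow_of_exponent_le hc1.le ?_
  have h1 := h.monotone hjt
  -- As `δ ≥ 1`, `t ≤ δ (j + 1) + 1 ≤ δ (j + 2)`; this is the origin of the constant `2β` in the
  -- exponent.
  have h2 : (t : ℝ) * ((∑ i, vecEntropy (π i)) / δ) ≤ (j + 2) * ∑ i, vecEntropy (π i) := by
    rw [← mul_div_assoc, mul_comm, mul_div_assoc, mul_comm]
    refine mul_le_mul_of_nonneg_right ?_ hβ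
    rw [div_le_iff₀ (by linarith)]
    nlinarith [Nat.cast_nonneg (α := ℝ) j]
  linarith

/-- The path must make at least one step to enter `Q`. The box `M` lies both in `Q` and in the first
child, which makes these two comparable. -/
theorem exists_common_descendant (H : IsUbiquitous c (balancedFrom π n₀) δ Hit child) (hc : 0 < c)
    {L Q : Node d} (hL : IsValid c L) (hLQ : L.1 < Q.1) {ω : ℕ → Fin d → ℝ}
    (hE : ∀ n, ω n ∈ balancedFrom π n₀) (hω : ω ∈ enters c Hit child N L Q) :
    (fun n => ω (n + 1)) ∈ enters c Hit child N (child (selNode c Hit N L (ω 0))) Q ∧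
      ∃ M, IsAncestor c Q M ∧ IsAncestor c (child (selNode c Hit N L (ω 0))) M := by
  obtain ⟨s, hs⟩ := hω
  cases s with
  | zero => exact absurd hs.1 (not_le.2 hLQ)
  | succ s =>
    exact ⟨⟨s, hs⟩, _, hs, H.isAncestor_nodePath hc (H.isValid_child _ (H.hit_selNode hL (hE 0)))
      (fun n => hE (n + 1)) (Nat.zero_le s)⟩

theorem IsControlled.ae_forall_mem (h : IsControlled π φ n₀) (hπ : ∀ i, IsPosProb (π i)) :
    ∀ᵐ ω ∂Measure.infinitePi fun _ : ℕ => balancedLaw π n₀, ∀ n, ω n ∈ balancedFrom π n₀ :=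
  have := h.isProbabilityMeasure hπ
  ae_infinitePi_forall_mem _ (ae_balancedLaw hπ)

theorem IsControlled.real_enters_le (h : IsControlled π φ n₀) (hπ : ∀ i, IsPosProb (π i))
    {L Q : Node d} {A : Set (Fin d → ℝ)} (hA : MeasurableSet A)
    (hsub : ∀ ω : ℕ → Fin d → ℝ, (∀ n, ω n ∈ balancedFrom π n₀) → ω ∈ enters c Hit child N L Q →
      ω 0 ∈ A) :
    (Measure.infinitePi fun _ : ℕ => balancedLaw π n₀).real (enters c Hit child N L Q) ≤
      (balancedLaw π n₀).real A := by
  have hP := h.isProbabilityMeasure hπ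
  rw [measureReal_def, measureReal_def, ← infinitePi_zero (balancedLaw π n₀) hA]
  refine ENNReal.toReal_mono (measure_ne_top _ _) (measure_mono_ae ?_)
  filter_upwards [h.ae_forall_mem hπ] with ω hE hω
  exact hsub ω hE hω

/-- If `Q` lies in the child of a selected box, disjointness forces the first step to select that
very box, and renewal separates this event from the rest of the path. -/
theorem IsControlled.real_enters_le_mul (h : IsControlled π φ n₀) (hc : 0 < c)
    (hπ : ∀ i, IsPosProb (π i)) (H : IsUbiquitous c (balancedFrom π n₀) δ Hit child)
    {L Q : Node d} (hL : IsValid c L) (hLQ : L.1 < Q.1) {y : Fin d → ℝ}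
    (hy : y ∈ balancedFrom π n₀) (hyQ : IsAncestor c (child (selNode c Hit N L y)) Q) :
    (Measure.infinitePi fun _ : ℕ => balancedLaw π n₀).real (enters c Hit child N L Q) ≤
      (balancedLaw π n₀).real {z | selNode c Hit N L z = selNode c Hit N L y} *
        (Measure.infinitePi fun _ : ℕ => balancedLaw π n₀).real
          (enters c Hit child N (child (selNode c Hit N L y)) Q) := by
  have hP := h.isProbabilityMeasure hπ
  have hms : MeasurableSet {z | selNode c Hit N L z = selNode c Hit N L y} :=
    measurable_selNode c Hit N L (measurableSet_singleton _)
  rw [measureReal_def, measureReal_def, measureReal_def, ← ENNReal.toReal_mul,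
    ← infinitePi_zero_shift (balancedLaw π n₀) hms (measurableSet_enters _ _)]
  refine ENNReal.toReal_mono (measure_ne_top _ _) (measure_mono_ae ?_)
  filter_upwards [h.ae_forall_mem hπ] with ω hE hω
  obtain ⟨hshift, M, hQM, hKM⟩ := exists_common_descendant H hc hL hLQ hE hω
  have hsel : selNode c Hit N L (ω 0) = selNode c Hit N L y :=
    H.selNode_eq_of_common hc hL (hE 0) hy
      ((H.isAncestor_child _ (H.hit_selNode hL (hE 0))).trans hKM)
      ((H.isAncestor_child _ (H.hit_selNode hL hy)).trans (hyQ.trans hQM))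
  rw [hsel] at hshift
  exact ⟨hsel, hshift⟩

/-- The box `Q` lies between a selected box and its child. Entering it requires this selection,
whose probability suffices because the generation of `Q` is at most that of the child. -/
theorem IsControlled.real_enters_le_of_selNode (h : IsControlled π φ n₀) (hN : IsLate π φ n₀ N)
    (hc : 2 ≤ c) (hπ : ∀ i, IsPosProb (π i)) (hδ : 1 ≤ δ)
    (H : IsUbiquitous c (balancedFrom π n₀) δ Hit child)
    {L Q : Node d} (hL : IsValid c L) (hLQ : L.1 < Q.1) {y : Fin d → ℝ}
    (hy : y ∈ balancedFrom π n₀) (hyQ : IsAncestor c (selNode c Hit N L y) Q)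
    (hnot : ¬ IsAncestor c (child (selNode c Hit N L y)) Q) :
    (Measure.infinitePi fun _ : ℕ => balancedLaw π n₀).real (enters c Hit child N L Q) ≤
      (c : ℝ) ^ (2 * ∑ i, vecEntropy (π i) - Q.1 * ((∑ i, vecEntropy (π i)) / δ) +
        2 * gaugeLevel c φ Q.1) := by
  have hc0 : 0 < c := by omega
  have hmem : ∀ ω : ℕ → Fin d → ℝ, (∀ n, ω n ∈ balancedFrom π n₀) →
      ω ∈ enters c Hit child N L Q → selNode c Hit N L (ω 0) = selNode c Hit N L y ∧
        IsAncestor c Q (child (selNode c Hit N L y)) := by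
    intro ω hE hω
    obtain ⟨-, M, hQM, hKM⟩ := exists_common_descendant H hc0 hL hLQ hE hω
    have hsel : selNode c Hit N L (ω 0) = selNode c Hit N L y :=
      H.selNode_eq_of_common hc0 hL (hE 0) hy
        ((H.isAncestor_child _ (H.hit_selNode hL (hE 0))).trans hKM) (hyQ.trans hQM)
    refine ⟨hsel, ?_⟩
    rw [hsel] at hKM
    rcases le_total Q.1 (child (selNode c Hit N L y)).1 with hle | hle
    · exact hQM.of_common hKM hle
    · exact absurd (hKM.of_common hQM hle) hnot
  -- A path that does enter certifies that the child lies in `Q`; if there is none, the probability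
  -- is zero.
  by_cases hne : ∃ ω ∈ enters c Hit child N L Q, ∀ n, ω n ∈ balancedFrom π n₀
  · obtain ⟨ω₀, hω₀, hE₀⟩ := hne
    have hQ := (hmem ω₀ hE₀ hω₀).2
    refine (h.real_enters_le hπ (A := {z | selNode c Hit N L z = selNode c Hit N L y})
      (measurable_selNode c Hit N L (measurableSet_singleton _))
      fun ω hE hω => (hmem ω hE hω).1).trans ?_
    exact (h.balancedLaw_selNode_le hN hc hπ H hL hy).trans (rpow_level_le h hc hπ hδ hyQ.1
      (le_trans (Nat.cast_le.2 hQ.1) (H.child_level_le _ (H.hit_selNode hL hy))))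
  · refine (h.real_enters_le hπ (A := ∅) MeasurableSet.empty
      fun ω hE hω => hne ⟨ω, hω, hE⟩).trans ?_
    rw [measureReal_empty]
    positivity

theorem measurableSet_isNeighbor (b : ℕ) (k : Fin d → ℕ) :
    MeasurableSet {z : Fin d → ℝ | IsNeighbor c b z k} := by
  have : {z : Fin d → ℝ | IsNeighbor c b z k} = boxIndex c b ⁻¹'
      {κ | (∀ i, k i < c ^ b) ∧ ∀ i, |(k i : ℤ) - (κ i : ℤ)| ≤ 1} := rfl
  rw [this]
  exact measurable_boxIndex c b (Set.to_countable _).measurableSet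

/-- When no selected box contains `Q`, a path that enters `Q` selects a box inside `Q` at its first
step. Its first point then has its box adjacent to `Q`, in coordinates relative to `L`. -/
theorem IsControlled.real_enters_le_of_not (h : IsControlled π φ n₀)
    (hc : 2 ≤ c) (hπ : ∀ i, IsPosProb (π i))
    (H : IsUbiquitous c (balancedFrom π n₀) δ Hit child)
    {L : Node d} (hL : IsValid c L) {b : ℕ} {k : Fin d → ℕ} (hk : ∀ i, k i < c ^ b) (hb : 0 < b)
    (hbn : n₀ ≤ b)
    (hnot : ∀ y ∈ balancedFrom π n₀, ¬ IsAncestor c (selNode c Hit N L y) (relNode c L b k)) :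
    (Measure.infinitePi fun _ : ℕ => balancedLaw π n₀).real
        (enters c Hit child N L (relNode c L b k)) ≤
      2 * 3 ^ d * (c : ℝ) ^ (-(b * ∑ i, vecEntropy (π i)) + gaugeLevel c φ b) := by
  have hc0 : 0 < c := by omega
  have hms : MeasurableSet {z : Fin d → ℝ | IsNeighbor c b z k} := measurableSet_isNeighbor b k
  refine (h.real_enters_le hπ (A := {z | IsNeighbor c b z k}) hms fun ω hE hω => ?_).trans
    (h.balancedLaw_neighbor_le hc hπ hbn k fun z hz _ => hz)
  obtain ⟨-, M, hQM, hKM⟩ := exists_common_descendant H hc0 hL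
    (by simp only [relNode]; omega) hE hω
  obtain ⟨b', k', hJ, -, -, hnb, hHit⟩ := H.selNode_spec (N := N) hL (hE 0)
  have hJM := (H.isAncestor_child _ (H.hit_selNode hL (hE 0))).trans hKM
  have hQJ : IsAncestor c (relNode c L b k) (selNode c Hit N L (ω 0)) := by
    rcases le_total (relNode c L b k).1 (selNode c Hit N L (ω 0)).1 with hle | hle
    · exact hQM.of_common hJM hle
    · exact absurd (hJM.of_common hQM hle) (hnot _ (hE 0))
  have hbb' : b ≤ b' := by
    have := hQJ.1
    rw [hJ] at this
    simpa [relNode] using this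
  rw [hJ, isAncestor_relNode_iff hc0 L hbb'] at hQJ
  refine ⟨hk, fun i => ?_⟩
  have h2 := abs_div_sub_div_le (c ^ (b' - b)) (hnb.2 i)
  have h3 := boxIndex_div hc0 b (b' - b) (ω 0) i
  rw [Nat.add_sub_cancel' hbb'] at h3
  rwa [h3, hQJ i] at h2

/-- The weight `w` stands for the probability of having reached `L`. It is needed for `Q` lying
between `L` and the next selected boxes, where the estimate inside `L` alone would lack the mass of
`L`. The induction is on the gap between the generations of `L` and `Q`. -/
theorem IsControlled.mul_enters_le (h : IsControlled π φ n₀) (hN : IsLate π φ n₀ N)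
    (hc : 2 ≤ c) (hπ : ∀ i, IsPosProb (π i)) (hδ : 1 ≤ δ)
    (H : IsUbiquitous c (balancedFrom π n₀) δ Hit child) (n : ℕ) :
    ∀ (L Q : Node d) (w : ℝ), IsValid c L → IsAncestor c L Q → Q.1 < L.1 + n → 0 ≤ w → w ≤ 1 →
      w ≤ (c : ℝ) ^ (2 * ∑ i, vecEntropy (π i) - L.1 * ((∑ i, vecEntropy (π i)) / δ) +
        2 * gaugeLevel c φ L.1) →
      w * (Measure.infinitePi fun _ : ℕ => balancedLaw π n₀).real (enters c Hit child N L Q) ≤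
        2 * 3 ^ d * (c : ℝ) ^ (n₀ * ∑ i, vecEntropy (π i)) *
          (c : ℝ) ^ (2 * ∑ i, vecEntropy (π i) - Q.1 * ((∑ i, vecEntropy (π i)) / δ) +
            3 * gaugeLevel c φ Q.1) := by
  have hc1 : (1 : ℝ) < c := by exact_mod_cast (by omega : 1 < c)
  have hc0 : 0 < c := by omega
  have hβ := sum_vecEntropy_nonneg hc hπ
  have hP := h.isProbabilityMeasure hπ
  set β := ∑ i, vecEntropy (π i) with hβdef
  have hβδ : β / δ ≤ β := div_le_self hβ hδ
  have hβδ0 : 0 ≤ β / δ := div_nonneg hβ (by linarith)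
  have h23 : (1 : ℝ) ≤ 2 * 3 ^ d := by
    have : (1 : ℝ) ≤ 3 ^ d := one_le_pow₀ (by norm_num)
    linarith
  have hweak : ∀ a e : ℝ, ∀ t : ℕ, e ≤ a → (c : ℝ) ^ (2 * β - t * (β / δ) + e) ≤
      2 * 3 ^ d * (c : ℝ) ^ (n₀ * β) * (c : ℝ) ^ (2 * β - t * (β / δ) + a) := by
    intro a e t hea
    have h1 : (1 : ℝ) ≤ (c : ℝ) ^ (n₀ * β) := Real.one_le_rpow hc1.le (by positivity)
    refine (Real.rpow_le_rpow_of_exponent_le hc1.le (by linarith)).trans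
      (le_mul_of_one_le_left (by positivity) ?_)
    nlinarith
  induction n with
  | zero =>
    intro L Q w _ hLQ hlt
    exact absurd hLQ.1 (by omega)
  | succ n ih =>
    intro L Q w hL hLQ hlt hw0 hw1 hw
    obtain ⟨b, k, hk, rfl⟩ := exists_eq_relNode hc0 hLQ
    have hQ1 : ((relNode c L b k).1 : ℝ) = L.1 + b := by simp [relNode]
    have hQ1' : (relNode c L b k).1 = L.1 + b := rfl
    have hg0 := h.gaugeLevel_nonneg (c := c) (relNode c L b k).1
    have hgL : gaugeLevel c φ L.1 ≤ gaugeLevel c φ (relNode c L b k).1 := h.monotone hLQ.1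
    -- Mass estimates inside `L` start at relative generation `n₀`. For smaller gaps the bound on
    -- `w` suffices up to the factor `c^(n₀ β)`.
    by_cases hb : b ≤ n₀ ∨ b = 0
    · have hbn : (b : ℝ) ≤ n₀ := by
        rcases hb with hb | hb
        · exact_mod_cast hb
        · rw [hb]; simp
      refine (mul_le_of_le_one_right hw0 measureReal_le_one).trans (hw.trans ?_)
      have h1 : (c : ℝ) ^ (2 * β - L.1 * (β / δ) + 2 * gaugeLevel c φ L.1) ≤
          (c : ℝ) ^ (n₀ * β) * (c : ℝ) ^ (2 * β - (relNode c L b k).1 * (β / δ) +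
            3 * gaugeLevel c φ (relNode c L b k).1) := by
        rw [← Real.rpow_add (by linarith)]
        refine Real.rpow_le_rpow_of_exponent_le hc1.le ?_
        have h2 : (b : ℝ) * (β / δ) ≤ n₀ * β := mul_le_mul hbn hβδ hβδ0 (by positivity)
        rw [hQ1]
        linarith
      refine h1.trans ?_
      rw [mul_assoc]
      exact le_mul_of_one_le_left (by positivity) h23
    push Not at hb
    have hlt' : L.1 < (relNode c L b k).1 := by omega
    by_cases hstep : ∃ y ∈ balancedFrom π n₀,
        IsAncestor c (child (selNode c Hit N L y)) (relNode c L b k)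
    · obtain ⟨y, hy, hyQ⟩ := hstep
      have hHit := H.hit_selNode (N := N) hL hy
      have hlev := H.level_lt_step hN.one_le hL hy
      -- The new weight is `w` times the probability of the selection. Its bound uses only the
      -- second factor, as `w ≤ 1`, so constants do not accumulate along the path.
      refine (mul_le_mul_of_nonneg_left (h.real_enters_le_mul hc0 hπ H hL hlt' hy hyQ) hw0).trans ?_
      rw [← mul_assoc]
      refine ih _ _ _ (H.isValid_child _ hHit) hyQ (by omega) (by positivity)
        (mul_le_one₀ hw1 measureReal_nonneg measureReal_le_one) ?_
      refine (mul_le_of_le_one_left measureReal_nonneg hw1).trans ?_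
      exact (h.balancedLaw_selNode_le hN hc hπ H hL hy).trans
        (rpow_level_le h hc hπ hδ (H.isAncestor_child _ hHit).1 (H.child_level_le _ hHit))
    push Not at hstep
    by_cases hsel : ∃ y ∈ balancedFrom π n₀,
        IsAncestor c (selNode c Hit N L y) (relNode c L b k)
    · obtain ⟨y, hy, hyQ⟩ := hsel
      refine (mul_le_of_le_one_left measureReal_nonneg hw1).trans ?_
      refine (h.real_enters_le_of_selNode hN hc hπ hδ H hL hlt' hy hyQ (hstep y hy)).trans ?_
      exact hweak _ _ _ (by linarith)
    push Not at hsel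
    -- Here both factors count: `w` brings the generation of `L` and two `gaugeLevel`, the estimate
    -- inside `L` brings `c^(-bβ) ≤ c^(-bβ/δ)` and a third one.
    refine (mul_le_mul hw (h.real_enters_le_of_not hc hπ H hL hk (by omega) hb.1.le hsel)
      measureReal_nonneg (by positivity)).trans ?_
    have h1 : (c : ℝ) ^ (2 * β - L.1 * (β / δ) + 2 * gaugeLevel c φ L.1) *
        (c : ℝ) ^ (-(b * β) + gaugeLevel c φ b) ≤ (c : ℝ) ^ (n₀ * β) *
          (c : ℝ) ^ (2 * β - (relNode c L b k).1 * (β / δ) +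
            3 * gaugeLevel c φ (relNode c L b k).1) := by
      rw [← Real.rpow_add (by linarith), ← Real.rpow_add (by linarith)]
      refine Real.rpow_le_rpow_of_exponent_le hc1.le ?_
      have h2 : (b : ℝ) * (β / δ) ≤ b * β := mul_le_mul_of_nonneg_left hβδ (by positivity)
      have h3 : gaugeLevel c φ b ≤ gaugeLevel c φ (relNode c L b k).1 := h.monotone (by omega)
      have h4 : (0 : ℝ) ≤ n₀ * β := by positivity
      rw [hQ1]
      linarith
    calc _ = 2 * 3 ^ d * ((c : ℝ) ^ (2 * β - L.1 * (β / δ) + 2 * gaugeLevel c φ L.1) *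
        (c : ℝ) ^ (-(b * β) + gaugeLevel c φ b)) := by ring
      _ ≤ _ := by
        rw [mul_assoc (2 * 3 ^ d : ℝ)]
        exact mul_le_mul_of_nonneg_left h1 (by positivity)

/-- The mass that the random path starting at the root gives to a box. -/
theorem IsControlled.real_enters_root_le (h : IsControlled π φ n₀) (hN : IsLate π φ n₀ N)
    (hc : 2 ≤ c) (hπ : ∀ i, IsPosProb (π i)) (hδ : 1 ≤ δ)
    (H : IsUbiquitous c (balancedFrom π n₀) δ Hit child) {Q : Node d} (hQ : IsValid c Q) :
    (Measure.infinitePi fun _ : ℕ => balancedLaw π n₀).real (enters c Hit child N (0, 0) Q) ≤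
      2 * 3 ^ d * (c : ℝ) ^ (n₀ * ∑ i, vecEntropy (π i)) *
        (c : ℝ) ^ (2 * ∑ i, vecEntropy (π i) - Q.1 * ((∑ i, vecEntropy (π i)) / δ) +
          3 * gaugeLevel c φ Q.1) := by
  have hc1 : (1 : ℝ) < c := by exact_mod_cast (by omega : 1 < c)
  have := h.mul_enters_le hN hc hπ hδ H (Q.1 + 1) (0, 0) Q 1 (fun i => by simp)
    (isAncestor_root hQ) (by simp) zero_le_one le_rfl (Real.one_le_rpow hc1.le (by
      have := sum_vecEntropy_nonneg hc hπ
      have := h.gaugeLevel_nonneg (c := c) 0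
      simp only [Nat.cast_zero, zero_mul]
      linarith))
  simpa only [one_mul] using this

end PathMass

/-! ### The limit point of a random path -/

section PathPoint

variable {d c n₀ : ℕ} {π : Fin d → Fin c → ℝ} {φ : ℝ → ℝ} {δ : ℝ} {E : Set (Fin d → ℝ)}
  {Hit : Node d → Prop} {child : Node d → Node d} {N : ℕ → ℕ}

/-- The closure of the box of index `Q`. -/
def closedBox (c : ℕ) (Q : Node d) : Set (Fin d → ℝ) :=
  {x | ∀ i, (Q.2 i : ℝ) / (c : ℝ) ^ Q.1 ≤ x i ∧ x i ≤ ((Q.2 i : ℝ) + 1) / (c : ℝ) ^ Q.1}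

theorem IsAncestor.div_pow_le {L Q : Node d} (hc : 0 < c) (h : IsAncestor c L Q) (i : Fin d) :
    (L.2 i : ℝ) / (c : ℝ) ^ L.1 ≤ (Q.2 i : ℝ) / (c : ℝ) ^ Q.1 := by
  have hc' : (0 : ℝ) < c := by exact_mod_cast hc
  have h1 : (c : ℝ) ^ Q.1 = (c : ℝ) ^ (Q.1 - L.1) * (c : ℝ) ^ L.1 := by
    rw [← pow_add, Nat.sub_add_cancel h.1]
  have h2 : (L.2 i : ℝ) * (c : ℝ) ^ (Q.1 - L.1) ≤ Q.2 i := by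
    rw [← h.2 i]; exact_mod_cast Nat.div_mul_le_self _ _
  rw [h1, ← div_div]
  gcongr
  rwa [le_div_iff₀ (by positivity)]

theorem IsAncestor.add_one_div_pow_le {L Q : Node d} (hc : 0 < c) (h : IsAncestor c L Q)
    (i : Fin d) :
    ((Q.2 i : ℝ) + 1) / (c : ℝ) ^ Q.1 ≤ ((L.2 i : ℝ) + 1) / (c : ℝ) ^ L.1 := by
  have hc' : (0 : ℝ) < c := by exact_mod_cast hc
  have h1 : (c : ℝ) ^ Q.1 = (c : ℝ) ^ (Q.1 - L.1) * (c : ℝ) ^ L.1 := by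
    rw [← pow_add, Nat.sub_add_cancel h.1]
  have h2 : (Q.2 i : ℝ) + 1 ≤ (L.2 i + 1) * (c : ℝ) ^ (Q.1 - L.1) := by
    rw [← h.2 i]
    have := Nat.lt_div_mul_add (a := Q.2 i) (b := c ^ (Q.1 - L.1)) (by positivity)
    have h3 : Q.2 i + 1 ≤ (Q.2 i / c ^ (Q.1 - L.1) + 1) * c ^ (Q.1 - L.1) := by
      rw [add_mul, one_mul]; exact this
    exact_mod_cast h3
  rw [h1, ← div_div]
  gcongr
  rwa [div_le_iff₀ (by positivity)]

theorem IsAncestor.closedBox_subset {L Q : Node d} (hc : 0 < c) (h : IsAncestor c L Q) :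
    closedBox c Q ⊆ closedBox c L := fun _ hx i =>
  ⟨(h.div_pow_le hc i).trans (hx i).1, (hx i).2.trans (h.add_one_div_pow_le hc i)⟩

/-- The limit of the path that starts at the root. -/
def pathPoint (c : ℕ) (Hit : Node d → Prop) (child : Node d → Node d) (N : ℕ → ℕ)
    (ω : ℕ → Fin d → ℝ) : Fin d → ℝ :=
  fun i => ⨆ s, ((nodePath c Hit child N (0, 0) ω s).2 i : ℝ) /
    (c : ℝ) ^ (nodePath c Hit child N (0, 0) ω s).1

theorem measurable_pathPoint : Measurable (pathPoint c Hit child N) := by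
  refine measurable_pi_lambda _ fun i => Measurable.iSup fun s => ?_
  exact (measurable_of_countable fun L : Node d => (L.2 i : ℝ) / (c : ℝ) ^ L.1).comp
    (measurable_nodePath (c := c) (Hit := Hit) (child := child) (N := N) (0, 0) s)

theorem isValid_root : IsValid c ((0, 0) : Node d) := fun i => by simp

/-- By nestedness every lower corner is below every upper corner. The supremum may touch an upper
face, hence closed boxes. -/
theorem IsUbiquitous.pathPoint_mem (H : IsUbiquitous c E δ Hit child) (hc : 0 < c)
    {ω : ℕ → Fin d → ℝ} (hω : ∀ n, ω n ∈ E) (s : ℕ) :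
    pathPoint c Hit child N ω ∈ closedBox c (nodePath c Hit child N (0, 0) ω s) := by
  have hc' : (0 : ℝ) < c := by exact_mod_cast hc
  have key : ∀ r s i, ((nodePath c Hit child N (0, 0) ω r).2 i : ℝ) /
      (c : ℝ) ^ (nodePath c Hit child N (0, 0) ω r).1 ≤
        ((nodePath c Hit child N (0, 0) ω s).2 i + 1) /
          (c : ℝ) ^ (nodePath c Hit child N (0, 0) ω s).1 := by
    intro r s i
    refine ((H.isAncestor_nodePath hc isValid_root hω (le_max_left r s)).div_pow_le hc i).trans
      (le_trans ?_ ((H.isAncestor_nodePath hc isValid_root hω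
        (le_max_right r s)).add_one_div_pow_le hc i))
    gcongr
    linarith
  intro i
  exact ⟨le_ciSup (f := fun s => ((nodePath c Hit child N (0, 0) ω s).2 i : ℝ) /
    (c : ℝ) ^ (nodePath c Hit child N (0, 0) ω s).1) ⟨_, Set.forall_mem_range.2 fun r => key r 0 i⟩ s,
    ciSup_le fun r => key r s i⟩

/-- The indices of the boxes of generation `t` that may contain points at distance at most
`c⁻ᵗ` from `z`. -/
def nearIndices (c : ℕ) (z : Fin d → ℝ) (t : ℕ) : Finset (Fin d → ℕ) :=
  (Fintype.piFinset fun i => Finset.Icc (⌊(c : ℝ) ^ t * z i⌋ - 2).toNat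
    (⌊(c : ℝ) ^ t * z i⌋ + 1).toNat).filter fun κ => ∀ i, κ i < c ^ t

theorem card_nearIndices_le (z : Fin d → ℝ) (t : ℕ) : (nearIndices c z t).card ≤ 4 ^ d := by
  refine (Finset.card_filter_le _ _).trans ?_
  rw [Fintype.card_piFinset]
  calc _ ≤ ∏ _i : Fin d, 4 := Finset.prod_le_prod' fun i _ => by rw [Nat.card_Icc]; omega
    _ = 4 ^ d := by simp

/-- After `t` steps the path is at generation at least `t`; the ancestor of generation `t` of its
box has been entered, and its closure contains the limit point. -/
theorem IsUbiquitous.mem_enters_of_mem_closedBall (H : IsUbiquitous c E δ Hit child) (hc : 0 < c)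
    (hN : ∀ a, 1 ≤ N a) {ω : ℕ → Fin d → ℝ} (hω : ∀ n, ω n ∈ E) {z : Fin d → ℝ} {r : ℝ} {t : ℕ}
    (hr : r ≤ ((c : ℝ) ^ t)⁻¹) (hX : pathPoint c Hit child N ω ∈ Metric.closedBall z r) :
    ∃ κ ∈ nearIndices c z t, ω ∈ enters c Hit child N (0, 0) (t, κ) := by
  have hc' : (0 : ℝ) < c := by exact_mod_cast hc
  set M := nodePath c Hit child N (0, 0) ω t with hM
  have hlev : t ≤ M.1 := H.le_level_nodePath hN isValid_root hω t
  have hanc : IsAncestor c (t, fun i => M.2 i / c ^ (M.1 - t)) M := ⟨hlev, fun _ => rfl⟩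
  refine ⟨_, ?_, t, hanc⟩
  have hval := hanc.isValid hc (H.isValid_nodePath isValid_root hω t)
  have hbox := hanc.closedBox_subset hc (H.pathPoint_mem (N := N) hc hω t)
  simp only [nearIndices, Finset.mem_filter, Fintype.mem_piFinset, Finset.mem_Icc]
  refine ⟨fun i => ?_, hval⟩
  have hp : (0 : ℝ) < (c : ℝ) ^ t := by positivity
  have h1 := (div_le_iff₀ hp).1 (hbox i).1
  have h2 := (le_div_iff₀ hp).1 (hbox i).2
  have h3 : |pathPoint c Hit child N ω i - z i| ≤ ((c : ℝ) ^ t)⁻¹ := by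
    rw [← Real.dist_eq]
    exact (dist_le_pi_dist _ _ i).trans ((Metric.mem_closedBall.1 hX).trans hr)
  rw [abs_le] at h3
  have h4 : (pathPoint c Hit child N ω i - z i) * (c : ℝ) ^ t ≤ 1 := by
    have := mul_le_mul_of_nonneg_right h3.2 hp.le
    rwa [inv_mul_cancel₀ hp.ne'] at this
  have h5 : -1 ≤ (pathPoint c Hit child N ω i - z i) * (c : ℝ) ^ t := by
    have := mul_le_mul_of_nonneg_right h3.1 hp.le
    rwa [neg_mul, inv_mul_cancel₀ hp.ne'] at this
  simp only at h1 h2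
  generalize M.2 i / c ^ (M.1 - t) = κ at *
  -- The scaled limit point is in `[κ, κ + 1]` and within `1` of the scaled `z i`, which leaves four
  -- values of `κ`.
  have h6 : ((κ : ℤ) - 1) ≤ ⌊(c : ℝ) ^ t * z i⌋ := by
    rw [Int.le_floor]; push_cast; linarith
  have h7 : ⌊(c : ℝ) ^ t * z i⌋ ≤ (κ : ℤ) + 2 := by
    have : (⌊(c : ℝ) ^ t * z i⌋ : ℝ) ≤ ((κ + 2 : ℤ) : ℝ) := by
      refine (Int.floor_le _).trans ?_
      push_cast
      linarith
    exact_mod_cast this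
  omega

/-- The law of the limit point of the random path. -/
def pathLaw (π : Fin d → Fin c → ℝ) (n₀ : ℕ) (Hit : Node d → Prop) (child : Node d → Node d)
    (N : ℕ → ℕ) : Measure (Fin d → ℝ) :=
  (Measure.infinitePi fun _ : ℕ => balancedLaw π n₀).map (pathPoint c Hit child N)

theorem IsControlled.isProbabilityMeasure_pathLaw (h : IsControlled π φ n₀)
    (hπ : ∀ i, IsPosProb (π i)) : IsProbabilityMeasure (pathLaw π n₀ Hit child N) := by
  have := h.isProbabilityMeasure hπ
  exact Measure.isProbabilityMeasure_map measurable_pathPoint.aemeasurable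

/-- Almost surely the limit point lies in the closed child of a selected box of arbitrarily large
generation. The general inequality for image measures spares the measurability of `S`. -/
theorem IsControlled.pathLaw_pos (h : IsControlled π φ n₀) (hN : ∀ a, 1 ≤ N a) (hc : 0 < c)
    (hπ : ∀ i, IsPosProb (π i)) (H : IsUbiquitous c (balancedFrom π n₀) δ Hit child)
    {S : Set (Fin d → ℝ)} (hS : ∀ x, (∀ n : ℕ, ∃ J : Node d, n ≤ J.1 ∧ Hit J ∧
      x ∈ closedBox c (child J)) → x ∈ S) : 0 < pathLaw π n₀ Hit child N S := by
  have hP := h.isProbabilityMeasure hπ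
  refine lt_of_lt_of_le ?_ (Measure.le_map_apply measurable_pathPoint.aemeasurable S)
  have h1 : (1 : ℝ≥0∞) ≤ Measure.infinitePi (fun _ : ℕ => balancedLaw π n₀)
      (pathPoint c Hit child N ⁻¹' S) := by
    rw [← measure_univ (μ := Measure.infinitePi fun _ : ℕ => balancedLaw π n₀)]
    refine measure_mono_ae ?_
    filter_upwards [h.ae_forall_mem hπ] with ω hω _
    refine hS _ fun n => ?_
    have hL := H.isValid_nodePath (N := N) isValid_root hω n
    refine ⟨selNode c Hit N (nodePath c Hit child N (0, 0) ω n) (ω n), ?_,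
      H.hit_selNode hL (hω n), ?_⟩
    · exact (H.le_level_nodePath hN isValid_root hω n).trans
        (H.level_lt_selNode hN hL (hω n)).le
    · have := H.pathPoint_mem (N := N) hc hω (n + 1)
      rwa [nodePath_succ] at this
  exact one_pos.trans_le h1

theorem IsControlled.pathLaw_closedBall_le (h : IsControlled π φ n₀) (hN : IsLate π φ n₀ N)
    (hc : 2 ≤ c) (hπ : ∀ i, IsPosProb (π i)) (hδ : 1 ≤ δ)
    (H : IsUbiquitous c (balancedFrom π n₀) δ Hit child) (z : Fin d → ℝ) {r : ℝ} {t : ℕ}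
    (hr : r ≤ ((c : ℝ) ^ t)⁻¹) :
    pathLaw π n₀ Hit child N (Metric.closedBall z r) ≤ ENNReal.ofReal
      (4 ^ d * (2 * 3 ^ d * (c : ℝ) ^ (n₀ * ∑ i, vecEntropy (π i)) *
        (c : ℝ) ^ (2 * ∑ i, vecEntropy (π i) - t * ((∑ i, vecEntropy (π i)) / δ) +
          3 * gaugeLevel c φ t))) := by
  have hP := h.isProbabilityMeasure hπ
  have hc0 : 0 < c := by omega
  rw [pathLaw, Measure.map_apply measurable_pathPoint Metric.isClosed_closedBall.measurableSet]
  have h1 : Measure.infinitePi (fun _ : ℕ => balancedLaw π n₀)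
      (pathPoint c Hit child N ⁻¹' Metric.closedBall z r) ≤
      Measure.infinitePi (fun _ : ℕ => balancedLaw π n₀)
        (⋃ κ ∈ nearIndices c z t, enters c Hit child N (0, 0) (t, κ)) := by
    refine measure_mono_ae ?_
    filter_upwards [h.ae_forall_mem hπ] with ω hω hX
    obtain ⟨κ, hκ, hmem⟩ := H.mem_enters_of_mem_closedBall hc0 hN.one_le hω hr hX
    exact Set.mem_biUnion hκ hmem
  refine h1.trans ((measure_biUnion_finset_le _ _).trans ?_)
  refine (Finset.sum_le_card_nsmul _ _ (ENNReal.ofReal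
    (2 * 3 ^ d * (c : ℝ) ^ (n₀ * ∑ i, vecEntropy (π i)) *
        (c : ℝ) ^ (2 * ∑ i, vecEntropy (π i) - t * ((∑ i, vecEntropy (π i)) / δ) +
          3 * gaugeLevel c φ t))) fun κ hκ => ?_).trans ?_
  · rw [← ENNReal.ofReal_toReal (measure_ne_top _ (enters c Hit child N (0, 0) (t, κ)))]
    exact ENNReal.ofReal_le_ofReal
      (h.real_enters_root_le hN hc hπ hδ H (Q := (t, κ)) (Finset.mem_filter.1 hκ).2)
  · rw [nsmul_eq_mul, ENNReal.ofReal_mul (p := 4 ^ d) (by positivity),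
      ENNReal.ofReal_pow (by norm_num),
      ENNReal.ofReal_ofNat]
    exact mul_le_mul_left (by exact_mod_cast card_nearIndices_le z t) _

/-- With `c⁻ᵗ` comparable to `r`, the power `β / δ` changes by a constant factor and `hanti`
compares the gauges at `c⁻ᵗ` and `r`. The bound is uniform in `z` and `r ≤ 1`, and uses the multiple
`3 ≤ 4 + d` of the gauge. -/
theorem IsControlled.limsup_pathLaw_lt_top (h : IsControlled π φ n₀) (hN : IsLate π φ n₀ N)
    (hc : 2 ≤ c) (hπ : ∀ i, IsPosProb (π i)) (hδ : 1 ≤ δ)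
    (H : IsUbiquitous c (balancedFrom π n₀) δ Hit child)
    (hanti : AntitoneOn (fun r : ℝ => r ^ (-φ r)) (Set.Ioc 0 1)) (z : Fin d → ℝ) :
    limsup (fun r : ℝ => pathLaw π n₀ Hit child N (Metric.closedBall z r) /
      ENNReal.ofReal (r ^ ((∑ i, vecEntropy (π i)) / δ - (4 + (d : ℝ)) * φ r))) (𝓝[>] 0) < ∞ := by
  have hc1 : (1 : ℝ) < c := by exact_mod_cast (by omega : 1 < c)
  have hc0 : (0 : ℝ) < c := by linarith
  have hβ := sum_vecEntropy_nonneg hc hπ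
  set β := ∑ i, vecEntropy (π i) with hβdef
  have hβδ0 : 0 ≤ β / δ := div_nonneg hβ (by linarith)
  refine lt_of_le_of_lt (b := ENNReal.ofReal (4 ^ d * (2 * 3 ^ d * (c : ℝ) ^ (n₀ * β) *
    (c : ℝ) ^ (2 * β + β / δ)))) (limsup_le_of_le (by isBoundedDefault) ?_) ENNReal.ofReal_lt_top
  filter_upwards [Ioc_mem_nhdsGT (zero_lt_one (α := ℝ))] with r hr
  set t := ⌊Real.logb c r⁻¹⌋₊ with ht
  have hlog : 0 ≤ Real.logb c r⁻¹ := Real.logb_nonneg hc1 ((one_le_inv₀ hr.1).2 hr.2)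
  have hct : (c : ℝ) ^ t ≤ r⁻¹ := by
    rw [← Real.rpow_natCast, ← Real.le_logb_iff_rpow_le hc1 (inv_pos.2 hr.1)]
    exact Nat.floor_le hlog
  have hct' : r⁻¹ ≤ c * (c : ℝ) ^ t := by
    have : r⁻¹ ≤ (c : ℝ) ^ ((t : ℝ) + 1) := by
      rw [← Real.logb_le_iff_le_rpow hc1 (inv_pos.2 hr.1)]
      exact (Nat.lt_floor_add_one _).le
    rwa [Real.rpow_add_one hc0.ne', Real.rpow_natCast, mul_comm] at this
  have hrt : r ≤ ((c : ℝ) ^ t)⁻¹ := by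
    rwa [le_inv_comm₀ hr.1 (by positivity)]
  have htr : ((c : ℝ) ^ t)⁻¹ ≤ c * r := by
    rw [inv_le_iff_one_le_mul₀ hr.1] at hct'
    rw [inv_le_iff_one_le_mul₀ (by positivity)]
    linarith
  refine ENNReal.div_le_of_le_mul ((h.pathLaw_closedBall_le hN hc hπ hδ H z hrt).trans ?_)
  rw [← ENNReal.ofReal_mul (by positivity)]
  refine ENNReal.ofReal_le_ofReal ?_
  generalize hA : 2 * 3 ^ d * (c : ℝ) ^ (n₀ * β) = A
  have hA0 : 0 ≤ 4 ^ d * A := by rw [← hA]; positivity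
  rw [← mul_assoc, ← mul_assoc, mul_assoc (4 ^ d * A)]
  refine mul_le_mul_of_nonneg_left ?_ hA0
  have h1 : ((c : ℝ) ^ t)⁻¹ = (c : ℝ) ^ (-t : ℝ) := by
    rw [Real.rpow_neg hc0.le, Real.rpow_natCast]
  have h2 : (c : ℝ) ^ (-(t * (β / δ))) ≤ (c : ℝ) ^ (β / δ) * r ^ (β / δ) := by
    rw [← Real.mul_rpow hc0.le hr.1.le]
    refine le_trans (le_of_eq ?_) (Real.rpow_le_rpow (by positivity) htr hβδ0)
    rw [h1, ← Real.rpow_mul hc0.le]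
    ring_nf
  have h3 : (c : ℝ) ^ (gaugeLevel c φ t) ≤ r ^ (-φ r) := by
    have hmem : ((c : ℝ) ^ t)⁻¹ ∈ Set.Ioc (0 : ℝ) 1 :=
      ⟨inv_pos.2 (pow_pos hc0 t), inv_le_one_of_one_le₀ (one_le_pow₀ hc1.le)⟩
    refine le_trans (le_of_eq ?_) (hanti hr hmem hrt)
    change _ = (((c : ℝ) ^ t)⁻¹) ^ (-φ ((c : ℝ) ^ t)⁻¹)
    nth_rw 1 [h1]
    rw [← Real.rpow_mul hc0.le, gaugeLevel]
    ring_nf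
  have h4 : (c : ℝ) ^ (3 * gaugeLevel c φ t) ≤ r ^ (-((4 + (d : ℝ)) * φ r)) := by
    calc (c : ℝ) ^ (3 * gaugeLevel c φ t) = ((c : ℝ) ^ (gaugeLevel c φ t)) ^ (3 : ℝ) := by
          rw [← Real.rpow_mul hc0.le, mul_comm]
      _ ≤ (r ^ (-φ r)) ^ (3 : ℝ) := Real.rpow_le_rpow (by positivity) h3 (by norm_num)
      _ = r ^ (-(3 * φ r)) := by rw [← Real.rpow_mul hr.1.le]; ring_nf
      _ ≤ _ := by
        refine Real.rpow_le_rpow_of_exponent_ge hr.1 hr.2 ?_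
        have := h.nonneg r
        have : (0 : ℝ) ≤ d := Nat.cast_nonneg d
        nlinarith
  calc (c : ℝ) ^ (2 * β - t * (β / δ) + 3 * gaugeLevel c φ t)
      = (c : ℝ) ^ (2 * β) * ((c : ℝ) ^ (-(t * (β / δ))) * (c : ℝ) ^ (3 * gaugeLevel c φ t)) := by
        rw [← Real.rpow_add hc0, ← Real.rpow_add hc0]; ring_nf
    _ ≤ (c : ℝ) ^ (2 * β) * (((c : ℝ) ^ (β / δ) * r ^ (β / δ)) *
          r ^ (-((4 + (d : ℝ)) * φ r))) := by
        have := Real.rpow_nonneg hr.1.le (β / δ)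
        gcongr
    _ = _ := by
        rw [Real.rpow_add hc0, sub_eq_add_neg, Real.rpow_add hr.1]; ring

end PathPoint

/-! ### Digits of the points of `[0,1]` -/

section DigitPrefix

variable {d c : ℕ}

/-- The integer whose expansion is the word of the first `j` digits of `x`. -/
def digitPrefix (c j : ℕ) (x : ℝ) : ℕ := min ⌊(c : ℝ) ^ j * x⌋₊ (c ^ j - 1)

theorem digitPrefix_lt (hc : 0 < c) (j : ℕ) (x : ℝ) : digitPrefix c j x < c ^ j := by
  have : 0 < c ^ j := by positivity
  exact (min_le_right _ _).trans_lt (by omega)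

theorem digitPrefix_of_lt (hc : 0 < c) (j : ℕ) {x : ℝ} (hx : x ∈ Set.Ico 0 1) :
    digitPrefix c j x = ⌊(c : ℝ) ^ j * x⌋₊ := by
  have := floor_pow_mul_lt hc hx (j := j)
  exact min_eq_left (by omega)

theorem digitPrefix_one (j : ℕ) : digitPrefix c j 1 = c ^ j - 1 := by
  have : ⌊(c : ℝ) ^ j * 1⌋₊ = c ^ j := by
    rw [mul_one]; exact_mod_cast Nat.floor_natCast (R := ℝ) (c ^ j)
  rw [digitPrefix, this]
  exact min_eq_right (Nat.sub_le _ _)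

theorem digitPrefix_div (hc : 0 < c) (a b : ℕ) {x : ℝ} (hx : x ∈ Set.Icc 0 1) :
    digitPrefix c (a + b) x / c ^ b = digitPrefix c a x := by
  rcases hx.2.lt_or_eq with h1 | rfl
  · rw [digitPrefix_of_lt hc _ ⟨hx.1, h1⟩, digitPrefix_of_lt hc _ ⟨hx.1, h1⟩]
    exact boxIndex_div hc a b (fun _ : Fin 1 => x) 0
  · rw [digitPrefix_one, digitPrefix_one, pow_add]
    have ha : 0 < c ^ a := by positivity
    have hb : 0 < c ^ b := by positivity
    obtain ⟨A, hA⟩ := Nat.exists_eq_succ_of_ne_zero ha.ne'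
    have h2 : c ^ a * c ^ b - 1 = (c ^ b - 1) + A * c ^ b := by
      rw [hA, Nat.succ_mul]; omega
    rw [h2, Nat.add_mul_div_right _ _ hb, Nat.div_eq_of_lt (by omega)]
    omega

theorem cDigit_succ (hc : 0 < c) (m : ℕ) {x : ℝ} (hx : x ∈ Set.Icc 0 1) :
    cDigit c (m + 1) x = digitPrefix c (m + 1) x % c := by
  rcases hx.2.lt_or_eq with h1 | rfl
  · rw [digitPrefix_of_lt hc _ ⟨hx.1, h1⟩, cDigit, if_neg h1.ne]
  · rw [digitPrefix_one, cDigit, if_pos rfl, pow_succ]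
    have ha : 0 < c ^ m := by positivity
    obtain ⟨A, hA⟩ := Nat.exists_eq_succ_of_ne_zero ha.ne'
    have h2 : c ^ m * c - 1 = (c - 1) + A * c := by
      rw [hA, Nat.succ_mul]; omega
    rw [h2, Nat.add_mul_mod_self_right, Nat.mod_eq_of_lt (by omega)]

theorem card_filter_cDigit (hc : 0 < c) (t j : ℕ) {x : ℝ} (hx : x ∈ Set.Icc 0 1) :
    ((Finset.Icc 1 j).filter fun m => cDigit c m x = t).card =
      digitCount c t j (digitPrefix c j x) := by
  induction j with
  | zero => simp [digitCount]
  | succ j ih =>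
    have h1 := digitPrefix_div hc j 1 hx
    rw [pow_one] at h1
    have h2 : Finset.Icc 1 (j + 1) = insert (j + 1) (Finset.Icc 1 j) := by
      ext m; simp only [Finset.mem_Icc, Finset.mem_insert]; omega
    rw [h2, Finset.filter_insert, cDigit_succ hc j hx, digitCount, h1, ← ih]
    split_ifs
    · rw [Finset.card_insert_of_notMem (by simp)]
    · rfl

theorem digitFreq_eq (hc : 0 < c) (t j : ℕ) {x : ℝ} (hx : x ∈ Set.Icc 0 1) :
    digitFreq c t j x = (digitCount c t j (digitPrefix c j x) : ℝ) / j := by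
  rw [digitFreq, card_filter_cDigit hc t j hx]

theorem digitPrefix_le_mul (hc : 0 < c) (j : ℕ) {x : ℝ} (hx : 0 ≤ x) :
    (digitPrefix c j x : ℝ) / (c : ℝ) ^ j ≤ x := by
  have hc' : (0 : ℝ) < (c : ℝ) ^ j := pow_pos (by exact_mod_cast hc) j
  rw [div_le_iff₀ hc', mul_comm]
  exact (Nat.cast_le.2 (min_le_left _ _)).trans (Nat.floor_le (by positivity))

theorem le_digitPrefix_add_one (hc : 0 < c) (j : ℕ) {x : ℝ} (hx : x ∈ Set.Icc 0 1) :
    x ≤ ((digitPrefix c j x : ℝ) + 1) / (c : ℝ) ^ j := by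
  have hc' : (0 : ℝ) < (c : ℝ) ^ j := pow_pos (by exact_mod_cast hc) j
  rw [le_div_iff₀ hc', mul_comm]
  rcases hx.2.lt_or_eq with h1 | rfl
  · rw [digitPrefix_of_lt hc _ ⟨hx.1, h1⟩]
    exact (Nat.lt_floor_add_one _).le
  · have : 1 ≤ c ^ j := Nat.one_le_pow _ _ hc
    rw [digitPrefix_one]
    push_cast [this]
    linarith

/-- The covering by balls of radius `lam n / 2` enters here: the prefix of the centre is adjacent to
that of any covered point. -/
theorem abs_digitPrefix_sub_le (hc : 0 < c) (j : ℕ) {x u : ℝ} (hx : 0 ≤ x) (hu : u ∈ Set.Ico 0 1)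
    (hxu : |u - x| ≤ ((c : ℝ) ^ j)⁻¹ / 2) :
    |(digitPrefix c j x : ℤ) - ⌊(c : ℝ) ^ j * u⌋₊| ≤ 1 := by
  have hc' : (0 : ℝ) < (c : ℝ) ^ j := pow_pos (by exact_mod_cast hc) j
  have h1 : |(c : ℝ) ^ j * u - (c : ℝ) ^ j * x| ≤ 1 / 2 := by
    rw [← mul_sub, abs_mul, abs_of_pos hc']
    calc _ ≤ (c : ℝ) ^ j * (((c : ℝ) ^ j)⁻¹ / 2) := by gcongr
      _ = 1 / 2 := by field_simp
  rw [abs_le] at h1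
  have h2 := Nat.floor_le (mul_nonneg hc'.le hx)
  have h3 := Nat.lt_floor_add_one ((c : ℝ) ^ j * x)
  have h4 := Nat.floor_le (mul_nonneg hc'.le hu.1)
  have h5 := Nat.lt_floor_add_one ((c : ℝ) ^ j * u)
  have h6 : ⌊(c : ℝ) ^ j * x⌋₊ < ⌊(c : ℝ) ^ j * u⌋₊ + 2 := by
    have : (⌊(c : ℝ) ^ j * x⌋₊ : ℝ) < (⌊(c : ℝ) ^ j * u⌋₊ + 2 : ℕ) := by push_cast; linarith
    exact_mod_cast this
  have h7 : ⌊(c : ℝ) ^ j * u⌋₊ < ⌊(c : ℝ) ^ j * x⌋₊ + 2 := by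
    have : (⌊(c : ℝ) ^ j * u⌋₊ : ℝ) < (⌊(c : ℝ) ^ j * x⌋₊ + 2 : ℕ) := by push_cast; linarith
    exact_mod_cast this
  have h8 := floor_pow_mul_lt hc hu (j := j)
  rw [abs_le, digitPrefix]
  omega

/-- The closed box of the prefix of a point is contained in a ball centred at this point. -/
theorem closedBox_digitPrefix_subset (hc : 0 < c) (t : ℕ) {x : Fin d → ℝ} (hx : x ∈ Set.Icc 0 1)
    {r : ℝ} (hr : ((c : ℝ) ^ t)⁻¹ ≤ r) :
    closedBox c (t, fun i => digitPrefix c t (x i)) ⊆ Metric.closedBall x r := by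
  have hc' : (0 : ℝ) < c := by exact_mod_cast hc
  intro z hz
  have hr0 : 0 ≤ r := le_trans (by positivity) hr
  rw [Metric.mem_closedBall, dist_pi_le_iff hr0]
  intro i
  have hxi : x i ∈ Set.Icc 0 1 := ⟨hx.1 i, hx.2 i⟩
  have h1 := digitPrefix_le_mul hc t hxi.1
  have h2 := le_digitPrefix_add_one hc t hxi
  have h3 := hz i
  simp only at h3
  rw [add_div, one_div] at h2 h3
  rw [Real.dist_eq, abs_le]
  constructor <;> linarith [h3.1, h3.2]

end DigitPrefix

/-! ### Ubiquity of the balls with typical centres -/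

section Ubiquity

variable {d c n₀ : ℕ} {π : Fin d → Fin c → ℝ} {x : ℕ → Fin d → ℝ} {lam ε : ℕ → ℝ} {δ : ℝ}

/-- The generation of the boxes whose size is comparable to `r`. -/
def radiusLevel (c : ℕ) (r : ℝ) : ℕ := ⌊Real.logb c r⁻¹⌋₊

/-- The error allowed on the frequencies of the first `j` digits. -/
def freqError (j : ℕ) : ℝ := ((j : ℝ) + 1) ^ (-(1 / 4) : ℝ)

theorem freqError_pos (j : ℕ) : 0 < freqError j := by unfold freqError; positivity

theorem antitone_freqError : Antitone freqError := fun i j hij =>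
  Real.rpow_le_rpow_of_nonpos (by positivity) (by gcongr) (by norm_num)

theorem tendsto_freqError : Tendsto freqError atTop (𝓝 0) :=
  (tendsto_rpow_neg_atTop (by norm_num : (0 : ℝ) < 1 / 4)).comp
    (tendsto_atTop_add_const_right _ _ tendsto_natCast_atTop_atTop)

theorem radiusLevel_anti (hc : 2 ≤ c) {r s : ℝ} (hr : 0 < r) (hrs : r ≤ s) :
    radiusLevel c s ≤ radiusLevel c r :=
  Nat.floor_mono (Real.logb_le_logb_of_le (by exact_mod_cast (by omega : 1 < c))
    (inv_pos.2 (hr.trans_le hrs)) (inv_anti₀ hr hrs))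

theorem tendsto_radiusLevel (hc : 2 ≤ c) (hlam : ∀ n, 0 < lam n) (h0 : Tendsto lam atTop (𝓝 0)) :
    Tendsto (fun n => radiusLevel c (lam n)) atTop atTop := by
  refine tendsto_nat_floor_atTop.comp ((Real.tendsto_logb_atTop (by exact_mod_cast
    (by omega : 1 < c))).comp (tendsto_inv_nhdsGT_zero.comp ?_))
  exact tendsto_nhdsWithin_iff.2 ⟨h0, Eventually.of_forall hlam⟩

/-- A crude power is enough: `5/8` is below `3/4`, the growth exponent of `j * freqError j`. -/
theorem lilBound_le_rpow {b : ℕ} (hb : 1 ≤ b) : lilBound b ≤ 2 * (b : ℝ) ^ (5 / 8 : ℝ) := by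
  have hb' : (1 : ℝ) ≤ b := by exact_mod_cast hb
  have h1 : Real.log (Real.log b) ≤ Real.log b :=
    Real.log_le_self (Real.log_nonneg hb')
  have h2 : Real.log b ≤ (b : ℝ) ^ (1 / 4 : ℝ) / (1 / 4) :=
    Real.log_le_rpow_div (by linarith) (by norm_num)
  refine Real.sqrt_le_iff.2 ⟨by positivity, ?_⟩
  calc (b : ℝ) * Real.log (Real.log b) ≤ b * (4 * (b : ℝ) ^ (1 / 4 : ℝ)) := by
        gcongr; linarith
    _ = 4 * ((b : ℝ) ^ (1 : ℝ) * (b : ℝ) ^ (1 / 4 : ℝ)) := by rw [Real.rpow_one]; ring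
    _ = 4 * ((b : ℝ) ^ (5 / 8 : ℝ) * (b : ℝ) ^ (5 / 8 : ℝ)) := by
        rw [← Real.rpow_add (by linarith), ← Real.rpow_add (by linarith)]; norm_num
    _ = _ := by ring

/-- Here `a` is the number of digits imposed by the address of a box. It is eventually at most
`b^(3/4) / 4`, as is `7 * 2 * b^(5/8)`, whence `4` and `56`; together they stay below `b^(3/4) / 2`.
-/
theorem eventually_add_lilBound_le (a : ℕ) : ∀ᶠ b : ℕ in atTop,
    a + 7 * lilBound b ≤ (a + b : ℕ) * freqError (a + b) := by
  have h1 := ((tendsto_rpow_atTop (by norm_num : (0 : ℝ) < 3 / 4)).comp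
    tendsto_natCast_atTop_atTop).eventually_ge_atTop (4 * a : ℝ)
  have h2 := ((tendsto_rpow_atTop (by norm_num : (0 : ℝ) < 1 / 8)).comp
    tendsto_natCast_atTop_atTop).eventually_ge_atTop (56 : ℝ)
  filter_upwards [h1, h2, eventually_ge_atTop 1] with b h1 h2 hb
  simp only [Function.comp] at h1 h2
  have hb' : (1 : ℝ) ≤ b := by exact_mod_cast hb
  have h3 := lilBound_le_rpow hb
  have h4 : 56 * (b : ℝ) ^ (5 / 8 : ℝ) ≤ (b : ℝ) ^ (3 / 4 : ℝ) := by
    calc _ ≤ (b : ℝ) ^ (1 / 8 : ℝ) * (b : ℝ) ^ (5 / 8 : ℝ) := by gcongr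
      _ = _ := by rw [← Real.rpow_add (by linarith)]; norm_num
  have h5 : (b : ℝ) ^ (3 / 4 : ℝ) / 2 ≤ (a + b : ℕ) * freqError (a + b) := by
    set s : ℝ := ((a + b : ℕ) : ℝ) with hs
    have hbs : (b : ℝ) ≤ s := by rw [hs]; push_cast; linarith [Nat.cast_nonneg (α := ℝ) a]
    have hs1 : 1 ≤ s := hb'.trans hbs
    have h6 : s ^ (-(1 / 4) : ℝ) / 2 ≤ freqError (a + b) := by
      calc s ^ (-(1 / 4) : ℝ) / 2 ≤ s ^ (-(1 / 4) : ℝ) * 2 ^ (-(1 / 4) : ℝ) := by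
            rw [div_eq_mul_inv, ← Real.rpow_neg_one]
            gcongr
            · norm_num
            · norm_num
        _ = (s * 2) ^ (-(1 / 4) : ℝ) := (Real.mul_rpow (by linarith) (by norm_num)).symm
        _ ≤ freqError (a + b) :=
            Real.rpow_le_rpow_of_nonpos (by linarith) (by linarith) (by norm_num)
    calc (b : ℝ) ^ (3 / 4 : ℝ) / 2 ≤ s ^ (3 / 4 : ℝ) / 2 := by gcongr
      _ = s * (s ^ (-(1 / 4) : ℝ) / 2) := by
        rw [← mul_div_assoc, ← Real.rpow_one_add' (by linarith) (by norm_num)]; norm_num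
      _ ≤ s * freqError (a + b) := by gcongr
  linarith

/-- The ball of index `n` is typical, and `J` is the index of a box of comparable size around its
centre. -/
def IsTypicalAt (π : Fin d → Fin c → ℝ) (x : ℕ → Fin d → ℝ) (lam ε : ℕ → ℝ) (J : Node d)
    (n : ℕ) : Prop :=
  lam n ≤ 1 ∧ radiusLevel c (lam n) = J.1 ∧ (fun i => digitPrefix c J.1 (x n i)) = J.2 ∧
    DigitCondition π (x n) (lam n) (ε n)

open Classical in
/-- The index of a box contained in the contracted ball attached to `J`. -/
def contractedNode (π : Fin d → Fin c → ℝ) (x : ℕ → Fin d → ℝ) (lam ε : ℕ → ℝ) (δ : ℝ)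
    (J : Node d) : Node d :=
  if h : ∃ n, IsTypicalAt π x lam ε J n then
    (⌈δ * Real.logb c (lam h.choose)⁻¹⌉₊,
      fun i => digitPrefix c ⌈δ * Real.logb c (lam h.choose)⁻¹⌉₊ (x h.choose i))
  else J

theorem exists_contractedNode_eq {J : Node d} (h : ∃ n, IsTypicalAt π x lam ε J n) :
    ∃ n, IsTypicalAt π x lam ε J n ∧ contractedNode π x lam ε δ J =
      (⌈δ * Real.logb c (lam n)⁻¹⌉₊, fun i => digitPrefix c ⌈δ * Real.logb c (lam n)⁻¹⌉₊ (x n i)) :=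
  ⟨h.choose, h.choose_spec, dif_pos h⟩

theorem logb_inv_nonneg (hc : 2 ≤ c) {r : ℝ} (hr : 0 < r) (hr1 : r ≤ 1) :
    0 ≤ Real.logb c r⁻¹ :=
  Real.logb_nonneg (by exact_mod_cast (by omega : 1 < c)) ((one_le_inv₀ hr).2 hr1)

theorem pow_radiusLevel_le (hc : 2 ≤ c) {r : ℝ} (hr : 0 < r) (hr1 : r ≤ 1) :
    r ≤ ((c : ℝ) ^ radiusLevel c r)⁻¹ := by
  have hc1 : (1 : ℝ) < c := by exact_mod_cast (by omega : 1 < c)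
  rw [le_inv_comm₀ hr (by positivity), ← Real.rpow_natCast,
    ← Real.le_logb_iff_rpow_le hc1 (inv_pos.2 hr)]
  exact Nat.floor_le (logb_inv_nonneg hc hr hr1)

/-- The first `a` digits are arbitrary and perturb each count by at most `a`; the other `b` form a
neighbour of a prefix of a balanced point. -/
theorem digitCondition_of_balanced (hc : 0 < c) (hπ : ∀ i, IsPosProb (π i)) {a b : ℕ} (hb : n₀ ≤ b)
    {y : Fin d → ℝ} (hy : y ∈ balancedFrom π n₀) {l k : Fin d → ℕ} (hk : IsNeighbor c b y k)
    {z : Fin d → ℝ} (hz : z ∈ Set.Icc 0 1)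
    (hprefix : (fun i => digitPrefix c (a + b) (z i)) = fun i => l i * c ^ b + k i) {e r : ℝ}
    (hr : radiusLevel c r = a + b) (he : a + 7 * lilBound b ≤ (a + b : ℕ) * e) (hab : 0 < a + b) :
    DigitCondition π z r e := by
  intro i t
  change |digitFreq c t (radiusLevel c r) (z i) - π i t| ≤ e
  have hab' : (0 : ℝ) < (a + b : ℕ) := by exact_mod_cast hab
  rw [hr, digitFreq_eq hc t _ ⟨hz.1 i, hz.2 i⟩, congrFun hprefix i,
    digitCount_add hc t a b (l i) (k i) (hk.1 i)]
  have h1 := (hy b hb i).2.2 (k i) (hk.2 i) t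
  have h2 : |(digitCount c t a (l i) : ℝ) - a * π i t| ≤ a := by
    have h3 : (digitCount c t a (l i) : ℝ) ≤ a := by exact_mod_cast digitCount_le c t a (l i)
    have h4 := (hπ i).pos t
    have h5 := (hπ i).le_one t
    have h6 : (0 : ℝ) ≤ a := Nat.cast_nonneg a
    have h7 : (0 : ℝ) ≤ digitCount c t a (l i) := Nat.cast_nonneg _
    rw [abs_le]
    constructor <;> nlinarith
  rw [div_sub' hab'.ne', abs_div, abs_of_pos hab', div_le_iff₀ hab', mul_comm e]
  refine le_trans (le_trans (le_of_eq ?_) (abs_add_le _ _)) ((add_le_add h2 h1).trans he)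
  push_cast
  ring_nf

/-- The copy in `L` of a balanced point is interior to the cube, hence covered by arbitrarily small
balls, and being balanced makes their centres typical. The ceiling of `δ log_c(1/λ)` exceeds `δ (j +
1)` by at most one, which gives the level bound for the child. -/
theorem isUbiquitous_isTypicalAt (hc : 2 ≤ c) (hπ : ∀ i, IsPosProb (π i)) (hδ : 1 ≤ δ)
    (hx : ∀ n, x n ∈ Set.Icc 0 1) (hlam : ∀ n, 0 < lam n) (h0 : Tendsto lam atTop (𝓝 0))
    (hcover : ∀ y : Fin d → ℝ, (∀ i, y i ∈ Set.Ioo 0 1) →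
      ∃ᶠ n in atTop, y ∈ Metric.closedBall (x n) (lam n / 2)) :
    IsUbiquitous c (balancedFrom π n₀) δ
      (fun J => ∃ n, IsTypicalAt π x lam (fun n => freqError (radiusLevel c (lam n))) J n)
      (contractedNode π x lam (fun n => freqError (radiusLevel c (lam n))) δ) := by
  have hc0 : 0 < c := by omega
  refine ⟨?_, ?_, ?_, ?_⟩
  · rintro ⟨a, l⟩ hL y hy N
    have hy01 := mem_Ioo_of_mem_balancedFrom hc0 hy
    obtain ⟨B, hB⟩ := eventually_atTop.1 (eventually_add_lilBound_le a)
    have hu : ∀ i, boxEmbed c a l y i ∈ Set.Ioo 0 1 := by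
      intro i
      have h1 : (l i : ℝ) + 1 ≤ (c : ℝ) ^ a := by exact_mod_cast hL i
      have h2 : (0 : ℝ) < (c : ℝ) ^ a := pow_pos (by exact_mod_cast hc0) a
      have h3 := hy01 i
      have h4 : (0 : ℝ) ≤ l i := Nat.cast_nonneg _
      exact ⟨div_pos (by linarith [h3.1]) h2, (div_lt_one h2).2 (by linarith [h3.2])⟩
    obtain ⟨n, hn, hn1, hn2⟩ := ((hcover _ hu).and_eventually
      ((h0.eventually_le_const zero_lt_one).and ((tendsto_radiusLevel hc hlam h0).eventually_ge_atTop
        (a + (N + n₀ + B + 1))))).exists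
    obtain ⟨b, hb⟩ := Nat.exists_eq_add_of_le ((Nat.le_add_right a _).trans hn2)
    obtain ⟨k, hk, hpre⟩ := exists_relative_neighbor (b := b) (l := l) (by omega) hy
      (k := fun i => digitPrefix c (a + b) (x n i)) fun i => by
        rw [← boxIndex_boxEmbed hc0 a b l (fun i => (hy01 i).1.le) i]
        refine abs_digitPrefix_sub_le hc0 _ ((hx n).1 i) ⟨(hu i).1.le, (hu i).2⟩ ?_
        rw [← Real.dist_eq]
        refine (dist_le_pi_dist _ _ i).trans ((Metric.mem_closedBall.1 hn).trans ?_)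
        rw [← hb]
        exact div_le_div_of_nonneg_right (pow_radiusLevel_le hc (hlam n) hn1) (by norm_num)
    refine ⟨b, by omega, k, hk, n, hn1, hb, hpre, ?_⟩
    refine digitCondition_of_balanced hc0 hπ (by omega) hy hk (hx n) hpre hb ?_ (by omega)
    simp only [hb]
    exact hB b (by omega)
  · intro J hJ
    obtain ⟨n, ⟨hn1, hlev, hpre, -⟩, heq⟩ := exists_contractedNode_eq (δ := δ) hJ
    have hl := logb_inv_nonneg hc (hlam n) hn1
    have hle : J.1 ≤ ⌈δ * Real.logb c (lam n)⁻¹⌉₊ := by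
      rw [← hlev]
      exact (Nat.floor_le_ceil _).trans (Nat.ceil_mono (le_mul_of_one_le_left hl hδ))
    rw [heq]
    refine ⟨hle, fun i => ?_⟩
    have := digitPrefix_div hc0 J.1 (⌈δ * Real.logb c (lam n)⁻¹⌉₊ - J.1)
      (⟨(hx n).1 i, (hx n).2 i⟩ : x n i ∈ Set.Icc 0 1)
    rw [Nat.add_sub_cancel' hle] at this
    rw [← congrFun hpre i]
    exact this
  · intro J hJ
    obtain ⟨n, -, heq⟩ := exists_contractedNode_eq (δ := δ) hJ
    rw [heq]
    exact fun i => digitPrefix_lt hc0 _ _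
  · intro J hJ
    obtain ⟨n, ⟨hn1, hlev, -, -⟩, heq⟩ := exists_contractedNode_eq (δ := δ) hJ
    have hl := logb_inv_nonneg hc (hlam n) hn1
    rw [heq, ← hlev]
    refine (Nat.ceil_lt_add_one (by positivity)).le.trans ?_
    have := (Nat.lt_floor_add_one (Real.logb c (lam n)⁻¹)).le
    gcongr
    exact this

/-- The contracted box has side at most `lam n ^ δ` and its closure contains the centre, so it lies
in the contracted ball. -/
theorem mem_digitLimsup_of_contractedNode (hc : 2 ≤ c) (hx : ∀ n, x n ∈ Set.Icc 0 1)
    (hlam : ∀ n, 0 < lam n) (hanti : Antitone lam) {z : Fin d → ℝ}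
    (hz : ∀ n : ℕ, ∃ J : Node d, n ≤ J.1 ∧ (∃ m, IsTypicalAt π x lam ε J m) ∧
      z ∈ closedBox c (contractedNode π x lam ε δ J)) :
    z ∈ digitLimsup π x lam ε δ := by
  have hc1 : (1 : ℝ) < c := by exact_mod_cast (by omega : 1 < c)
  refine frequently_atTop.2 fun M => ?_
  -- A generation strictly above that of `lam M` forces the index of the ball beyond `M`, as `lam`
  -- is non-increasing.
  obtain ⟨J, hJ, hhit, hzJ⟩ := hz (radiusLevel c (lam M) + 1)
  obtain ⟨n, ⟨hn1, hlev, -, hdig⟩, heq⟩ := exists_contractedNode_eq (δ := δ) hhit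
  refine ⟨n, ?_, hdig, ?_⟩
  · by_contra! hlt
    have := radiusLevel_anti hc (hlam M) (hanti hlt.le)
    omega
  · rw [heq] at hzJ
    refine closedBox_digitPrefix_subset (by omega) _ (hx n) ?_ hzJ
    rw [inv_le_comm₀ (by positivity) (Real.rpow_pos_of_pos (hlam n) δ), ← Real.inv_rpow (hlam n).le,
      ← Real.rpow_natCast, ← Real.logb_le_iff_le_rpow hc1 (Real.rpow_pos_of_pos
        (inv_pos.2 (hlam n)) _), Real.logb_rpow_eq_mul_logb_of_pos (inv_pos.2 (hlam n))]
    exact Nat.le_ceil _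

end Ubiquity

end

/-! ### Assembly of the estimates -/

/-- Balls with typical centres carry, after contraction, a measure of the expected dimension. -/
theorem exists_measure_digitLimsup {d c : ℕ} (hc : 2 ≤ c) {π : Fin d → Fin c → ℝ}
    (hπ : ∀ i, IsPosProb (π i)) {φ : ℝ → ℝ} (hφ0 : ∀ r, 0 ≤ φ r)
    (hφm : Monotone (gaugeLevel c φ)) (hφt : Tendsto (gaugeLevel c φ) atTop atTop)
    (hφ : ∀ᶠ j : ℕ in atTop, logSize π * (7 * lilBound j) ≤ gaugeLevel c φ j)
    (hanti : AntitoneOn (fun r : ℝ => r ^ (-φ r)) (Set.Ioc 0 1))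
    {x : ℕ → Fin d → ℝ} {lam : ℕ → ℝ} (hx : ∀ n, x n ∈ Set.Icc 0 1) (hlam : ∀ n, 0 < lam n)
    (hlam' : Antitone lam) (h0 : Tendsto lam atTop (𝓝 0))
    (hcover : ∀ y : Fin d → ℝ, (∀ i, y i ∈ Set.Ioo 0 1) →
      ∃ᶠ n in atTop, y ∈ Metric.closedBall (x n) (lam n / 2)) {δ : ℝ} (hδ : 1 ≤ δ) :
    ∃ mδ : Measure (Fin d → ℝ), IsFiniteMeasure mδ ∧
      0 < mδ (digitLimsup π x lam (fun n => freqError (radiusLevel c (lam n))) δ) ∧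
      ∀ y, limsup (fun r : ℝ => mδ (Metric.closedBall y r) / ENNReal.ofReal
        (r ^ ((∑ i, vecEntropy (π i)) / δ - (4 + (d : ℝ)) * φ r))) (𝓝[>] 0) < ∞ := by
  obtain ⟨n₀, hn₀, hhalf⟩ :=
    ((eventually_forall_ge_atTop.2 hφ).and (eventually_half_le_balancedFrom hc hπ)).exists
  have h : IsControlled π φ n₀ := ⟨hφ0, hφm, hφt, hn₀, hhalf⟩
  obtain ⟨N, hN⟩ := h.exists_isLate
  have H := isUbiquitous_isTypicalAt (n₀ := n₀) hc hπ hδ hx hlam h0 hcover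
  have := h.isProbabilityMeasure_pathLaw hπ (N := N)
    (Hit := fun J => ∃ n, IsTypicalAt π x lam (fun n => freqError (radiusLevel c (lam n))) J n)
    (child := contractedNode π x lam (fun n => freqError (radiusLevel c (lam n))) δ)
  exact ⟨_, inferInstance, h.pathLaw_pos hN.one_le (by omega) hπ H fun z hz =>
    mem_digitLimsup_of_contractedNode hc hx hlam hlam' hz,
    fun y => h.limsup_pathLaw_lt_top hN hc hπ hδ H hanti y⟩

theorem mainTheorem8 (d c : ℕ) (hd : 1 ≤ d) (hc : 2 ≤ c) (p : Fin d → Fin c → ℝ)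
    (hpos : ∀ i k, 0 < p i k) (hsum : ∀ i, ∑ k, p i k = 1) (q : ℝ) :
    (∀ s : ℝ, tauSpectrum c (productMultinomial p) s =
      ((∑ i, tauVector (p i) s : ℝ) : EReal)) ∧
    ∃ α β : ℝ, 0 < α ∧ 0 < β ∧ β ≤ d ∧
      HasDerivAt (fun s => (tauSpectrum c (productMultinomial p) s).toReal) α q ∧
      tauLegendre c (productMultinomial p) α = (β : EReal) ∧
      (productMultinomial p).support = Set.Icc 0 1 ∧
      (productMultinomial (fun i => tilt (p i) q)).support = Set.Icc 0 1 ∧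
      ∀ γ > (1 / 2 : ℝ), ∃ C > 0, ∃ φ ψ : ℝ → ℝ,
        GaugePair φ ψ ∧
        (∀ᶠ r in 𝓝[>] (0 : ℝ), φ r = gaugePhi C r) ∧
        (∀ᶠ r in 𝓝[>] (0 : ℝ), ψ r = gaugePsi C γ r) ∧
        LocalScaling c (productMultinomial p) (productMultinomial (fun i => tilt (p i) q)) α ψ ∧
        LocalMassBound c (productMultinomial (fun i => tilt (p i) q)) β φ ∧
        (∃ mL : ℕ → (Fin d → ℕ) → Measure (Fin d → ℝ),
          (∀ (j : ℕ) (k : Fin d → ℕ), (∀ i, k i < c ^ j) →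
            (mL j k).map (boxMap c j k) = productMultinomial (fun i => tilt (p i) q)) ∧
          SelfSimilarCopies c (productMultinomial (fun i => tilt (p i) q)) β φ mL ∧
          UniformGrowthControl c β φ mL) ∧
        ∀ (x : ℕ → Fin d → ℝ) (lam : ℕ → ℝ),
          (∀ n, x n ∈ Set.Icc 0 1) → (∀ n, 0 < lam n) → Antitone lam →
          Tendsto lam atTop (𝓝 0) →
          (∀ y : Fin d → ℝ, (∀ i, y i ∈ Set.Ioo 0 1) →
            ∃ᶠ n in atTop, y ∈ Metric.closedBall (x n) (lam n / 2)) →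
          ∃ ε : ℕ → ℝ, (∀ n, 0 < ε n) ∧ Antitone ε ∧ Tendsto ε atTop (𝓝 0) ∧
            ∀ δ : ℝ, 1 ≤ δ → ∃ mδ : Measure (Fin d → ℝ), IsFiniteMeasure mδ ∧
              0 < mδ (digitLimsup (fun i => tilt (p i) q) x lam ε δ) ∧
              ∀ y ∈ digitLimsup (fun i => tilt (p i) q) x lam ε δ,
                limsup (fun r : ℝ => mδ (Metric.closedBall y r) /
                  ENNReal.ofReal (r ^ (β / δ - (4 + (d : ℝ)) * φ r))) (𝓝[>] 0) < ∞ := by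
  have hp : ∀ i, IsPosProb (p i) := fun i => ⟨hpos i, hsum i⟩
  have hπ : ∀ i, IsPosProb (tilt (p i) q) := fun i => isPosProb_tilt (hp i) hc q
  have hlogc : 0 < Real.log c := Real.log_pos (by exact_mod_cast (by omega : 1 < c))
  refine ⟨tauSpectrum_productMultinomial hp hc, tauSlope p q, tiltEntropy p q,
    tauSlope_pos hd hc hp q, tiltEntropy_pos hd hc hp q, tiltEntropy_le hc hp q,
    hasDerivAt_tauSpectrum hc hp q, tauLegendre_productMultinomial hc hp q,
    productMultinomial_support hp hc, productMultinomial_support hπ hc, fun γ hγ => ?_⟩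
  set π : Fin d → Fin c → ℝ := fun i => tilt (p i) q
  have hBp := logSize_nonneg p
  have hBπ := logSize_nonneg π
  -- One `C` must serve `ψ`, which controls the weights `p`, and `φ`, which controls the weights
  -- `π`. The `7` is that of `BalancedWord`.
  obtain ⟨C, hC, hCp, hCπ⟩ : ∃ C > 0, 2 * (logSize p * 7) * (1 + Real.log c) ≤ C ∧
      2 * (logSize π * 7) * (1 + Real.log c) ≤ C :=
    ⟨2 * (logSize p * 7) * (1 + Real.log c) + 2 * (logSize π * 7) * (1 + Real.log c) + 1,
      by positivity, by linarith [show 0 ≤ 2 * (logSize π * 7) * (1 + Real.log c) by positivity],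
      by linarith [show 0 ≤ 2 * (logSize p * 7) * (1 + Real.log c) by positivity]⟩
  have Hφ := gaugeGen_genPhi hC
  have Hψ := gaugeGen_genPsi hC hγ
  have hφ : ∀ᶠ j : ℕ in atTop, logSize π * (7 * lilBound j) ≤
      gaugeLevel c (gaugeOf (genPhi C) (Real.exp (Real.exp 1))) j := by
    simpa only [mul_assoc] using
      eventually_lilBound_le_gaugePhi hc (by positivity) hCπ (Real.exp (Real.exp 1))
  have hψ : ∀ᶠ j : ℕ in atTop, logSize p * (7 * lilBound j) ≤
      gaugeLevel c (gaugeOf (genPsi C γ) (Real.exp (2 * γ))) j := by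
    simpa only [mul_assoc] using
      eventually_lilBound_le_gaugePsi hc (by positivity) hCp hγ (Real.exp (2 * γ))
  refine ⟨C, hC, gaugeOf (genPhi C) (Real.exp (Real.exp 1)),
    gaugeOf (genPsi C γ) (Real.exp (2 * γ)), Hφ.gaugePair Hψ, gaugeOf_eventuallyEq _ _,
    gaugeOf_eventuallyEq _ _, localScaling_of_gauge hd hc hp hπ hψ,
    localMassBound_of_gauge hd hc hπ hφ, ⟨boxCopy π, fun j k _ =>
      map_boxMap_boxCopy (by omega) π j k, selfSimilarCopies_boxCopy hd hc hπ hφ,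
      uniformGrowthControl_boxCopy hd hc hπ Hφ.gaugeOf_nonneg hφ (Hφ.tendsto_gaugeLevel hc)⟩,
    fun x lam hx hlam hlam' h0 hcover => ?_⟩
  -- The errors depend only on the radii, so they are chosen before `δ`.
  refine ⟨fun n => freqError (radiusLevel c (lam n)), fun n => freqError_pos _,
    fun m n hmn => antitone_freqError (radiusLevel_anti hc (hlam n) (hlam' hmn)),
    tendsto_freqError.comp (tendsto_radiusLevel hc hlam h0), fun δ hδ => ?_⟩
  obtain ⟨mδ, hfin, hmpos, hlim⟩ := exists_measure_digitLimsup hc hπ Hφ.gaugeOf_nonneg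
    (Hφ.monotone_gaugeLevel hc) (Hφ.tendsto_gaugeLevel hc) hφ Hφ.antitoneOn_rpow_neg hx hlam hlam'
    h0 hcover hδ
  exact ⟨mδ, hfin, hmpos, fun y _ => hlim y⟩
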